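/- Let $d\ge 1$ and $W^d=\{x\in\mathbb R^d: x_1<\dots<x_d\}$. There is a constant $C$, depending only on $d$, such that the following holds for every $\lambda>0$. Let $(X_{ij})_{i\ge1,\,1\le j\le d}$ be independent exponential random variables, all of rate $\lambda$. For $x\in W^d$ let $\mathbb P_x$ refer to the random walk $S_j(n)=x_j+\sum_{i=1}^nX_{ij}$, $1\le j\le d$, $n\ge 0$, started from $S(0)=x$. Write $a\prec b$ if $a_1\le b_1\le a_2\le b_2\le\dots\le a_d\le b_d$, and put $$\tau=\inf\{n\ge1:S(n)\notin W^d\},\qquad \rho=\inf\{n\ge1:S(n-1)\not\prec S(n)\}.$$ Let $\Delta(x)=\prod_{1\le i<j\le d}(x_j-x_i)$ and $h(x)=\mathbb E[\Delta(x_1+\eta_1,\dots,x_d+\eta_d)]$, where $\eta_1=0$ and $\eta_2,\dots,\eta_d$ are independent, $\eta_j$ having the Gamma distribution with shape $j-1$ and rate $\lambda$; let $\hat h(z)=h(-z_d,\dots,-z_1)$. Then for all $x\in W^d$ and all integers $n\ge d+1$: (i) $$\mathbb P_x(\tau>n)\le C\lambda^{d(d-1)/2}\,\frac{h(x)}{n^{d(d-1)/4}},\qquad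 \mathbb P_x(\rho>n)\le C\lambda^{d(d-1)/2}\,\frac{\Delta(x)}{n^{d(d-1)/4}}.$$ (ii) The measures $\mathbb P_x(S(n+d)\in dz,\ \tau>n+d)$ and $\mathbb P_x(S(n)\in dz,\ \rho>n)$ have continuous densities $G_{n+d}(x,z)$ and $\widetilde G_n(x,z)$ with respect to Lebesgue measure on $W^d$, and for all $z\in W^d$ $$G_{n+d}(x,z)\le C\lambda^{d^2}\,\frac{h(x)\,\hat h(z)}{n^{d^2/2}},\qquad \widetilde G_n(x,z)\le C\lambda^{d^2}\,\frac{\Delta(x)\,\Delta(z)}{n^{d^2/2}}.$$ -/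

import Mathlib

open MeasureTheory ProbabilityTheory

namespace OrderedWalk

/-- The Weyl chamber `W^d = {x : x_1 < ... < x_d}`. -/
def weylChamber (d : ℕ) : Set (Fin d → ℝ) := {x | StrictMono x}

/-- `a ≺ b`, that is `a_1 ≤ b_1 ≤ a_2 ≤ b_2 ≤ ... ≤ a_d ≤ b_d`. -/
def Interlace {d : ℕ} (a b : Fin d → ℝ) : Prop :=
  (∀ j, a j ≤ b j) ∧ ∀ i j : Fin d, (i : ℕ) + 1 = (j : ℕ) → b i ≤ a j

/-- The Vandermonde product `Δ(x) = ∏_{i<j} (x_j - x_i)`. -/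
def vandermonde {d : ℕ} (x : Fin d → ℝ) : ℝ :=
  ∏ i, ∏ j ∈ Finset.Ioi i, (x j - x i)

/-- The walk `S_j(n) = x_j + X_{1j} + ... + X_{nj}` started from `x`
(the increments are indexed from `0` in Lean). -/
def walk {d : ℕ} {Ω : Type*} (X : ℕ → Fin d → Ω → ℝ) (x : Fin d → ℝ) (n : ℕ) (ω : Ω) :
    Fin d → ℝ :=
  fun j => x j + ∑ i ∈ Finset.range n, X i j ω

/-- `τ = inf {n ≥ 1 : s(n) ∉ W^d}` for a path `s`; it is `⊤` if there is no such `n`. -/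
noncomputable def tau {d : ℕ} (s : ℕ → Fin d → ℝ) : ℕ∞ :=
  sInf ((fun n : ℕ => (n : ℕ∞)) '' {n | 1 ≤ n ∧ s n ∉ weylChamber d})

/-- `ρ = inf {n ≥ 1 : s(n-1) ⊀ s(n)}` for a path `s`; it is `⊤` if there is no such `n`. -/
noncomputable def rho {d : ℕ} (s : ℕ → Fin d → ℝ) : ℕ∞ :=
  sInf ((fun n : ℕ => (n : ℕ∞)) '' {n | 1 ≤ n ∧ ¬ Interlace (s (n - 1)) (s n)})

/-- The event `{τ > n}` for the walk started from `x`. -/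
def tauGt {d : ℕ} {Ω : Type*} (X : ℕ → Fin d → Ω → ℝ) (x : Fin d → ℝ) (n : ℕ) : Set Ω :=
  {ω | (n : ℕ∞) < tau (fun k => walk X x k ω)}

/-- The event `{ρ > n}` for the walk started from `x`. -/
def rhoGt {d : ℕ} {Ω : Type*} (X : ℕ → Fin d → Ω → ℝ) (x : Fin d → ℝ) (n : ℕ) : Set Ω :=
  {ω | (n : ℕ∞) < rho (fun k => walk X x k ω)}

/-- The law of `η = (η_1, ..., η_d)`: independent coordinates, `η_1 = 0` and `η_j` distributed
as Gamma with shape `j - 1` and rate `lam` for `j ≥ 2` (the Lean index is `j - 1`). -/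
noncomputable def etaLaw (d : ℕ) (lam : ℝ) : Measure (Fin d → ℝ) :=
  Measure.pi fun j : Fin d =>
    if (j : ℕ) = 0 then Measure.dirac 0 else gammaMeasure ((j : ℕ) : ℝ) lam

/-- `h(x) = E[Δ(x_1 + η_1, ..., x_d + η_d)]`. -/
noncomputable def harm {d : ℕ} (lam : ℝ) (x : Fin d → ℝ) : ℝ :=
  ∫ η, vandermonde (x + η) ∂(etaLaw d lam)

/-- `ĥ(z_1, ..., z_d) = h(-z_d, ..., -z_1)`. -/
noncomputable def harmHat {d : ℕ} (lam : ℝ) (z : Fin d → ℝ) : ℝ :=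
  harm lam (fun j => -z j.rev)

/-- The sub-probability `B ↦ P_x(S(n) ∈ B, A)`. -/
noncomputable def killedLaw {d : ℕ} {Ω : Type*} [MeasurableSpace Ω] (μ : Measure Ω)
    (X : ℕ → Fin d → Ω → ℝ) (x : Fin d → ℝ) (n : ℕ) (A : Set Ω) : Measure (Fin d → ℝ) :=
  (μ.restrict A).map (walk X x n)

/-- `g` is the continuous density of `ν` on the Weyl chamber: `ν(dz) = g(z) dz`, where `ν`
does not charge the complement of the chamber. Since the chamber is open, `g` is uniquely
determined on it by `ν`. -/
def IsContinuousDensity {d : ℕ} (ν : Measure (Fin d → ℝ)) (g : (Fin d → ℝ) → ℝ) : Prop :=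
  ContinuousOn g (weylChamber d) ∧ (∀ z ∈ weylChamber d, 0 ≤ g z) ∧
    ν = (volume.restrict (weylChamber d)).withDensity (fun z => ENNReal.ofReal (g z))

end OrderedWalk

/-!
The proof replaces the two killed walks by products of elementary operators and reads everything
off from commutation relations between them.

A time step of either walk moves the `d` particles one after the other. Moving them from left to
right (`ascWord`), and killing when the order breaks at an intermediate moment, gives the walk
killed at `ρ`; moving them from right to left (`descTop`) gives the walk killed at `τ`, because no
order can break at an intermediate moment unless it is broken at the end. The operators `jumpOp`
of single killed jumps commute for non-adjacent particles, and this alone yields the exchange of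
sweeps `descTop ^ (d - 1 + k) = P * ascWord ^ k * B` and `ascWord ^ (d - 1 + k) = B * descTop ^ k *
P` with fixed triangular words `P` (`triTop`) and `B` (`triWord`): `descTop_pow_eq` and
`ascWord_pow_eq`. The words `B` and `P` are adjoint to each other under the reflection of the
chamber (`isReflAdjoint_triWord`).

By lack of memory, a killed jump acts on averages of antisymmetric functions over Gamma variables
like a free jump, provided the blocking particle has exactly one more jump to come
(`integral_indicator_gammaAvg`): a blocked jump restarts from the blocking particle, and the two
particles then contribute a term that is antisymmetric and vanishes. The ascending order of the
jumps, and the triangular order in `P`, keep this condition true. Hence `P` applied to `Δ` is `h`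
(`triTop_pred_vandermonde`), and the walk killed at `ρ` has the transition density
`det (f (z j - x i))` at time `m + 1`, where `f` is the Gamma density of shape `m + 1`
(`ascWord_pow_succ_apply`).

The decay in time comes from divided differences. With the triangular matrix `newtonMatrix` at the
starting points and at the end points, the determinant becomes `Δ(x) Δ(z)` times a determinant of
divided differences of order `(i, j)`, each bounded by the derivative `f⁽ⁱ⁺ʲ⁾`; this is
`kernDet_le_scale`. With divided differences in the starting points only, and the integral over
`z`, one gets the tail of `ρ` (`setLIntegral_kernDet_le`). Since a Gamma law is a convolution of
many Gamma laws of comparable shape, and consecutive Gamma laws of shape `b` differ by `1 / √b` in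
total variation, each derivative gains a factor `lam / √m` in `L¹`
(`integral_abs_gammaDeriv_le_sqrt`), and the supremum norm is the `L¹` norm of one more derivative.

The results for `τ` follow by applying `P` to those for `ρ` (`descTop_pow_one_le`, `tauDens_le`).
For the finitely many small times the density `f` is not smooth enough for divided differences;
there the words `B` and `P` alone already give the factors `Δ(x)` and `Δ(z)`
(`kernDet_le_uniform`).
-/

namespace OrderedWalk

open scoped ENNReal

/-! ### Words in partially commuting generators -/

section Words

variable {M : Type*} [Monoid M] (K : ℕ → M) (d : ℕ)

/-- The ascending word `K 0 * K 1 * ⋯ * K (m - 1)`. -/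
def ascWord : ℕ → M
  | 0 => 1
  | m + 1 => ascWord m * K m

/-- The triangular word `ascWord m * ascWord (m - 1) * ⋯ * ascWord 1`. -/
def triWord : ℕ → M
  | 0 => 1
  | m + 1 => ascWord K (m + 1) * triWord m

/-- The descending word `K (d - 1) * K (d - 2) * ⋯ * K (d - l)` in the top `l` letters. -/
def descTop : ℕ → M
  | 0 => 1
  | l + 1 => descTop l * K (d - 1 - l)

/-- The ascending word `K (d - l) * ⋯ * K (d - 1)` in the top `l` letters. -/
def ascTop : ℕ → M
  | 0 => 1
  | l + 1 => K (d - 1 - l) * ascTop l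

/-- The triangular word `ascTop 1 * ascTop 2 * ⋯ * ascTop l`. -/
def triTop : ℕ → M
  | 0 => 1
  | l + 1 => triTop l * ascTop K d (l + 1)

variable {K} {d}

lemma commute_ascWord (hK : ∀ i j, i + 2 ≤ j → Commute (K i) (K j)) (m j : ℕ) (h : m + 1 ≤ j) :
    Commute (ascWord K m) (K j) := by
  induction m with
  | zero => exact Commute.one_left _
  | succ m ih => exact (ih (by omega)).mul_left (hK _ _ (by omega))

lemma commute_descTop {w : M} {l : ℕ} (hw : ∀ i < l, Commute w (K (d - 1 - i))) :
    Commute w (descTop K d l) := by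
  induction l with
  | zero => exact Commute.one_right _
  | succ l ih => exact (ih fun i hi => hw i (by omega)).mul_right (hw l (by omega))

lemma commute_ascTop {w : M} {l : ℕ} (hw : ∀ i < l, Commute w (K (d - 1 - i))) :
    Commute w (ascTop K d l) := by
  induction l with
  | zero => exact Commute.one_right _
  | succ l ih => exact (hw l (by omega)).mul_right (ih fun i hi => hw i (by omega))

lemma commute_triTop {w : M} {l : ℕ} (hw : ∀ i < l, Commute w (K (d - 1 - i))) :
    Commute w (triTop K d l) := by
  induction l with
  | zero => exact Commute.one_right _
  | succ l ih => exact (ih fun i hi => hw i (by omega)).mul_right (commute_ascTop hw)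

/-- The last `m + 1` letters of the descending word extend the triangular word to the next one, and
the letters before them move to the front. -/
lemma triWord_mul_descTop (hK : ∀ i j, i + 2 ≤ j → Commute (K i) (K j)) (m : ℕ) (hm : m < d) :
    triWord K m * descTop K d d = descTop K d (d - m - 1) * triWord K (m + 1) := by
  induction m with
  | zero =>
    obtain ⟨e, rfl⟩ : ∃ e, d = e + 1 := ⟨d - 1, by omega⟩
    simp [triWord, ascWord, descTop]
  | succ m ih =>
    have h1 : descTop K d (d - m - 1) = descTop K d (d - (m + 1) - 1) * K (m + 1) := by
      obtain ⟨e, rfl⟩ : ∃ e, d = m + 2 + e := ⟨d - (m + 2), by omega⟩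
      have e1 : m + 2 + e - m - 1 = e + 1 := by omega
      have e2 : m + 2 + e - (m + 1) - 1 = e := by omega
      have e3 : m + 2 + e - 1 - e = m + 1 := by omega
      rw [e1, e2, descTop, e3]
    have h2 : Commute (ascWord K (m + 1)) (descTop K d (d - (m + 1) - 1)) :=
      commute_descTop fun i hi => commute_ascWord hK _ _ (by omega)
    calc triWord K (m + 1) * descTop K d d
        = ascWord K (m + 1) * (triWord K m * descTop K d d) := by simp [triWord, mul_assoc]
      _ = ascWord K (m + 1) * descTop K d (d - (m + 1) - 1) * K (m + 1) * triWord K (m + 1) := by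
          rw [ih (by omega), h1]; simp [mul_assoc]
      _ = descTop K d (d - (m + 1) - 1) * (ascWord K (m + 1) * K (m + 1) * triWord K (m + 1)) := by
          rw [h2.eq]; simp [mul_assoc]
      _ = _ := rfl

/-- The triangular word intertwines the descending and the ascending full words. -/
lemma triWord_mul_descTop_pow (hK : ∀ i j, i + 2 ≤ j → Commute (K i) (K j)) (hd : 1 ≤ d) (k : ℕ) :
    triWord K (d - 1) * descTop K d d ^ k = ascWord K d ^ k * triWord K (d - 1) := by
  have h : triWord K (d - 1) * descTop K d d = ascWord K d * triWord K (d - 1) := by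
    rw [triWord_mul_descTop hK (d - 1) (by omega)]
    obtain ⟨e, rfl⟩ : ∃ e, d = e + 1 := ⟨d - 1, by omega⟩
    simp [descTop, triWord]
  induction k with
  | zero => simp
  | succ k ih => rw [pow_succ, ← mul_assoc, ih, mul_assoc, h, pow_succ, mul_assoc]

lemma descTop_mul_triTop (hK : ∀ i j, i + 2 ≤ j → Commute (K i) (K j)) (l : ℕ) (hl : l + 1 ≤ d) :
    descTop K d (l + 1) * triTop K d l = triTop K d (l + 1) := by
  induction l with
  | zero => simp [descTop, triTop, ascTop]
  | succ l ih =>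
    have h : Commute (K (d - 1 - (l + 1))) (triTop K d l) :=
      commute_triTop fun i hi => hK _ _ (by omega)
    calc descTop K d (l + 1 + 1) * triTop K d (l + 1)
        = descTop K d (l + 1) * (K (d - 1 - (l + 1)) * triTop K d l) * ascTop K d (l + 1) := by
          simp [descTop, triTop, mul_assoc]
      _ = (descTop K d (l + 1) * triTop K d l) * (K (d - 1 - (l + 1)) * ascTop K d (l + 1)) := by
          rw [h.eq]; simp [mul_assoc]
      _ = _ := by rw [ih (by omega)]; rfl

/-- Powers of the descending word, rearranged: a triangular prefix, ascending words, and a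
triangular suffix. -/
lemma descTop_pow_eq (hK : ∀ i j, i + 2 ≤ j → Commute (K i) (K j)) (hd : 1 ≤ d) (k : ℕ) :
    descTop K d d ^ (d - 1 + k) = triTop K d (d - 1) * ascWord K d ^ k * triWord K (d - 1) := by
  have key : ∀ m ≤ d - 1, ∃ X : M, descTop K d d ^ m = X * triWord K m ∧
      X * triTop K d (d - 1 - m) = triTop K d (d - 1) := by
    intro m
    induction m with
    | zero => exact fun _ => ⟨1, by simp [triWord]⟩
    | succ m ih =>
      intro hm
      obtain ⟨X, h1, h2⟩ := ih (by omega)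
      refine ⟨X * descTop K d (d - m - 1), ?_, ?_⟩
      · rw [pow_succ, h1, mul_assoc, triWord_mul_descTop hK m (by omega), mul_assoc]
      · have e1 : d - m - 1 = (d - 1 - (m + 1)) + 1 := by omega
        have e2 : d - 1 - m = (d - 1 - (m + 1)) + 1 := by omega
        rw [mul_assoc, e1, descTop_mul_triTop hK _ (by omega), ← e2, h2]
  obtain ⟨X, h1, h2⟩ := key (d - 1) le_rfl
  have h3 : X = triTop K d (d - 1) := by simpa [triTop] using h2
  rw [pow_add, h1, h3, mul_assoc, triWord_mul_descTop_pow hK hd, mul_assoc]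

lemma ascWord_mul_ascTop (l : ℕ) (hl : l ≤ d) :
    ascWord K (d - l) * ascTop K d l = ascWord K d := by
  induction l with
  | zero => simp [ascTop]
  | succ l ih =>
    rw [← ih (by omega), ascTop, ← mul_assoc]
    have e : d - l = (d - (l + 1)) + 1 := by omega
    have e' : d - 1 - l = d - (l + 1) := by omega
    rw [e, ascWord, e']

lemma ascTop_self : ascTop K d d = ascWord K d := by
  simpa [ascWord] using ascWord_mul_ascTop (K := K) (d := d) d le_rfl

/-- Powers of the ascending word, rearranged: a triangular prefix, descending words, and a
triangular suffix. -/
lemma ascWord_pow_eq (hK : ∀ i j, i + 2 ≤ j → Commute (K i) (K j)) (hd : 1 ≤ d) (k : ℕ) :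
    ascWord K d ^ (d - 1 + k) = triWord K (d - 1) * descTop K d d ^ k * triTop K d (d - 1) := by
  have key : ∀ m ≤ d - 1, ∃ Z : M, ascWord K d ^ m = Z * triTop K d m ∧
      Z * triWord K (d - 1 - m) = triWord K (d - 1) := by
    intro m
    induction m with
    | zero => exact fun _ => ⟨1, by simp [triTop]⟩
    | succ m ih =>
      intro hm
      obtain ⟨Z, h1, h2⟩ := ih (by omega)
      refine ⟨Z * ascWord K (d - (m + 1)), ?_, ?_⟩
      · have hc : Commute (ascWord K (d - (m + 1))) (triTop K d m) :=
          commute_triTop fun i hi => commute_ascWord hK _ _ (by omega)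
        rw [pow_succ, h1, ← ascWord_mul_ascTop (K := K) (d := d) (m + 1) (by omega), mul_assoc,
          ← mul_assoc (triTop K d m), ← hc.eq, triTop]
        simp [mul_assoc]
      · have e2 : d - 1 - m = (d - 1 - (m + 1)) + 1 := by omega
        have e1 : d - (m + 1) = (d - 1 - (m + 1)) + 1 := by omega
        rw [← h2, e2, triWord, e1, mul_assoc]
  obtain ⟨Z, h1, h2⟩ := key (d - 1) le_rfl
  have h3 : Z = triWord K (d - 1) := by simpa [triWord] using h2
  rw [add_comm, pow_add, h1, h3, ← mul_assoc, triWord_mul_descTop_pow hK hd]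

end Words

/-! ### Single-particle jump operators -/

section Ops

variable {d : ℕ}

lemma isOpen_weylChamber : IsOpen (weylChamber d) := by
  have : weylChamber d = ⋂ i : Fin d, ⋂ j : Fin d, ⋂ _ : i < j, {x | x i < x j} := by
    ext x; simp [weylChamber, StrictMono]
  rw [this]
  refine isOpen_iInter_of_finite fun i => isOpen_iInter_of_finite fun j =>
    isOpen_iInter_of_finite fun _ => ?_
  exact isOpen_lt (continuous_apply i) (continuous_apply j)

lemma measurableSet_weylChamber : MeasurableSet (weylChamber d) :=
  isOpen_weylChamber.measurableSet

lemma ae_expMeasure_pos (lam : ℝ) : ∀ᵐ s ∂(expMeasure lam), 0 < s := by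
  rw [expMeasure, gammaMeasure, ae_withDensity_iff (by
    exact (measurable_gammaPDFReal 1 lam).ennreal_ofReal)]
  have : ∀ᵐ s : ℝ, s ≠ 0 := by simp [ae_iff]
  filter_upwards [this] with s hs h
  by_contra hcon
  exact h (gammaPDF_of_neg (lt_of_le_of_ne (not_lt.1 hcon) hs))

lemma expMeasure_le (lam : ℝ) :
    expMeasure lam ≤ ENNReal.ofReal lam • (volume : Measure ℝ) := by
  rw [expMeasure, gammaMeasure, ← withDensity_const]
  refine withDensity_mono (Filter.Eventually.of_forall fun s => ?_)
  change exponentialPDF lam s ≤ _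
  rw [exponentialPDF_eq]
  refine ENNReal.ofReal_le_ofReal_iff'.2 ?_
  split_ifs with h
  · rcases le_or_gt lam 0 with hl | hl
    · right; exact mul_nonpos_of_nonpos_of_nonneg hl (Real.exp_pos _).le
    · left
      exact mul_le_of_le_one_right hl.le (Real.exp_le_one_iff.2 (by nlinarith))
  · right; rfl

/-- Measurable functions with values in `[0, ∞]`. -/
abbrev MFun (d : ℕ) := {F : (Fin d → ℝ) → ℝ≥0∞ // Measurable F}

/-- The monoid, under composition, of operators on measurable functions with values in
`[0, ∞]`. -/
abbrev Op (d : ℕ) := Function.End (MFun d)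

lemma measurable_add_single (i : Fin d) :
    Measurable fun p : (Fin d → ℝ) × ℝ => p.1 + Pi.single i p.2 := by
  refine measurable_fst.add ?_
  refine measurable_pi_iff.2 fun j => ?_
  by_cases h : j = i
  · subst h; simpa using measurable_snd
  · simp [h]

/-- `F` averaged over an exponential jump of particle `i`, the walk being killed outside the
Weyl chamber, both before and after the jump. -/
noncomputable def jumpFun (lam : ℝ) (i : Fin d) (F : (Fin d → ℝ) → ℝ≥0∞) :
    (Fin d → ℝ) → ℝ≥0∞ :=
  (weylChamber d).indicator fun x =>
    ∫⁻ s, (weylChamber d).indicator F (x + Pi.single i s) ∂(expMeasure lam)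

instance sFinite_expMeasure (lam : ℝ) : SFinite (expMeasure lam) := by
  unfold expMeasure gammaMeasure; infer_instance

lemma measurable_jumpFun (lam : ℝ) (i : Fin d) {F : (Fin d → ℝ) → ℝ≥0∞} (hF : Measurable F) :
    Measurable (jumpFun lam i F) := by
  refine Measurable.indicator ?_ measurableSet_weylChamber
  exact Measurable.lintegral_prod_right'
    ((hF.indicator measurableSet_weylChamber).comp (measurable_add_single i))

/-- The operator of one killed exponential jump of particle `i`; the identity if there is no
such particle. -/
noncomputable def jumpOp (lam : ℝ) (i : ℕ) : Op d :=
  if h : i < d then fun F => ⟨jumpFun lam ⟨i, h⟩ F.1, measurable_jumpFun lam _ F.2⟩ else 1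

lemma jumpOp_apply (lam : ℝ) (i : Fin d) (F : MFun d) (x : Fin d → ℝ) :
    (jumpOp lam i F).1 x = jumpFun lam i F.1 x := by
  simp [jumpOp]

/-- A step back from a legal configuration stays legal: if two distant particles move forward and
the result is ordered, then so is the configuration where only the first one has moved. -/
lemma add_single_mem_of_add_add_mem {x : Fin d → ℝ} {i j : Fin d} {s t : ℝ}
    (hij : (i : ℕ) + 2 ≤ j ∨ (j : ℕ) + 2 ≤ i) (ht : 0 ≤ t) (hx : x ∈ weylChamber d)
    (h : x + Pi.single i s + Pi.single j t ∈ weylChamber d) :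
    x + Pi.single i s ∈ weylChamber d := by
  have hne : i ≠ j := by rintro rfl; omega
  intro a b hab
  have hab' := h hab
  simp only [Pi.add_apply, Pi.single_apply] at hab' ⊢
  have h1 : 0 ≤ if a = j then t else 0 := by split_ifs <;> simp [ht]
  by_cases hb : b = j
  · subst hb
    rw [if_neg (Ne.symm hne : ¬ b = i)]
    by_cases ha : a = i
    · subst ha
      have hlt : (a : ℕ) < b := hab
      have hc : (a : ℕ) + 1 < d := by have := b.2; omega
      let c : Fin d := ⟨a + 1, hc⟩
      have hac : a < c := by simp [c, Fin.lt_def]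
      have hcb : c < b := by simp only [c, Fin.lt_def]; omega
      have h2 := h hac
      have h3 := hx hcb
      simp only [Pi.add_apply, Pi.single_apply, hac.ne', hcb.ne, if_false, hne] at h2
      simp only [if_true] at h2 ⊢
      linarith
    · rw [if_neg ha]; have := hx hab; simpa using this
  · rw [if_neg hb] at hab'
    linarith

lemma jumpFun_jumpFun {lam : ℝ} {i j : Fin d} (hij : (i : ℕ) + 2 ≤ j ∨ (j : ℕ) + 2 ≤ i)
    (F : (Fin d → ℝ) → ℝ≥0∞) {x : Fin d → ℝ} (hx : x ∈ weylChamber d) :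
    jumpFun lam i (jumpFun lam j F) x = ∫⁻ s, ∫⁻ t,
      (weylChamber d).indicator F (x + Pi.single i s + Pi.single j t)
        ∂(expMeasure lam) ∂(expMeasure lam) := by
  unfold jumpFun
  rw [Set.indicator_of_mem hx]
  refine lintegral_congr fun s => ?_
  by_cases h : x + Pi.single i s ∈ weylChamber d
  · rw [Set.indicator_of_mem h, Set.indicator_of_mem h]
  · rw [Set.indicator_of_notMem h]
    symm
    rw [lintegral_eq_zero_of_ae_eq_zero]
    filter_upwards [ae_expMeasure_pos lam] with t ht
    refine Set.indicator_of_notMem (fun hmem => h ?_) _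
    exact add_single_mem_of_add_add_mem hij ht.le hx hmem

lemma commute_jumpOp (lam : ℝ) (i j : ℕ) (hij : i + 2 ≤ j) :
    Commute (jumpOp lam i : Op d) (jumpOp lam j) := by
  by_cases hj : j < d
  swap
  · have : (jumpOp lam j : Op d) = 1 := by simp [jumpOp, hj]
    rw [this]; exact Commute.one_right _
  have hi : i < d := by omega
  funext F
  apply Subtype.ext
  funext x
  change (jumpOp lam ((⟨i, hi⟩ : Fin d) : ℕ) (jumpOp lam ((⟨j, hj⟩ : Fin d) : ℕ) F)).1 x =
    (jumpOp lam ((⟨j, hj⟩ : Fin d) : ℕ) (jumpOp lam ((⟨i, hi⟩ : Fin d) : ℕ) F)).1 x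
  have e1 : ∀ a : Fin d, ∀ G : MFun d, (jumpOp lam a G).1 = jumpFun lam a G.1 :=
    fun a G => funext fun y => jumpOp_apply lam a G y
  rw [e1, e1, e1, e1]
  by_cases hx : x ∈ weylChamber d
  swap
  · simp [jumpFun, hx]
  rw [jumpFun_jumpFun (by left; exact hij) _ hx, jumpFun_jumpFun (by right; exact hij) _ hx]
  rw [lintegral_lintegral_swap]
  · refine lintegral_congr fun s => lintegral_congr fun t => ?_
    rw [add_right_comm]
  · refine Measurable.aemeasurable ?_
    refine (F.2.indicator measurableSet_weylChamber).comp ?_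
    exact (measurable_add_single _).comp
      (((measurable_add_single _).comp
        (measurable_const.prodMk measurable_fst)).prodMk measurable_snd)

/-- Operators given by sub-Markov kernels which, started in the Weyl chamber, stay in it. -/
def IsSubMarkov (w : Op d) : Prop :=
  ∃ κ : Kernel (Fin d → ℝ) (Fin d → ℝ), (∀ x, κ x Set.univ ≤ 1) ∧
    (∀ x ∈ weylChamber d, κ x (weylChamber d)ᶜ = 0) ∧
    ∀ (F : MFun d) x, (w F).1 x = ∫⁻ y, F.1 y ∂(κ x)

lemma isSubMarkov_one : IsSubMarkov (1 : Op d) := by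
  refine ⟨Kernel.id, fun x => by simp, fun x hx => ?_, fun F x => ?_⟩
  · rw [Kernel.id_apply, Measure.dirac_apply' _ measurableSet_weylChamber.compl]
    simp [hx]
  · rw [Kernel.id_apply, lintegral_dirac' _ F.2]; rfl

lemma IsSubMarkov.mul {w w' : Op d} (h : IsSubMarkov w) (h' : IsSubMarkov w') :
    IsSubMarkov (w * w') := by
  obtain ⟨κ, h1, h2, h3⟩ := h
  obtain ⟨κ', h1', h2', h3'⟩ := h'
  have happ : ∀ (F : MFun d) x, ((w * w') F).1 x = ∫⁻ y, F.1 y ∂((κ'.comp κ) x) := by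
    intro F x
    rw [Kernel.lintegral_comp _ _ _ F.2]
    change (w (w' F)).1 x = _
    rw [h3]
    exact lintegral_congr fun y => h3' F y
  refine ⟨κ'.comp κ, fun x => ?_, fun x hx => ?_, happ⟩
  · rw [Kernel.comp_apply' _ _ _ MeasurableSet.univ]
    calc ∫⁻ y, κ' y Set.univ ∂(κ x) ≤ ∫⁻ _, 1 ∂(κ x) := lintegral_mono fun y => h1' y
      _ ≤ 1 := by simpa using h1 x
  · rw [Kernel.comp_apply' _ _ _ measurableSet_weylChamber.compl]
    refine lintegral_eq_zero_of_ae_eq_zero ?_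
    filter_upwards [(ae_iff.2 (h2 x hx) : ∀ᵐ y ∂(κ x), y ∈ weylChamber d)] with y hy
    exact h2' y hy

lemma isSubMarkov_jumpOp {lam : ℝ} (hl : 0 < lam) (i : ℕ) : IsSubMarkov (jumpOp lam i : Op d) := by
  by_cases hi : i < d
  swap
  · have : (jumpOp lam i : Op d) = 1 := by simp [jumpOp, hi]
    rw [this]; exact isSubMarkov_one
  have hprob := isProbabilityMeasure_expMeasure hl
  lift i to Fin d using hi with k
  classical
  let m : (Fin d → ℝ) → Measure (Fin d → ℝ) := fun x =>
    if x ∈ weylChamber d then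
      ((expMeasure lam).map fun s => x + Pi.single k s).restrict (weylChamber d) else 0
  have hmeas1 : ∀ x : Fin d → ℝ, Measurable fun s : ℝ => x + Pi.single k s := fun x =>
    (measurable_add_single k).comp (measurable_const.prodMk measurable_id)
  have hm : ∀ (F : MFun d) x, jumpFun lam k F.1 x = ∫⁻ y, F.1 y ∂(m x) := by
    intro F x
    by_cases hx : x ∈ weylChamber d
    · simp only [m, if_pos hx, jumpFun, Set.indicator_of_mem hx]
      rw [← lintegral_indicator measurableSet_weylChamber, lintegral_map
        (F.2.indicator measurableSet_weylChamber) (hmeas1 x)]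
    · simp [m, jumpFun, hx]
  have hmm : Measurable m := by
    refine Measure.measurable_of_measurable_coe _ fun B hB => ?_
    have : (fun x => m x B) = jumpFun lam k (B.indicator 1) := by
      funext x
      rw [hm ⟨B.indicator 1, measurable_one.indicator hB⟩ x]
      rw [lintegral_indicator_one hB]
    rw [this]
    exact measurable_jumpFun lam k (measurable_one.indicator hB)
  refine ⟨⟨m, hmm⟩, fun x => ?_, fun x hx => ?_, fun F x => ?_⟩
  · change m x Set.univ ≤ 1
    simp only [m]
    split_ifs
    · refine (Measure.restrict_apply_le _ _).trans ?_
      rw [Measure.map_apply (hmeas1 x) MeasurableSet.univ]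
      exact prob_le_one
    · simp
  · change m x _ = 0
    simp only [m, if_pos hx]
    rw [Measure.restrict_apply measurableSet_weylChamber.compl]
    simp
  · rw [jumpOp_apply]; exact hm F x

section SubMarkov

variable {w : Op d} (hw : IsSubMarkov w)
include hw

lemma IsSubMarkov.mono {F G : MFun d} (h : ∀ y ∈ weylChamber d, F.1 y ≤ G.1 y)
    {x : Fin d → ℝ} (hx : x ∈ weylChamber d) : (w F).1 x ≤ (w G).1 x := by
  obtain ⟨κ, h1, h2, h3⟩ := hw
  rw [h3, h3]
  refine lintegral_mono_ae ?_
  filter_upwards [(ae_iff.2 (h2 x hx) : ∀ᵐ y ∂(κ x), y ∈ weylChamber d)] with y hy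
  exact h y hy

lemma IsSubMarkov.congr {F G : MFun d} (h : ∀ y ∈ weylChamber d, F.1 y = G.1 y)
    {x : Fin d → ℝ} (hx : x ∈ weylChamber d) : (w F).1 x = (w G).1 x :=
  le_antisymm (hw.mono (fun y hy => (h y hy).le) hx) (hw.mono (fun y hy => (h y hy).ge) hx)

lemma IsSubMarkov.const_mul (c : ℝ≥0∞) (F : MFun d) (x : Fin d → ℝ) :
    (w ⟨fun y => c * F.1 y, F.2.const_mul c⟩).1 x = c * (w F).1 x := by
  obtain ⟨κ, h1, h2, h3⟩ := hw
  rw [h3, h3]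
  exact lintegral_const_mul _ F.2

lemma IsSubMarkov.le_const {F : MFun d} {c : ℝ≥0∞} (h : ∀ y ∈ weylChamber d, F.1 y ≤ c)
    {x : Fin d → ℝ} (hx : x ∈ weylChamber d) : (w F).1 x ≤ c := by
  refine (hw.mono (G := ⟨fun _ => c, measurable_const⟩) h hx).trans ?_
  obtain ⟨κ, h1, h2, h3⟩ := hw
  rw [h3]
  calc ∫⁻ _, c ∂(κ x) = c * κ x Set.univ := lintegral_const c
    _ ≤ c * 1 := by gcongr; exact h1 x
    _ = c := mul_one c

lemma IsSubMarkov.lintegral_swap {Z : Type*} [MeasurableSpace Z] {ν : Measure Z} [SFinite ν]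
    (H : (Fin d → ℝ) → Z → ℝ≥0∞) (hH : Measurable (Function.uncurry H)) (x : Fin d → ℝ) :
    (w ⟨fun y => ∫⁻ z, H y z ∂ν, hH.lintegral_prod_right'⟩).1 x =
      ∫⁻ z, (w ⟨fun y => H y z, hH.comp (measurable_id.prodMk measurable_const)⟩).1 x ∂ν := by
  obtain ⟨κ, h1, h2, h3⟩ := hw
  have : IsFiniteKernel κ := ⟨⟨1, ENNReal.one_lt_top, h1⟩⟩
  simp only [h3]
  exact lintegral_lintegral_swap hH.aemeasurable

end SubMarkov

lemma isSubMarkov_ascWord {K : ℕ → Op d} (hK : ∀ i, IsSubMarkov (K i)) (m : ℕ) :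
    IsSubMarkov (ascWord K m) := by
  induction m with
  | zero => exact isSubMarkov_one
  | succ m ih => exact ih.mul (hK m)

lemma isSubMarkov_triWord {K : ℕ → Op d} (hK : ∀ i, IsSubMarkov (K i)) (m : ℕ) :
    IsSubMarkov (triWord K m) := by
  induction m with
  | zero => exact isSubMarkov_one
  | succ m ih => exact (isSubMarkov_ascWord hK (m + 1)).mul ih

lemma isSubMarkov_descTop {K : ℕ → Op d} (hK : ∀ i, IsSubMarkov (K i)) (l : ℕ) :
    IsSubMarkov (descTop K d l) := by
  induction l with
  | zero => exact isSubMarkov_one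
  | succ l ih => exact ih.mul (hK _)

lemma isSubMarkov_ascTop {K : ℕ → Op d} (hK : ∀ i, IsSubMarkov (K i)) (l : ℕ) :
    IsSubMarkov (ascTop K d l) := by
  induction l with
  | zero => exact isSubMarkov_one
  | succ l ih => exact (hK _).mul ih

lemma isSubMarkov_triTop {K : ℕ → Op d} (hK : ∀ i, IsSubMarkov (K i)) (l : ℕ) :
    IsSubMarkov (triTop K d l) := by
  induction l with
  | zero => exact isSubMarkov_one
  | succ l ih => exact ih.mul (isSubMarkov_ascTop hK _)

lemma IsSubMarkov.pow {w : Op d} (hw : IsSubMarkov w) (n : ℕ) : IsSubMarkov (w ^ n) := by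
  induction n with
  | zero => exact isSubMarkov_one
  | succ n ih => rw [pow_succ]; exact ih.mul hw

end Ops

/-! ### Adjoints under the reflection of the chamber -/

section Adjoint

variable {d : ℕ}

/-- The reflection `z ↦ (-z_d, …, -z_1)` of the Weyl chamber. -/
def refl (z : Fin d → ℝ) : Fin d → ℝ := fun j => -z j.rev

@[simp] lemma refl_refl (z : Fin d → ℝ) : refl (refl z) = z := by
  funext j; simp [refl]

lemma measurePreserving_comp_perm (σ : Equiv.Perm (Fin d)) :
    MeasurePreserving (fun z : Fin d → ℝ => z ∘ σ) volume volume := by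
  have h := volume_measurePreserving_piCongrLeft (fun _ : Fin d => ℝ) σ.symm
  convert h using 1
  funext z
  funext j
  have := MeasurableEquiv.piCongrLeft_apply_apply (β := fun _ : Fin d => ℝ) σ.symm z (σ j)
  simpa using this.symm

lemma measurePreserving_refl : MeasurePreserving (refl : (Fin d → ℝ) → _) volume volume :=
  (Measure.measurePreserving_neg (volume : Measure (Fin d → ℝ))).comp
    (measurePreserving_comp_perm Fin.revPerm)

lemma measurable_refl : Measurable (refl : (Fin d → ℝ) → _) := measurePreserving_refl.measurable

lemma refl_mem {z : Fin d → ℝ} (hz : z ∈ weylChamber d) : refl z ∈ weylChamber d := by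
  intro a b hab
  simp only [refl, neg_lt_neg_iff]
  exact hz (Fin.rev_lt_rev.2 hab)

lemma refl_mem_iff {z : Fin d → ℝ} : refl z ∈ weylChamber d ↔ z ∈ weylChamber d :=
  ⟨fun h => by simpa using refl_mem h, refl_mem⟩

/-- Composition of a measurable function with the reflection. -/
def reflFun (F : MFun d) : MFun d := ⟨fun x => F.1 (refl x), F.2.comp measurable_refl⟩

lemma reflFun_reflFun (F : MFun d) : reflFun (reflFun F) = F := by
  apply Subtype.ext; funext x; exact congrArg F.1 (refl_refl x)

lemma setLIntegral_refl {F : (Fin d → ℝ) → ℝ≥0∞} (hF : Measurable F) :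
    ∫⁻ x in weylChamber d, F (refl x) = ∫⁻ x in weylChamber d, F x := by
  rw [← lintegral_indicator measurableSet_weylChamber,
    ← lintegral_indicator measurableSet_weylChamber,
    ← measurePreserving_refl.lintegral_comp (hF.indicator measurableSet_weylChamber)]
  refine lintegral_congr fun x => ?_
  by_cases hx : x ∈ weylChamber d
  · rw [Set.indicator_of_mem hx, Set.indicator_of_mem (refl_mem hx)]
  · rw [Set.indicator_of_notMem hx, Set.indicator_of_notMem fun h => hx (refl_mem_iff.1 h)]

/-- The adjoint of `w`, for Lebesgue measure on the Weyl chamber, is `w'` conjugated by the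
reflection of the chamber. -/
def IsReflAdjoint (w w' : Op d) : Prop :=
  ∀ F G : MFun d, ∫⁻ x in weylChamber d, G.1 x * (w F).1 x =
    ∫⁻ x in weylChamber d, F.1 x * (w' (reflFun G)).1 (refl x)

lemma IsReflAdjoint.one : IsReflAdjoint (1 : Op d) 1 := by
  intro F G
  refine lintegral_congr fun x => ?_
  change G.1 x * F.1 x = F.1 x * G.1 (refl (refl x))
  rw [refl_refl, mul_comm]

lemma IsReflAdjoint.mul {w₁ w₁' w₂ w₂' : Op d} (h₁ : IsReflAdjoint w₁ w₁')
    (h₂ : IsReflAdjoint w₂ w₂') : IsReflAdjoint (w₁ * w₂) (w₂' * w₁') := by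
  intro F G
  change ∫⁻ x in weylChamber d, G.1 x * (w₁ (w₂ F)).1 x =
    ∫⁻ x in weylChamber d, F.1 x * (w₂' (w₁' (reflFun G))).1 (refl x)
  rw [h₁]
  have h := h₂ F (reflFun (w₁' (reflFun G)))
  rw [reflFun_reflFun] at h
  rw [← h]
  exact lintegral_congr fun x => mul_comm _ _

lemma IsReflAdjoint.symm {w w' : Op d} (h : IsReflAdjoint w w') : IsReflAdjoint w' w := by
  intro F G
  have h1 := h (reflFun G) (reflFun F)
  rw [reflFun_reflFun] at h1
  rw [← setLIntegral_refl (F := fun x => G.1 x * (w' F).1 x) (G.2.mul (w' F).2)]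
  change ∫⁻ x in weylChamber d, (reflFun G).1 x * (w' F).1 (refl x) = _
  rw [← h1, ← setLIntegral_refl (F := fun x => (reflFun F).1 x * (w (reflFun G)).1 x)
    ((reflFun F).2.mul (w (reflFun G)).2)]
  refine lintegral_congr fun x => ?_
  change F.1 (refl (refl x)) * _ = _
  rw [refl_refl]

/-- Reflection reverses the direction of a jump, and Lebesgue measure is invariant under translations. -/
lemma isReflAdjoint_jumpOp (lam : ℝ) (i : Fin d) :
    IsReflAdjoint (jumpOp lam i : Op d) (jumpOp lam (i.rev : Fin d)) := by
  intro F G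
  let W := weylChamber d
  have hW : MeasurableSet W := measurableSet_weylChamber
  have hF : Measurable (W.indicator F.1) := F.2.indicator hW
  have hG : Measurable (W.indicator G.1) := G.2.indicator hW
  have hadd := measurable_add_single i
  have hsub : Measurable fun p : (Fin d → ℝ) × ℝ => p.1 - Pi.single i p.2 := by
    refine measurable_fst.sub (measurable_pi_iff.2 fun j => ?_)
    by_cases h : j = i
    · subst h; simpa using measurable_snd
    · simp [h]
  have hFx : ∀ x, Measurable fun s => W.indicator F.1 (x + Pi.single i s) := fun x =>
    hF.comp (hadd.comp ((measurable_const (a := x)).prodMk measurable_id))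
  have hGx : ∀ x, Measurable fun s => W.indicator G.1 (x - Pi.single i s) := fun x =>
    hG.comp (hsub.comp ((measurable_const (a := x)).prodMk measurable_id))
  have hL : ∀ x, W.indicator (fun x => G.1 x * (jumpOp lam i F).1 x) x =
      ∫⁻ s, W.indicator G.1 x * W.indicator F.1 (x + Pi.single i s) ∂(expMeasure lam) := by
    intro x
    by_cases hx : x ∈ W
    · rw [Set.indicator_of_mem hx, jumpOp_apply, jumpFun, Set.indicator_of_mem hx,
        Set.indicator_of_mem hx, ← lintegral_const_mul _ (hFx x)]
    · simp [Set.indicator_of_notMem hx]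
  have hR : ∀ x, W.indicator (fun x => F.1 x * (jumpOp lam (i.rev : Fin d) (reflFun G)).1
      (refl x)) x =
      ∫⁻ s, W.indicator G.1 (x - Pi.single i s) * W.indicator F.1 x ∂(expMeasure lam) := by
    intro x
    by_cases hx : x ∈ W
    · rw [Set.indicator_of_mem hx, jumpOp_apply, jumpFun, Set.indicator_of_mem (refl_mem hx),
        Set.indicator_of_mem hx, lintegral_mul_const _ (hGx x), mul_comm]
      congr 1
      refine lintegral_congr fun s => ?_
      have hr : refl (refl x + Pi.single i.rev s) = x - Pi.single i s := by
        funext j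
        simp only [refl, Pi.add_apply, Pi.single_apply, Pi.sub_apply, Fin.rev_rev, Fin.rev_inj]
        ring
      have hm : refl x + Pi.single i.rev s ∈ weylChamber d ↔ x - Pi.single i s ∈ W := by
        rw [← hr]; exact refl_mem_iff.symm
      by_cases h : x - Pi.single i s ∈ W
      · rw [Set.indicator_of_mem h, Set.indicator_of_mem (hm.2 h), ← hr]; rfl
      · rw [Set.indicator_of_notMem h, Set.indicator_of_notMem (fun h' => h (hm.1 h'))]
    · simp [Set.indicator_of_notMem hx]
  rw [← lintegral_indicator hW, ← lintegral_indicator hW]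
  simp_rw [W] at hL hR
  simp_rw [W, hL, hR]
  refine (lintegral_lintegral_swap ((hG.comp measurable_fst).mul (hF.comp hadd)).aemeasurable).trans
    (Eq.trans ?_ (lintegral_lintegral_swap
      ((hG.comp hsub).mul (hF.comp measurable_fst)).aemeasurable).symm)
  refine lintegral_congr fun s => ?_
  have h := lintegral_add_right_eq_self (μ := (volume : Measure (Fin d → ℝ)))
    (fun x => (weylChamber d).indicator G.1 (x - (Pi.single i s : Fin d → ℝ)) *
      (weylChamber d).indicator F.1 x) (Pi.single i s : Fin d → ℝ)
  simpa using h

lemma isReflAdjoint_jumpOp_nat (lam : ℝ) {l : ℕ} (hl : l < d) :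
    IsReflAdjoint (jumpOp lam l : Op d) (jumpOp lam (d - 1 - l)) := by
  have h := isReflAdjoint_jumpOp lam (⟨l, hl⟩ : Fin d)
  have e : ((Fin.rev ⟨l, hl⟩ : Fin d) : ℕ) = d - 1 - l := by simp [Fin.val_rev]; omega
  rwa [e] at h

lemma isReflAdjoint_ascWord (lam : ℝ) {m : ℕ} (hm : m ≤ d) :
    IsReflAdjoint (ascWord (jumpOp lam) m : Op d) (ascTop (jumpOp lam) d m) := by
  induction m with
  | zero => exact IsReflAdjoint.one
  | succ m ih => exact (ih (by omega)).mul (isReflAdjoint_jumpOp_nat lam (by omega))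

lemma isReflAdjoint_triWord (lam : ℝ) {m : ℕ} (hm : m ≤ d) :
    IsReflAdjoint (triWord (jumpOp lam) m : Op d) (triTop (jumpOp lam) d m) := by
  induction m with
  | zero => exact IsReflAdjoint.one
  | succ m ih => exact (isReflAdjoint_ascWord lam hm).mul (ih (by omega))

end Adjoint

/-! ### Bounds for triangular words and for the descending word -/

section Bounds

variable {d : ℕ}

/-- `∏_{i < j} (x_j - x_i)`, the factors of the Vandermonde product with larger index `j`. -/
def vandFactor (x : Fin d → ℝ) (j : Fin d) : ℝ := ∏ i ∈ Finset.Iio j, (x j - x i)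

lemma vandermonde_eq_prod_vandFactor (x : Fin d → ℝ) : vandermonde x = ∏ j, vandFactor x j := by
  unfold vandermonde vandFactor
  exact Finset.prod_comm' (by simp)

lemma vandFactor_pos {x : Fin d → ℝ} (hx : x ∈ weylChamber d) (j : Fin d) :
    0 < vandFactor x j :=
  Finset.prod_pos fun _ hi => sub_pos.2 (hx (Finset.mem_Iio.1 hi))

lemma vandermonde_pos {x : Fin d → ℝ} (hx : x ∈ weylChamber d) : 0 < vandermonde x := by
  rw [vandermonde_eq_prod_vandFactor]
  exact Finset.prod_pos fun j _ => vandFactor_pos hx j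

lemma continuous_vandFactor (j : Fin d) : Continuous fun x => vandFactor x j :=
  continuous_finsetProd _ fun i _ => (continuous_apply j).sub (continuous_apply i)

lemma continuous_vandermonde : Continuous (vandermonde : (Fin d → ℝ) → ℝ) := by
  simp_rw [funext vandermonde_eq_prod_vandFactor]
  exact continuous_finsetProd _ fun j _ => continuous_vandFactor j

/-- The partial Vandermonde product over the larger indices `j ≤ M`, `j ≠ l`. -/
def partialVand (M l : ℕ) (x : Fin d → ℝ) : ℝ :=
  ∏ j ∈ Finset.univ.filter (fun j : Fin d => (j : ℕ) ≤ M ∧ (j : ℕ) ≠ l), vandFactor x j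

lemma measurable_partialVand (M l : ℕ) :
    Measurable fun x : Fin d → ℝ => ENNReal.ofReal (partialVand M l x) :=
  (continuous_finsetProd _ fun j _ => continuous_vandFactor j).measurable.ennreal_ofReal

lemma partialVand_pos {M l : ℕ} {x : Fin d → ℝ} (hx : x ∈ weylChamber d) :
    0 < partialVand M l x :=
  Finset.prod_pos fun j _ => vandFactor_pos hx j

/-- A legal jump of particle `l` trades the missing factor `l + 1` for the missing factor `l`. -/
lemma partialVand_add_single_le {M : ℕ} {l l' : Fin d} (hll : (l : ℕ) + 1 = l') (hM : (l' : ℕ) ≤ M)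
    {x : Fin d → ℝ} (hx : x ∈ weylChamber d) {s : ℝ} (hs : 0 ≤ s)
    (hxs : x + Pi.single l s ∈ weylChamber d) :
    partialVand M (l + 1) (x + Pi.single l s) * (x l' - x l) ≤ partialVand M l x := by
  classical
  have hlt : l < l' := by rw [Fin.lt_def]; omega
  let S : Finset (Fin d) := Finset.univ.filter fun j => (j : ℕ) ≤ M ∧ j ≠ l ∧ j ≠ l'
  have h1 : (Finset.univ.filter fun j : Fin d => (j : ℕ) ≤ M ∧ (j : ℕ) ≠ (l : ℕ) + 1) =
      insert l S := by
    ext j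
    simp only [Finset.mem_filter, Finset.mem_univ, true_and, Finset.mem_insert, S, Fin.ext_iff]
    omega
  have h2 : (Finset.univ.filter fun j : Fin d => (j : ℕ) ≤ M ∧ (j : ℕ) ≠ (l : ℕ)) =
      insert l' S := by
    ext j
    simp only [Finset.mem_filter, Finset.mem_univ, true_and, Finset.mem_insert, S, Fin.ext_iff]
    omega
  have e1 : ∀ y : Fin d → ℝ, partialVand M (l + 1) y = vandFactor y l * ∏ j ∈ S, vandFactor y j := by
    intro y
    rw [partialVand, h1, Finset.prod_insert (by simp [S])]
  have e2 : partialVand M l x = vandFactor x l' * ∏ j ∈ S, vandFactor x j := by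
    rw [partialVand, h2, Finset.prod_insert (by simp [S])]
  have hS : ∏ j ∈ S, vandFactor (x + Pi.single l s) j ≤ ∏ j ∈ S, vandFactor x j := by
    refine Finset.prod_le_prod (fun j _ => (vandFactor_pos hxs j).le) fun j hj => ?_
    have hj' : j ≠ l := (Finset.mem_filter.1 hj).2.2.1
    refine Finset.prod_le_prod (fun i hi => sub_nonneg.2 (hxs (Finset.mem_Iio.1 hi)).le)
      fun i _ => ?_
    have : 0 ≤ if i = l then s else 0 := by split_ifs <;> simp [hs]
    simp only [Pi.add_apply, Pi.single_apply, hj', if_false]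
    linarith
  have hI : Finset.Iio l' = insert l (Finset.Iio l) := by
    ext i
    simp only [Finset.mem_Iio, Finset.mem_insert, Fin.lt_def, Fin.ext_iff]
    omega
  have hl : vandFactor (x + Pi.single l s) l * (x l' - x l) ≤ vandFactor x l' := by
    rw [vandFactor, vandFactor, hI, Finset.prod_insert (by simp), mul_comm]
    refine mul_le_mul_of_nonneg_left ?_ (sub_nonneg.2 (hx hlt).le)
    refine Finset.prod_le_prod (fun i hi => sub_nonneg.2 (hxs (Finset.mem_Iio.1 hi)).le)
      fun i hi => ?_
    have hil : i < l := Finset.mem_Iio.1 hi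
    have h3 := hxs hlt
    simp only [Pi.add_apply, Pi.single_apply, hlt.ne', hil.ne, if_false, if_true] at h3 ⊢
    linarith
  rw [e1, e2, mul_right_comm]
  exact mul_le_mul hl hS (Finset.prod_nonneg fun j _ => (vandFactor_pos hxs j).le)
    (vandFactor_pos hx l').le

/-- The particle `l` has to land in the gap below particle `l + 1`, which has probability at most
`lam` times the length of the gap; this length is the factor that is gained. -/
lemma jumpOp_partialVand_le {lam : ℝ} {M : ℕ} {l : ℕ} (hlM : l + 1 ≤ M) (hM : M < d)
    {x : Fin d → ℝ} (hx : x ∈ weylChamber d) :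
    (jumpOp lam l (⟨_, measurable_partialVand M (l + 1)⟩ : MFun d)).1 x ≤
      ENNReal.ofReal lam * ENNReal.ofReal (partialVand M l x) := by
  obtain ⟨k, rfl⟩ : ∃ k : Fin d, (k : ℕ) = l := ⟨⟨l, by omega⟩, rfl⟩
  let k' : Fin d := ⟨k + 1, by omega⟩
  have hkk : k < k' := by simp [k', Fin.lt_def]
  have hgap : 0 < x k' - x k := sub_pos.2 (hx hkk)
  rw [jumpOp_apply, jumpFun, Set.indicator_of_mem hx]
  let c := ENNReal.ofReal (partialVand M k x / (x k' - x k))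
  calc ∫⁻ s, (weylChamber d).indicator (fun y => ENNReal.ofReal (partialVand M (k + 1) y))
        (x + Pi.single k s) ∂(expMeasure lam)
      ≤ ∫⁻ s, (Set.Ioc 0 (x k' - x k)).indicator (fun _ => c) s ∂(expMeasure lam) := by
        refine lintegral_mono_ae ?_
        filter_upwards [ae_expMeasure_pos lam] with s hs
        by_cases h : x + Pi.single k s ∈ weylChamber d
        · have h1 := h hkk
          simp only [Pi.add_apply, Pi.single_apply, hkk.ne', if_false, if_true] at h1
          rw [Set.indicator_of_mem h, Set.indicator_of_mem (Set.mem_Ioc.2 ⟨hs, by linarith⟩)]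
          refine ENNReal.ofReal_le_ofReal ?_
          rw [le_div_iff₀ hgap]
          exact partialVand_add_single_le (by rfl) (by simpa [k'] using hlM) hx hs.le h
        · rw [Set.indicator_of_notMem h]; exact zero_le
    _ = c * expMeasure lam (Set.Ioc 0 (x k' - x k)) :=
        lintegral_indicator_const measurableSet_Ioc _
    _ ≤ c * (ENNReal.ofReal lam * ENNReal.ofReal (x k' - x k)) := by
        gcongr
        refine (expMeasure_le lam _).trans ?_
        simp
    _ = ENNReal.ofReal lam * ENNReal.ofReal (partialVand M k x) := by
        rw [mul_left_comm]
        congr 1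
        rw [← ENNReal.ofReal_mul (by have := partialVand_pos (M := M) (l := k) hx; positivity),
          div_mul_cancel₀ _ hgap.ne']

lemma ascWord_partialVand_le {lam : ℝ} (hlam : 0 < lam) {M : ℕ} {l : ℕ} (hlM : l ≤ M) (hM : M < d)
    {x : Fin d → ℝ} (hx : x ∈ weylChamber d) :
    (ascWord (jumpOp lam) l (⟨_, measurable_partialVand M l⟩ : MFun d)).1 x ≤
      ENNReal.ofReal lam ^ l * ENNReal.ofReal (partialVand M 0 x) := by
  induction l with
  | zero =>
    change ENNReal.ofReal (partialVand M 0 x) ≤ _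
    simp
  | succ l ih =>
    have hA := isSubMarkov_ascWord (d := d) (isSubMarkov_jumpOp hlam) l
    calc (ascWord (jumpOp lam) (l + 1) (⟨_, measurable_partialVand M (l + 1)⟩ : MFun d)).1 x
        = (ascWord (jumpOp lam) l (jumpOp lam l ⟨_, measurable_partialVand M (l + 1)⟩)).1 x := rfl
      _ ≤ (ascWord (jumpOp lam) l ⟨fun y => ENNReal.ofReal lam * ENNReal.ofReal (partialVand M l y),
            (measurable_partialVand M l).const_mul _⟩).1 x :=
          hA.mono (fun y hy => jumpOp_partialVand_le hlM hM hy) hx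
      _ = ENNReal.ofReal lam * (ascWord (jumpOp lam) l ⟨_, measurable_partialVand M l⟩).1 x :=
          hA.const_mul _ ⟨_, measurable_partialVand M l⟩ x
      _ ≤ ENNReal.ofReal lam * (ENNReal.ofReal lam ^ l * ENNReal.ofReal (partialVand M 0 x)) := by
          gcongr; exact ih (by omega)
      _ = _ := by rw [pow_succ]; ring

/-- The constant function `1`. -/
def oneFun (d : ℕ) : MFun d := ⟨fun _ => 1, measurable_const⟩

lemma triWord_one_le_partialVand {lam : ℝ} (hlam : 0 < lam) {m : ℕ} (hm : m < d)
    {x : Fin d → ℝ} (hx : x ∈ weylChamber d) :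
    (triWord (jumpOp lam) m (oneFun d)).1 x ≤
      ENNReal.ofReal lam ^ (∑ i ∈ Finset.range (m + 1), i) *
        ENNReal.ofReal (partialVand m 0 x) := by
  induction m generalizing x with
  | zero =>
    have h : partialVand 0 0 x = 1 := by
      rw [partialVand, Finset.filter_false_of_mem (by intros; omega), Finset.prod_empty]
    change 1 ≤ _
    simp [h]
  | succ m ih =>
    have hA := isSubMarkov_ascWord (d := d) (isSubMarkov_jumpOp hlam) (m + 1)
    have hF : ∀ y : Fin d → ℝ, partialVand m 0 y = partialVand (m + 1) (m + 1) y := by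
      intro y
      unfold partialVand
      have h0 : ∀ j : Fin d, (j : ℕ) = 0 → vandFactor y j = 1 := by
        intro j hj
        rw [vandFactor, Finset.prod_eq_one]
        intro i hi
        have := Finset.mem_Iio.1 hi
        rw [Fin.lt_def] at this; omega
      refine Finset.prod_subset (fun j hj => ?_) fun j hj hj' => h0 j ?_
      · simp only [Finset.mem_filter, Finset.mem_univ, true_and] at hj ⊢; omega
      · simp only [Finset.mem_filter, Finset.mem_univ, true_and] at hj hj'; omega
    let c : ℝ≥0∞ := ENNReal.ofReal lam ^ (∑ i ∈ Finset.range (m + 1), i)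
    calc (triWord (jumpOp lam) (m + 1) (oneFun d)).1 x
        = (ascWord (jumpOp lam) (m + 1) (triWord (jumpOp lam) m (oneFun d))).1 x := rfl
      _ ≤ (ascWord (jumpOp lam) (m + 1) ⟨fun y => c * ENNReal.ofReal (partialVand (m + 1) (m + 1) y),
            (measurable_partialVand (m + 1) (m + 1)).const_mul _⟩).1 x :=
          hA.mono (fun y hy => by
            change _ ≤ c * ENNReal.ofReal (partialVand (m + 1) (m + 1) y)
            exact hF y ▸ ih (by omega) hy) hx
      _ = c * (ascWord (jumpOp lam) (m + 1) ⟨_, measurable_partialVand (m + 1) (m + 1)⟩).1 x :=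
          hA.const_mul _ ⟨_, measurable_partialVand (m + 1) (m + 1)⟩ x
      _ ≤ c * (ENNReal.ofReal lam ^ (m + 1) * ENNReal.ofReal (partialVand (m + 1) 0 x)) := by
          gcongr; exact ascWord_partialVand_le hlam le_rfl hm hx
      _ = _ := by rw [Finset.sum_range_succ _ (m + 1), pow_add]; ring

/-- The probability that the interlacing constraints hold in the initial triangle is at most the
Vandermonde product of the starting point, in units of `1 / lam`. -/
lemma triWord_one_le {lam : ℝ} (hlam : 0 < lam) (hd : 1 ≤ d)
    {x : Fin d → ℝ} (hx : x ∈ weylChamber d) :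
    (triWord (jumpOp lam) (d - 1) (oneFun d)).1 x ≤
      ENNReal.ofReal lam ^ (∑ i ∈ Finset.range d, i) * ENNReal.ofReal (vandermonde x) := by
  have h := triWord_one_le_partialVand (d := d) hlam (m := d - 1) (by omega) hx
  have h1 : partialVand (d - 1) 0 x = vandermonde x := by
    rw [vandermonde_eq_prod_vandFactor, partialVand]
    refine Finset.prod_subset (Finset.subset_univ _) fun j _ hj => ?_
    have hj0 : (j : ℕ) = 0 := by
      simp only [Finset.mem_filter, Finset.mem_univ, true_and] at hj
      have := j.2; omega
    rw [vandFactor, Finset.prod_eq_one]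
    intro i hi
    have := Finset.mem_Iio.1 hi
    rw [Fin.lt_def] at this; omega
  rwa [h1, Nat.sub_add_cancel hd] at h

lemma jumpOp_le_lmarginal {lam : ℝ} (i : Fin d) (F : MFun d) (x : Fin d → ℝ) :
    (jumpOp lam i F).1 x ≤ ENNReal.ofReal lam *
      (∫⋯∫⁻_{i}, (weylChamber d).indicator F.1 ∂(fun _ => volume)) x := by
  rw [jumpOp_apply, jumpFun]
  refine (Set.indicator_le_self _ _ _).trans ?_
  refine (lintegral_mono' (expMeasure_le lam) le_rfl).trans ?_
  rw [lintegral_smul_measure, lmarginal_singleton, smul_eq_mul]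
  gcongr
  change _ ≤ ∫⁻ t, (weylChamber d).indicator F.1 (Function.update x i t)
  rw [← lintegral_add_left_eq_self (fun t => (weylChamber d).indicator F.1 (Function.update x i t))
    (x i)]
  refine lintegral_mono fun s => ?_
  have : x + Pi.single i s = Function.update x i (x i + s) := by
    funext j
    by_cases h : j = i
    · subst h; simp
    · simp [h]
  rw [this]

/-- Moving the particles from the last one downwards, each jump has a density of at most `lam`, so
that the top `l` coordinates are integrated out one after the other. -/
lemma descTop_le_lmarginal {lam : ℝ} (hlam : 0 < lam) (l : ℕ) (hl : l ≤ d) (F : MFun d)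
    {x : Fin d → ℝ} (hx : x ∈ weylChamber d) :
    (descTop (jumpOp lam) d l F).1 x ≤ ENNReal.ofReal lam ^ l *
      (∫⋯∫⁻_Finset.univ.filter (fun i : Fin d => d - l ≤ i),
        (weylChamber d).indicator F.1 ∂(fun _ => volume)) x := by
  induction l generalizing F with
  | zero =>
    have : (Finset.univ.filter fun i : Fin d => d - 0 ≤ i) = ∅ := by
      ext i; simp
    rw [this]
    change F.1 x ≤ _
    simp [Set.indicator_of_mem hx]
  | succ l ih =>
    let k : Fin d := ⟨d - 1 - l, by omega⟩
    have hW := measurableSet_weylChamber (d := d)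
    have hm : Measurable (∫⋯∫⁻_{k}, (weylChamber d).indicator F.1 ∂(fun _ => volume)) :=
      (F.2.indicator hW).lmarginal _
    have hS := isSubMarkov_descTop (d := d) (isSubMarkov_jumpOp hlam) l
    have hset : (Finset.univ.filter fun i : Fin d => d - (l + 1) ≤ i) =
        insert k (Finset.univ.filter fun i : Fin d => d - l ≤ i) := by
      ext i
      simp only [Finset.mem_filter, Finset.mem_univ, true_and, Finset.mem_insert, k, Fin.ext_iff]
      omega
    calc (descTop (jumpOp lam) d (l + 1) F).1 x
        = (descTop (jumpOp lam) d l (jumpOp lam k F)).1 x := rfl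
      _ ≤ (descTop (jumpOp lam) d l ⟨_, hm.const_mul (ENNReal.ofReal lam)⟩).1 x :=
          hS.mono (fun y _ => jumpOp_le_lmarginal k F y) hx
      _ = ENNReal.ofReal lam * (descTop (jumpOp lam) d l ⟨_, hm⟩).1 x :=
          hS.const_mul _ ⟨_, hm⟩ x
      _ ≤ ENNReal.ofReal lam * (ENNReal.ofReal lam ^ l *
            (∫⋯∫⁻_Finset.univ.filter (fun i : Fin d => d - l ≤ i),
            (weylChamber d).indicator (∫⋯∫⁻_{k}, (weylChamber d).indicator F.1 ∂(fun _ => volume))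
              ∂(fun _ => volume)) x) := by
          gcongr; exact ih (by omega) ⟨_, hm⟩
      _ ≤ ENNReal.ofReal lam * (ENNReal.ofReal lam ^ l *
            (∫⋯∫⁻_Finset.univ.filter (fun i : Fin d => d - l ≤ i),
            (∫⋯∫⁻_{k}, (weylChamber d).indicator F.1 ∂(fun _ => volume))
              ∂(fun _ => volume)) x) := by
          gcongr
          exact lmarginal_mono (fun y => Set.indicator_le_self _ _ _) x
      _ = _ := by
          rw [hset, lmarginal_insert' _ (F.2.indicator hW) (by
            simp only [Finset.mem_filter, Finset.mem_univ, true_and, k]; omega), pow_succ]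
          have : (∫⋯∫⁻_{k}, (weylChamber d).indicator F.1 ∂(fun _ => volume)) = fun y =>
              ∫⁻ t, (weylChamber d).indicator F.1 (Function.update y k t) := by
            exact lmarginal_singleton _ _
          rw [this]; ring

/-- One full step has a density of at most `lam ^ d`. -/
lemma descTop_self_le {lam : ℝ} (hlam : 0 < lam) (F : MFun d)
    {x : Fin d → ℝ} (hx : x ∈ weylChamber d) :
    (descTop (jumpOp lam) d d F).1 x ≤
      ENNReal.ofReal lam ^ d * ∫⁻ z in weylChamber d, F.1 z := by
  have h := descTop_le_lmarginal hlam d le_rfl F hx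
  have hu : (Finset.univ.filter fun i : Fin d => d - d ≤ i) = Finset.univ := by
    ext i; simp
  rw [hu, lmarginal_univ, ← volume_pi, lintegral_indicator measurableSet_weylChamber] at h
  exact h

end Bounds

/-! ### The walk as a sequence of single-particle jumps -/

section Walk

variable {d : ℕ} {Ω : Type*} [MeasurableSpace Ω] {μ : Measure Ω} [IsProbabilityMeasure μ]

lemma lintegral_comp_of_indepFun {α β : Type*} [MeasurableSpace α] [MeasurableSpace β]
    {Z : Ω → α} {S : Ω → β} (hZ : Measurable Z) (hS : Measurable S) (h : IndepFun Z S μ)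
    {g : α × β → ℝ≥0∞} (hg : Measurable g) :
    ∫⁻ ω, g (Z ω, S ω) ∂μ = ∫⁻ ω, ∫⁻ s, g (Z ω, s) ∂(μ.map S) ∂μ := by
  have h1 := (indepFun_iff_map_prod_eq_prod_map_map hZ.aemeasurable hS.aemeasurable).1 h
  have := Measure.isProbabilityMeasure_map (μ := μ) hS.aemeasurable
  rw [← lintegral_map hg (hZ.prodMk hS), h1, lintegral_prod _ hg.aemeasurable,
    lintegral_map hg.lintegral_prod_right' hZ]

/-- The path started from `x` whose `l`-th step moves particle `c l` by `u l`. -/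
def seqPath (c : ℕ → Fin d) (x : Fin d → ℝ) (u : ℕ → ℝ) (m : ℕ) : Fin d → ℝ :=
  x + ∑ l ∈ Finset.range m, Pi.single (c l) (u l)

lemma seqPath_succ (c : ℕ → Fin d) (x : Fin d → ℝ) (u : ℕ → ℝ) (m : ℕ) :
    seqPath c x u (m + 1) = seqPath c x u m + Pi.single (c m) (u m) := by
  simp [seqPath, Finset.sum_range_succ, add_assoc]

lemma measurable_seqPath (c : ℕ → Fin d) (x : Fin d → ℝ) (m : ℕ) :
    Measurable fun u => seqPath c x u m := by
  induction m with
  | zero => simp [seqPath]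
  | succ m ih =>
    simp_rw [seqPath_succ]
    exact (measurable_add_single (c m)).comp (ih.prodMk (measurable_pi_apply m))

/-- Driving sequences for which the path stays in the Weyl chamber up to step `m`. -/
def staySet (c : ℕ → Fin d) (x : Fin d → ℝ) (m : ℕ) : Set (ℕ → ℝ) :=
  {u | ∀ k ≤ m, seqPath c x u k ∈ weylChamber d}

lemma measurableSet_staySet (c : ℕ → Fin d) (x : Fin d → ℝ) (m : ℕ) :
    MeasurableSet (staySet c x m) := by
  have : staySet c x m = ⋂ k : ℕ, ⋂ _ : k ≤ m, (fun u => seqPath c x u k) ⁻¹' weylChamber d := by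
    ext u; simp [staySet]
  rw [this]
  exact MeasurableSet.iInter fun k => MeasurableSet.iInter fun _ =>
    measurable_seqPath c x k measurableSet_weylChamber

/-- The word of jump operators associated with the first `m` steps. -/
noncomputable def seqWord (lam : ℝ) (c : ℕ → Fin d) : ℕ → Op d
  | 0 => 1
  | m + 1 => seqWord lam c m * jumpOp lam (c m)

/-- The Markov property: words of killed jump operators compute expectations over paths that move
one particle at a time and stay in the chamber. -/
lemma lintegral_seqPath {lam : ℝ} (c : ℕ → Fin d) {ξ : ℕ → Ω → ℝ} (hξ : ∀ l, Measurable (ξ l))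
    (hlaw : ∀ l, μ.map (ξ l) = expMeasure lam) (hind : iIndepFun ξ μ)
    {x : Fin d → ℝ} (hx : x ∈ weylChamber d) (m : ℕ) (F : MFun d) :
    ∫⁻ ω, (staySet c x m).indicator (fun u => F.1 (seqPath c x u m)) (fun l => ξ l ω) ∂μ =
      (seqWord lam c m F).1 x := by
  classical
  induction m generalizing F with
  | zero =>
    have h : ∀ ω, (staySet c x 0).indicator (fun u => F.1 (seqPath c x u 0)) (fun l => ξ l ω) =
        F.1 x := by
      intro ω
      rw [Set.indicator_of_mem]
      · simp [seqPath]
      · intro k hk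
        obtain rfl : k = 0 := by omega
        simpa [seqPath] using hx
    simp_rw [h]
    rw [lintegral_const, measure_univ, mul_one]
    rfl
  | succ m ih =>
    -- the first `m` driving variables, extended by `0`
    let ext0 : (Finset.range m → ℝ) → ℕ → ℝ := fun v l =>
      if h : l ∈ Finset.range m then v ⟨l, h⟩ else 0
    have hext : Measurable ext0 := by
      refine measurable_pi_iff.2 fun l => ?_
      by_cases h : l ∈ Finset.range m
      · simp only [ext0, dif_pos h]
        exact measurable_pi_apply (⟨l, h⟩ : Finset.range m)
      · simp only [ext0, dif_neg h]
        exact measurable_const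
    let Z : Ω → Finset.range m → ℝ := fun ω i => ξ i ω
    have hZ : Measurable Z := measurable_pi_iff.2 fun i => hξ i
    have hpath : ∀ ω, ∀ k ≤ m, seqPath c x (ext0 (Z ω)) k = seqPath c x (fun l => ξ l ω) k := by
      intro ω k hk
      unfold seqPath
      congr 1
      refine Finset.sum_congr rfl fun l hl => ?_
      have : l ∈ Finset.range m := Finset.mem_range.2 ((Finset.mem_range.1 hl).trans_le hk)
      simp [ext0, Z, Finset.mem_range.1 this]
    have hstay : ∀ ω, ext0 (Z ω) ∈ staySet c x m ↔ (fun l => ξ l ω) ∈ staySet c x m := by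
      intro ω
      constructor
      · intro h k hk; rw [← hpath ω k hk]; exact h k hk
      · intro h k hk; rw [hpath ω k hk]; exact h k hk
    have hindep : IndepFun Z (ξ m) μ := by
      have h1 := hind.indepFun_finset (Finset.range m) {m} (by simp) hξ
      exact h1.comp measurable_id (measurable_pi_apply (⟨m, by simp⟩ : ({m} : Finset ℕ)))
    let W := weylChamber d
    have hFW : Measurable (W.indicator F.1) := F.2.indicator measurableSet_weylChamber
    let g : (Finset.range m → ℝ) × ℝ → ℝ≥0∞ := fun p =>
      (staySet c x m).indicator (fun _ => 1) (ext0 p.1) *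
        W.indicator F.1 (seqPath c x (ext0 p.1) m + Pi.single (c m) p.2)
    have hg : Measurable g := by
      refine Measurable.mul ?_ ?_
      · exact (measurable_const.indicator (measurableSet_staySet c x m)).comp
          (hext.comp measurable_fst)
      · exact hFW.comp ((measurable_add_single (c m)).comp
          (((measurable_seqPath c x m).comp (hext.comp measurable_fst)).prodMk measurable_snd))
    calc ∫⁻ ω, (staySet c x (m + 1)).indicator (fun u => F.1 (seqPath c x u (m + 1)))
          (fun l => ξ l ω) ∂μ
        = ∫⁻ ω, g (Z ω, ξ m ω) ∂μ := by
          refine lintegral_congr fun ω => ?_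
          simp only [g]
          rw [hpath ω m le_rfl]
          by_cases h : (fun l => ξ l ω) ∈ staySet c x m
          · rw [Set.indicator_of_mem ((hstay ω).2 h), one_mul,
              ← seqPath_succ c x (fun l => ξ l ω) m]
            by_cases h' : seqPath c x (fun l => ξ l ω) (m + 1) ∈ W
            · rw [Set.indicator_of_mem h', Set.indicator_of_mem]
              intro k hk
              rcases Nat.lt_or_ge m k with h1 | h1
              · obtain rfl : k = m + 1 := by omega
                exact h'
              · exact h k h1
            · rw [Set.indicator_of_notMem h', Set.indicator_of_notMem]
              exact fun h1 => h' (h1 (m + 1) le_rfl)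
          · rw [Set.indicator_of_notMem (fun h1 => h ((hstay ω).1 h1)), zero_mul,
              Set.indicator_of_notMem]
            exact fun h1 => h fun k hk => h1 k (by omega)
      _ = ∫⁻ ω, ∫⁻ s, g (Z ω, s) ∂(expMeasure lam) ∂μ := by
          rw [lintegral_comp_of_indepFun hZ (hξ m) hindep hg, hlaw]
      _ = ∫⁻ ω, (staySet c x m).indicator
            (fun u => (jumpOp lam (c m) F).1 (seqPath c x u m)) (fun l => ξ l ω) ∂μ := by
          refine lintegral_congr fun ω => ?_
          simp only [g]
          rw [hpath ω m le_rfl]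
          by_cases h : (fun l => ξ l ω) ∈ staySet c x m
          · rw [Set.indicator_of_mem ((hstay ω).2 h), Set.indicator_of_mem h, jumpOp_apply,
              jumpFun, Set.indicator_of_mem (h m le_rfl)]
            simp [W]
          · rw [Set.indicator_of_notMem (fun h1 => h ((hstay ω).1 h1)),
              Set.indicator_of_notMem h]
            simp
      _ = (seqWord lam c m (jumpOp lam (c m) F)).1 x := ih _
      _ = _ := rfl

lemma seqWord_periodic {lam : ℝ} {c : ℕ → Fin d} {w : ℕ → Op d} (hw0 : w 0 = 1)
    (hw : ∀ k, ∀ j < d, w (j + 1) = w j * jumpOp lam (c (k * d + j))) (k j : ℕ) (hj : j ≤ d) :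
    seqWord lam c (k * d + j) = w d ^ k * w j := by
  have step : ∀ k, seqWord lam c (k * d) = w d ^ k → ∀ j ≤ d,
      seqWord lam c (k * d + j) = w d ^ k * w j := by
    intro k hk j
    induction j with
    | zero => intro _; rw [hw0, mul_one, add_zero, hk]
    | succ j ih =>
      intro hj
      rw [← add_assoc, seqWord, ih (by omega), hw k j (by omega), mul_assoc]
  refine step k ?_ j hj
  clear hj j
  induction k with
  | zero => rw [zero_mul, pow_zero]; rfl
  | succ k ih => rw [add_mul, one_mul, step k ih d le_rfl, pow_succ]

/-- The particle moved at step `l` when the particles take turns in the order `e`. -/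
def turn (hd : 0 < d) (e : Equiv.Perm (Fin d)) (l : ℕ) : Fin d := e ⟨l % d, Nat.mod_lt _ hd⟩

lemma turn_mul_add (hd : 0 < d) (e : Equiv.Perm (Fin d)) (k j : ℕ) (hj : j < d) :
    turn hd e (k * d + j) = e ⟨j, hj⟩ := by
  have : (k * d + j) % d = j := by rw [mul_comm, Nat.mul_add_mod, Nat.mod_eq_of_lt hj]
  simp [turn, this]

omit [MeasurableSpace Ω] in
lemma walk_succ (X : ℕ → Fin d → Ω → ℝ) (x : Fin d → ℝ) (n : ℕ) (ω : Ω) (i : Fin d) :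
    walk X x (n + 1) ω i = walk X x n ω i + X n i ω := by
  simp [walk, Finset.sum_range_succ, add_assoc]

omit [MeasurableSpace Ω] in
/-- At step `k * d + j` the particles that come first in the order `e` have made `k + 1` jumps and the
others `k` jumps. -/
lemma seqPath_turn (hd : 0 < d) (e : Equiv.Perm (Fin d)) (X : ℕ → Fin d → Ω → ℝ) (x : Fin d → ℝ)
    (ω : Ω) (k j : ℕ) (hj : j ≤ d) (i : Fin d) :
    seqPath (turn hd e) x (fun l => X (l / d) (turn hd e l) ω) (k * d + j) i =
      if (e.symm i : ℕ) < j then walk X x (k + 1) ω i else walk X x k ω i := by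
  have step : ∀ k, (∀ i, seqPath (turn hd e) x (fun l => X (l / d) (turn hd e l) ω) (k * d) i =
      walk X x k ω i) → ∀ j ≤ d, ∀ i,
      seqPath (turn hd e) x (fun l => X (l / d) (turn hd e l) ω) (k * d + j) i =
        if (e.symm i : ℕ) < j then walk X x (k + 1) ω i else walk X x k ω i := by
    intro k hk j
    induction j with
    | zero => intro _ i; simpa using hk i
    | succ j ih =>
      intro hj i
      have hdiv : (k * d + j) / d = k := by
        rw [mul_comm, Nat.mul_add_div hd, Nat.div_eq_of_lt hj, add_zero]
      rw [← add_assoc, seqPath_succ, Pi.add_apply, ih (by omega), hdiv,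
        turn_mul_add hd e k j hj, Pi.single_apply]
      by_cases hi : i = e ⟨j, hj⟩
      · subst hi
        simp [walk_succ]
      · have hne : (e.symm i : ℕ) ≠ j := by
          intro h
          apply hi
          rw [← Equiv.symm_apply_eq]
          exact Fin.ext h
        rw [if_neg hi, add_zero]
        have : (e.symm i : ℕ) < j + 1 ↔ (e.symm i : ℕ) < j := by omega
        simp [this]
  refine step k ?_ j hj i
  clear hj i j
  induction k with
  | zero => intro i; simp [seqPath, walk]
  | succ k ih =>
    intro i
    rw [add_mul, one_mul, step k ih d le_rfl, if_pos (e.symm i).2]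

lemma injective_turn (hd : 0 < d) (e : Equiv.Perm (Fin d)) :
    Function.Injective fun l : ℕ => (l / d, turn hd e l) := by
  intro a b h
  simp only [Prod.mk.injEq, turn, e.injective.eq_iff, Fin.mk.injEq] at h
  rw [← Nat.div_add_mod a d, ← Nat.div_add_mod b d, h.1, h.2]

lemma strictMono_of_lt_succ {x : Fin d → ℝ} (h : ∀ i j : Fin d, (i : ℕ) + 1 = j → x i < x j) :
    StrictMono x := by
  have key : ∀ n : ℕ, ∀ i j : Fin d, (i : ℕ) + (n + 1) = j → x i < x j := by
    intro n
    induction n with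
    | zero => intro i j hij; exact h i j (by omega)
    | succ n ih =>
      intro i j hij
      let c : Fin d := ⟨i + (n + 1), by omega⟩
      exact (ih i c rfl).trans (h c j (by simp only [c]; omega))
  intro i j hij
  exact key (j - i - 1) i j (by rw [Fin.lt_def] at hij; omega)

lemma natCast_lt_sInf_image {n : ℕ} {S : Set ℕ} :
    (n : ℕ∞) < sInf ((fun k : ℕ => (k : ℕ∞)) '' S) ↔ ∀ k ∈ S, n < k := by
  rw [← ENat.add_one_le_iff (ENat.natCast_ne_top n), le_sInf_iff]
  simp only [Set.forall_mem_image]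
  refine forall₂_congr fun k _ => ?_
  exact_mod_cast Nat.succ_le_iff

omit [MeasurableSpace Ω] in
lemma mem_tauGt_iff (X : ℕ → Fin d → Ω → ℝ) (x : Fin d → ℝ) (n : ℕ) (ω : Ω) :
    ω ∈ tauGt X x n ↔ ∀ k, 1 ≤ k → k ≤ n → walk X x k ω ∈ weylChamber d := by
  simp only [tauGt, tau, Set.mem_ofPred_eq, natCast_lt_sInf_image]
  constructor
  · intro h k h1 h2
    by_contra h3
    exact absurd (h k ⟨h1, h3⟩) (by omega)
  · rintro h k ⟨h1, h2⟩
    by_contra h3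
    exact h2 (h k h1 (by omega))

omit [MeasurableSpace Ω] in
lemma mem_rhoGt_iff (X : ℕ → Fin d → Ω → ℝ) (x : Fin d → ℝ) (n : ℕ) (ω : Ω) :
    ω ∈ rhoGt X x n ↔ ∀ k < n, Interlace (walk X x k ω) (walk X x (k + 1) ω) := by
  simp only [rhoGt, rho, Set.mem_ofPred_eq, natCast_lt_sInf_image]
  constructor
  · intro h k hk
    by_contra h3
    exact absurd (h (k + 1) ⟨by omega, h3⟩) (by omega)
  · rintro h k ⟨h1, h2⟩
    by_contra h3
    obtain ⟨k, rfl⟩ : ∃ j, k = j + 1 := ⟨k - 1, by omega⟩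
    exact h2 (h k (by omega))

omit [MeasurableSpace Ω] in
/-- Moving the last particle first, a configuration between two ordered ones is ordered: a particle
that has moved is even further from those below, which have not. -/
lemma staySet_rev_iff (hd : 0 < d) {X : ℕ → Fin d → Ω → ℝ} {x : Fin d → ℝ}
    (hx : x ∈ weylChamber d) {ω : Ω} (hpos : ∀ k i, 0 < X k i ω) (n : ℕ) :
    (fun l => X (l / d) (turn hd Fin.revPerm l) ω) ∈ staySet (turn hd Fin.revPerm) x (n * d) ↔
      ω ∈ tauGt X x n := by
  rw [mem_tauGt_iff]
  have hp := seqPath_turn hd Fin.revPerm X x ω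
  constructor
  · intro h k _ hk
    have h1 := h (k * d) (Nat.mul_le_mul_right d hk)
    intro a b hab
    have h2 := h1 hab
    have e := fun i => hp k 0 (Nat.zero_le _) i
    simp only [add_zero, Nat.not_lt_zero, if_false] at e
    rwa [e, e] at h2
  · intro h
    have h0 : ∀ k ≤ n, walk X x k ω ∈ weylChamber d := by
      intro k hk
      rcases Nat.eq_zero_or_pos k with rfl | hk0
      · have : walk X x 0 ω = x := by funext j; simp [walk]
        rwa [this]
      · exact h k hk0 hk
    intro m hm
    rcases hm.eq_or_lt with rfl | hm
    · have e := fun i => hp n 0 (Nat.zero_le _) i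
      simp only [add_zero, Nat.not_lt_zero, if_false] at e
      intro a b hab
      rw [e, e]
      exact h0 n le_rfl hab
    have hk : m / d < n := (Nat.div_lt_iff_lt_mul hd).2 hm
    have hj : m % d ≤ d := (Nat.mod_lt _ hd).le
    have hm' : m = m / d * d + m % d := by rw [mul_comm]; exact (Nat.div_add_mod m d).symm
    rw [hm']
    intro a b hab
    rw [hp _ _ hj, hp _ _ hj]
    have hrev : ((Fin.revPerm.symm b : Fin d) : ℕ) < (Fin.revPerm.symm a : Fin d) := by
      rw [← Fin.lt_def]; simpa using hab
    have hk1 := h0 (m / d) hk.le hab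
    have hk2 := h0 (m / d + 1) hk hab
    have hb := walk_succ X x (m / d) ω b
    have hb' := hpos (m / d) b
    split_ifs <;> first | exact hk1 | exact hk2 | linarith

omit [MeasurableSpace Ω] in
/-- Moving the first particle first, the particle `i` may not overtake the old position of `i + 1`;
up to ties, this is the interlacing condition. -/
lemma staySet_one_iff (hd : 0 < d) {X : ℕ → Fin d → Ω → ℝ} {x : Fin d → ℝ}
    (hx : x ∈ weylChamber d) {ω : Ω} (hpos : ∀ k i, 0 < X k i ω)
    (hne : ∀ k i j, i ≠ j → walk X x (k + 1) ω i ≠ walk X x k ω j) (n : ℕ) :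
    (fun l => X (l / d) (turn hd 1 l) ω) ∈ staySet (turn hd 1) x (n * d) ↔
      ω ∈ rhoGt X x n := by
  rw [mem_rhoGt_iff]
  have hp := seqPath_turn hd 1 X x ω
  constructor
  · intro h k hk
    refine ⟨fun i => by rw [walk_succ]; linarith [hpos k i], fun i j hij => ?_⟩
    have hj : (i : ℕ) + 1 ≤ d := by omega
    have h1 := h (k * d + (i + 1)) (by
      calc k * d + (i + 1) ≤ k * d + d := by omega
        _ = (k + 1) * d := by ring
        _ ≤ n * d := Nat.mul_le_mul_right d hk)
    have hlt : i < j := by rw [Fin.lt_def]; omega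
    have h2 := h1 hlt
    rw [hp _ _ hj, hp _ _ hj] at h2
    have e1 : ((Equiv.symm 1 : Equiv.Perm (Fin d)) i : ℕ) = i := rfl
    have e2 : ((Equiv.symm 1 : Equiv.Perm (Fin d)) j : ℕ) = j := rfl
    rw [e1, e2, if_pos (by omega), if_neg (by omega)] at h2
    exact h2.le
  · intro h
    have hs : ∀ k < n, ∀ i j : Fin d, (i : ℕ) + 1 = j → walk X x (k + 1) ω i < walk X x k ω j :=
      fun k hk i j hij => lt_of_le_of_ne ((h k hk).2 i j hij)
        (hne k i j (by rintro rfl; omega))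
    have h0 : ∀ k ≤ n, walk X x k ω ∈ weylChamber d := by
      intro k hk
      rcases Nat.eq_zero_or_pos k with rfl | hk0
      · have : walk X x 0 ω = x := by funext j; simp [walk]
        rwa [this]
      · obtain ⟨k, rfl⟩ : ∃ j, k = j + 1 := ⟨k - 1, by omega⟩
        refine strictMono_of_lt_succ fun i j hij => ?_
        have h1 := hs k (by omega) i j hij
        have h2 := walk_succ X x k ω j
        linarith [hpos k j]
    intro m hm
    rcases hm.eq_or_lt with rfl | hm
    · have e := fun i => hp n 0 (Nat.zero_le _) i
      simp only [add_zero, Nat.not_lt_zero, if_false] at e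
      intro a b hab
      rw [e, e]
      exact h0 n le_rfl hab
    have hk : m / d < n := (Nat.div_lt_iff_lt_mul hd).2 hm
    have hj : m % d ≤ d := (Nat.mod_lt _ hd).le
    have hm' : m = m / d * d + m % d := by rw [mul_comm]; exact (Nat.div_add_mod m d).symm
    rw [hm']
    intro a b hab
    rw [hp _ _ hj, hp _ _ hj]
    have hab' : (a : ℕ) < b := hab
    have hk1 := h0 (m / d) hk.le
    have hk2 := h0 (m / d + 1) hk hab
    let c : Fin d := ⟨a + 1, by omega⟩
    have hcb : c ≤ b := by simp only [c, Fin.le_def]; omega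
    have hac := hs (m / d) hk a c rfl
    have hcb' := hk1.monotone hcb
    have hk1' := hk1 hab
    have e1 : ((Equiv.symm 1 : Equiv.Perm (Fin d)) a : ℕ) = a := rfl
    have e2 : ((Equiv.symm 1 : Equiv.Perm (Fin d)) b : ℕ) = b := rfl
    rw [e1, e2]
    split_ifs <;> first | exact hk1' | exact hk2 | linarith

section Law

variable {lam : ℝ} {X : ℕ → Fin d → Ω → ℝ}

omit [IsProbabilityMeasure μ] in
lemma ae_pos_increments (hX : ∀ i j, Measurable (X i j))
    (hlaw : ∀ i j, μ.map (X i j) = expMeasure lam) : ∀ᵐ ω ∂μ, ∀ k i, 0 < X k i ω := by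
  rw [ae_all_iff]; intro k
  rw [ae_all_iff]; intro i
  have h := ae_expMeasure_pos lam
  rw [← hlaw k i] at h
  exact ae_of_ae_map (hX k i).aemeasurable h

lemma measurable_walk (hX : ∀ i j, Measurable (X i j)) (x : Fin d → ℝ) (n : ℕ) :
    Measurable (walk X x n) :=
  measurable_pi_iff.2 fun j => measurable_const.add
    (Finset.measurable_sum _ fun i _ => hX i j)

/-- Ties have probability zero, since the exponential law has no atoms. -/
lemma ae_walk_ne (hX : ∀ i j, Measurable (X i j))
    (hlaw : ∀ i j, μ.map (X i j) = expMeasure lam)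
    (hind : iIndepFun (fun p : ℕ × Fin d => X p.1 p.2) μ) (x : Fin d → ℝ) :
    ∀ᵐ ω ∂μ, ∀ k i j, i ≠ j → walk X x (k + 1) ω i ≠ walk X x k ω j := by
  rw [ae_all_iff]; intro k
  rw [ae_all_iff]; intro i
  rw [ae_all_iff]; intro j
  -- the increment of particle `i` is independent of the configuration at time `k`
  have hmem : ∀ {l : ℕ} {a : Fin d}, l ∈ Finset.range k →
      (l, a) ∈ Finset.range k ×ˢ (Finset.univ : Finset (Fin d)) := fun h =>
    Finset.mk_mem_product h (Finset.mem_univ _)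
  let ψ : ((Finset.range k ×ˢ (Finset.univ : Finset (Fin d)) : Finset (ℕ × Fin d)) → ℝ) → ℝ :=
    fun v => (x j + ∑ l : Finset.range k, v ⟨(l, j), hmem l.2⟩) -
      (x i + ∑ l : Finset.range k, v ⟨(l, i), hmem l.2⟩)
  have hψ : Measurable ψ := by
    refine Measurable.sub ?_ ?_ <;>
    exact measurable_const.add (Finset.measurable_sum _ fun l _ => measurable_pi_apply _)
  have h1 := hind.indepFun_finset (Finset.range k ×ˢ Finset.univ) {(k, i)} (by simp)
    (fun p => hX p.1 p.2)
  have h2 : IndepFun (fun ω => walk X x k ω j - walk X x k ω i) (X k i) μ := by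
    have := h1.comp hψ (measurable_pi_apply (⟨(k, i), by simp⟩ : ({(k, i)} : Finset (ℕ × Fin d))))
    refine this.congr (Filter.Eventually.of_forall fun ω => ?_) (Filter.Eventually.of_forall
      fun ω => rfl)
    simp only [ψ, Function.comp_apply, walk]
    rw [Finset.sum_coe_sort (Finset.range k) (fun l => X l j ω),
      Finset.sum_coe_sort (Finset.range k) (fun l => X l i ω)]
  have hZ : Measurable fun ω => walk X x k ω j - walk X x k ω i :=
    ((measurable_pi_apply j).comp (measurable_walk hX x k)).sub
      ((measurable_pi_apply i).comp (measurable_walk hX x k))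
  have hD : MeasurableSet {p : ℝ × ℝ | p.1 = p.2} := measurableSet_eq_fun measurable_fst
    measurable_snd
  have h3 := lintegral_comp_of_indepFun hZ (hX k i) h2
    (g := {p : ℝ × ℝ | p.1 = p.2}.indicator 1) (measurable_one.indicator hD)
  have hatom : ∀ a : ℝ, expMeasure lam {a} = 0 := fun a =>
    withDensity_absolutelyContinuous _ _ (by simp)
  have h4 : ∀ z : ℝ, ∫⁻ s, {p : ℝ × ℝ | p.1 = p.2}.indicator (1 : ℝ × ℝ → ℝ≥0∞) (z, s)
      ∂(expMeasure lam) = 0 := by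
    intro z
    have : (fun s : ℝ => {p : ℝ × ℝ | p.1 = p.2}.indicator (1 : ℝ × ℝ → ℝ≥0∞) (z, s)) =
        ({z} : Set ℝ).indicator 1 := by
      funext s
      by_cases h : s = z
      · simp [h]
      · have h' : ¬ z = s := fun e => h e.symm
        simp [h, h']
    rw [this, lintegral_indicator_one (measurableSet_singleton z), hatom]
  rw [hlaw] at h3
  simp only [h4, lintegral_zero] at h3
  have hmeas : Measurable fun ω =>
      {p : ℝ × ℝ | p.1 = p.2}.indicator (1 : ℝ × ℝ → ℝ≥0∞)
        (walk X x k ω j - walk X x k ω i, X k i ω) :=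
    (measurable_one.indicator hD).comp (hZ.prodMk (hX k i))
  rw [lintegral_eq_zero_iff hmeas] at h3
  filter_upwards [h3] with ω hω _ heq
  rw [walk_succ] at heq
  rw [Set.indicator_of_mem (by simp only [Set.mem_ofPred_eq]; linarith)] at hω
  simp at hω

/-- The indicator of a measurable set, as a measurable function. -/
noncomputable def indFun {B : Set (Fin d → ℝ)} (hB : MeasurableSet B) : MFun d :=
  ⟨B.indicator 1, measurable_one.indicator hB⟩

lemma killedLaw_apply_of_ae {A : Set Ω} {n : ℕ} {e : Equiv.Perm (Fin d)} (hd : 0 < d)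
    (hX : ∀ i j, Measurable (X i j)) (hlaw : ∀ i j, μ.map (X i j) = expMeasure lam)
    (hind : iIndepFun (fun p : ℕ × Fin d => X p.1 p.2) μ) {x : Fin d → ℝ}
    (hx : x ∈ weylChamber d)
    (hA : ∀ᵐ ω ∂μ, (fun l => X (l / d) (turn hd e l) ω) ∈ staySet (turn hd e) x (n * d) ↔ ω ∈ A)
    {B : Set (Fin d → ℝ)} (hB : MeasurableSet B) :
    killedLaw μ X x n A B = (seqWord lam (turn hd e) (n * d) (indFun hB)).1 x := by
  have hw := measurable_walk hX x n
  let ξ : ℕ → Ω → ℝ := fun l => X (l / d) (turn hd e l)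
  have hξ : ∀ l, Measurable (ξ l) := fun l => hX _ _
  have h := lintegral_seqPath (μ := μ) (lam := lam) (turn hd e) (ξ := ξ) hξ
    (fun l => hlaw _ _) (hind.precomp (injective_turn hd e)) hx (n * d) (indFun hB)
  rw [← h, killedLaw, Measure.map_apply hw hB, Measure.restrict_apply (hw hB)]
  have hξm : Measurable fun ω l => ξ l ω := measurable_pi_iff.2 hξ
  have hset : MeasurableSet {ω | (fun l => ξ l ω) ∈ staySet (turn hd e) x (n * d) ∧
      walk X x n ω ∈ B} := (hξm (measurableSet_staySet _ _ _)).inter (hw hB)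
  have hend : ∀ ω, seqPath (turn hd e) x (fun l => ξ l ω) (n * d) = walk X x n ω := by
    intro ω
    funext i
    simpa using seqPath_turn hd e X x ω n 0 (Nat.zero_le _) i
  have h1 : (fun ω => (staySet (turn hd e) x (n * d)).indicator
      (fun u => (indFun hB).1 (seqPath (turn hd e) x u (n * d))) (fun l => ξ l ω)) =
      {ω | (fun l => ξ l ω) ∈ staySet (turn hd e) x (n * d) ∧ walk X x n ω ∈ B}.indicator 1 := by
    funext ω
    by_cases hs : (fun l => ξ l ω) ∈ staySet (turn hd e) x (n * d)
    · rw [Set.indicator_of_mem hs, hend]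
      by_cases hb : walk X x n ω ∈ B
      · refine Eq.trans ?_ (Set.indicator_of_mem (by exact ⟨hs, hb⟩) 1).symm
        simp [indFun, hb]
      · refine Eq.trans ?_ (Set.indicator_of_notMem (fun h' => hb h'.2) 1).symm
        simp [indFun, hb]
    · rw [Set.indicator_of_notMem hs]
      exact (Set.indicator_of_notMem (fun h' => hs h'.1) 1).symm
  rw [h1, lintegral_indicator_one hset]
  refine measure_congr ?_
  filter_upwards [hA] with ω hω
  refine propext ?_
  change (walk X x n ω ∈ B ∧ ω ∈ A) ↔ (_ ∧ _)
  rw [← hω]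
  exact and_comm

lemma killedLaw_tauGt_apply (hd : 0 < d)
    (hX : ∀ i j, Measurable (X i j)) (hlaw : ∀ i j, μ.map (X i j) = expMeasure lam)
    (hind : iIndepFun (fun p : ℕ × Fin d => X p.1 p.2) μ) {x : Fin d → ℝ}
    (hx : x ∈ weylChamber d) (n : ℕ) {B : Set (Fin d → ℝ)} (hB : MeasurableSet B) :
    killedLaw μ X x n (tauGt X x n) B = ((descTop (jumpOp lam) d d ^ n : Op d) (indFun hB)).1 x := by
  rw [killedLaw_apply_of_ae (e := Fin.revPerm) hd hX hlaw hind hx ?_ hB]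
  · have h := seqWord_periodic (lam := lam) (c := turn hd Fin.revPerm)
      (w := descTop (jumpOp lam) d) rfl (fun k j hj => by
        rw [turn_mul_add hd _ k j hj, descTop]
        congr 2
        simp [Fin.val_rev]; omega) n 0 (Nat.zero_le d)
    rw [add_zero] at h
    rw [h]; rfl
  · filter_upwards [ae_pos_increments hX hlaw] with ω hω
    exact staySet_rev_iff hd hx hω n

lemma killedLaw_rhoGt_apply (hd : 0 < d)
    (hX : ∀ i j, Measurable (X i j)) (hlaw : ∀ i j, μ.map (X i j) = expMeasure lam)
    (hind : iIndepFun (fun p : ℕ × Fin d => X p.1 p.2) μ) {x : Fin d → ℝ}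
    (hx : x ∈ weylChamber d) (n : ℕ) {B : Set (Fin d → ℝ)} (hB : MeasurableSet B) :
    killedLaw μ X x n (rhoGt X x n) B = ((ascWord (jumpOp lam) d ^ n : Op d) (indFun hB)).1 x := by
  rw [killedLaw_apply_of_ae (e := 1) hd hX hlaw hind hx ?_ hB]
  · have h := seqWord_periodic (lam := lam) (c := turn hd 1)
      (w := ascWord (jumpOp lam)) rfl (fun k j hj => by
        rw [turn_mul_add hd _ k j hj, ascWord]; rfl) n 0 (Nat.zero_le d)
    rw [add_zero] at h
    rw [h]; rfl
  · filter_upwards [ae_pos_increments hX hlaw, ae_walk_ne hX hlaw hind x] with ω hω hω'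
    exact staySet_one_iff hd hx hω hω' n

omit [IsProbabilityMeasure μ] in
lemma measure_eq_killedLaw_univ (hX : ∀ i j, Measurable (X i j)) (x : Fin d → ℝ) (n : ℕ)
    (A : Set Ω) : μ A = killedLaw μ X x n A Set.univ := by
  rw [killedLaw, Measure.map_apply (measurable_walk hX x n) MeasurableSet.univ]
  simp

end Law

end Walk

/-! ### Gamma laws with integer shape -/

section GammaLaw

/-- The density of the Gamma law of shape `m + 1` and rate `lam`. -/
noncomputable def gammaDens (lam : ℝ) (m : ℕ) (u : ℝ) : ℝ :=
  if 0 ≤ u then lam ^ (m + 1) * u ^ m / m.factorial * Real.exp (-(lam * u)) else 0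

lemma gammaDens_of_nonneg {lam : ℝ} {m : ℕ} {u : ℝ} (hu : 0 ≤ u) :
    gammaDens lam m u = lam ^ (m + 1) * u ^ m / m.factorial * Real.exp (-(lam * u)) := if_pos hu

lemma gammaDens_of_neg {lam : ℝ} {m : ℕ} {u : ℝ} (hu : u < 0) : gammaDens lam m u = 0 :=
  if_neg (not_le.2 hu)

lemma gammaDens_eq_gammaPDFReal (lam : ℝ) (m : ℕ) (u : ℝ) :
    gammaPDFReal ((m + 1 : ℕ) : ℝ) lam u = gammaDens lam m u := by
  unfold gammaPDFReal gammaDens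
  split_ifs with h
  · have h1 : (((m + 1 : ℕ) : ℝ) - 1) = (m : ℝ) := by push_cast; ring
    have h2 : Real.Gamma ((m + 1 : ℕ) : ℝ) = m.factorial := by
      push_cast; exact Real.Gamma_nat_eq_factorial m
    rw [h1, h2, Real.rpow_natCast, Real.rpow_natCast]
    ring
  · rfl

lemma gammaDens_nonneg {lam : ℝ} (hl : 0 < lam) (m : ℕ) (u : ℝ) : 0 ≤ gammaDens lam m u := by
  unfold gammaDens
  split_ifs <;> positivity

lemma measurable_gammaDens (lam : ℝ) (m : ℕ) : Measurable (gammaDens lam m) := by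
  unfold gammaDens
  exact Measurable.ite measurableSet_Ici (by fun_prop) measurable_const

/-- The Gamma law of shape `n` and rate `lam`; the Dirac mass at `0` for `n = 0`. -/
noncomputable def gammaLaw (lam : ℝ) (n : ℕ) : Measure ℝ :=
  if n = 0 then Measure.dirac 0 else gammaMeasure (n : ℝ) lam

lemma gammaLaw_zero (lam : ℝ) : gammaLaw lam 0 = Measure.dirac 0 := if_pos rfl

lemma gammaLaw_succ (lam : ℝ) (m : ℕ) :
    gammaLaw lam (m + 1) = volume.withDensity fun u => ENNReal.ofReal (gammaDens lam m u) := by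
  rw [gammaLaw, if_neg (by omega), gammaMeasure]
  congr 1
  funext u
  rw [gammaPDF, gammaDens_eq_gammaPDFReal]

lemma gammaLaw_one (lam : ℝ) : gammaLaw lam 1 = expMeasure lam := by
  rw [gammaLaw, if_neg (by omega), expMeasure]; simp

lemma expMeasure_eq (lam : ℝ) :
    expMeasure lam = volume.withDensity fun u => ENNReal.ofReal (gammaDens lam 0 u) := by
  rw [← gammaLaw_one]; exact gammaLaw_succ lam 0

variable {lam : ℝ}

instance isProbabilityMeasure_gammaLaw [Fact (0 < lam)] (n : ℕ) :
    IsProbabilityMeasure (gammaLaw lam n) := by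
  unfold gammaLaw
  split_ifs with h
  · infer_instance
  · exact isProbabilityMeasure_gammaMeasure (by positivity) Fact.out

lemma integrable_gammaDens (hl : 0 < lam) (m : ℕ) : Integrable (gammaDens lam m) := by
  refine ⟨(measurable_gammaDens lam m).aestronglyMeasurable, ?_⟩
  rw [hasFiniteIntegral_iff_ofReal (Filter.Eventually.of_forall (gammaDens_nonneg hl m))]
  have := isProbabilityMeasure_gammaMeasure (a := ((m + 1 : ℕ) : ℝ)) (r := lam) (by positivity) hl
  have h1 : gammaMeasure ((m + 1 : ℕ) : ℝ) lam Set.univ = 1 := measure_univ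
  rw [gammaMeasure, withDensity_apply _ MeasurableSet.univ, Measure.restrict_univ] at h1
  simp only [gammaPDF, gammaDens_eq_gammaPDFReal] at h1
  rw [h1]; exact ENNReal.one_lt_top

lemma integral_gammaDens (hl : 0 < lam) (m : ℕ) : ∫ u, gammaDens lam m u = 1 := by
  have := isProbabilityMeasure_gammaMeasure (a := ((m + 1 : ℕ) : ℝ)) (r := lam) (by positivity) hl
  have h1 : gammaMeasure ((m + 1 : ℕ) : ℝ) lam Set.univ = 1 := measure_univ
  rw [gammaMeasure, withDensity_apply _ MeasurableSet.univ, Measure.restrict_univ] at h1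
  simp only [gammaPDF, gammaDens_eq_gammaPDFReal] at h1
  rw [integral_eq_lintegral_of_nonneg_ae (Filter.Eventually.of_forall (gammaDens_nonneg hl m))
    (measurable_gammaDens lam m).aestronglyMeasurable, h1]
  rfl

lemma lintegral_gammaDens_conv (hl : 0 < lam) (n : ℕ) (u : ℝ) :
    ∫⁻ s, ENNReal.ofReal (gammaDens lam n (u - s)) * ENNReal.ofReal (gammaDens lam 0 s) =
      ENNReal.ofReal (gammaDens lam (n + 1) u) := by
  rcases lt_or_ge u 0 with hu | hu
  · rw [gammaDens_of_neg hu, ENNReal.ofReal_zero, lintegral_eq_zero_of_ae_eq_zero]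
    refine Filter.Eventually.of_forall fun s => ?_
    rcases lt_or_ge s 0 with hs | hs
    · simp [gammaDens_of_neg hs]
    · simp [gammaDens_of_neg (show u - s < 0 by linarith)]
  let c : ℝ := lam ^ (n + 2) / n.factorial * Real.exp (-(lam * u))
  have h1 : ∀ s, ENNReal.ofReal (gammaDens lam n (u - s)) * ENNReal.ofReal (gammaDens lam 0 s) =
      (Set.Icc 0 u).indicator (fun s => ENNReal.ofReal (c * (u - s) ^ n)) s := by
    intro s
    by_cases hs : s ∈ Set.Icc 0 u
    · rw [Set.indicator_of_mem hs, ← ENNReal.ofReal_mul (gammaDens_nonneg hl _ _),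
        gammaDens_of_nonneg (sub_nonneg.2 hs.2), gammaDens_of_nonneg hs.1]
      congr 1
      have : Real.exp (-(lam * u)) = Real.exp (-(lam * (u - s))) * Real.exp (-(lam * s)) := by
        rw [← Real.exp_add]; ring_nf
      simp only [c, this, Nat.factorial_zero, pow_zero]
      push_cast
      ring
    · rw [Set.indicator_of_notMem hs]
      rcases lt_or_ge s 0 with h | h
      · simp [gammaDens_of_neg h]
      · have : u - s < 0 := by
          by_contra h'
          exact hs ⟨h, by linarith⟩
        simp [gammaDens_of_neg this]
  simp_rw [h1]
  rw [lintegral_indicator measurableSet_Icc, ← ofReal_integral_eq_lintegral_ofReal]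
  · congr 1
    rw [integral_Icc_eq_integral_Ioc, ← intervalIntegral.integral_of_le hu,
      intervalIntegral.integral_const_mul,
      intervalIntegral.integral_comp_sub_left (fun y => y ^ n) u, integral_pow,
      gammaDens_of_nonneg hu, Nat.factorial_succ]
    simp only [c]
    push_cast
    have : (n.factorial : ℝ) ≠ 0 := by positivity
    field_simp
    simp
  · exact (Continuous.integrableOn_Icc (by fun_prop))
  · refine (ae_restrict_iff' measurableSet_Icc).2 (Filter.Eventually.of_forall fun s hs => ?_)
    have := sub_nonneg.2 hs.2
    simp only [c]
    positivity

/-- Convolving a Gamma law with an exponential law raises the shape by one. -/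
lemma lintegral_gammaLaw_succ (hl : 0 < lam) (n : ℕ) {φ : ℝ → ℝ≥0∞} (hφ : Measurable φ) :
    ∫⁻ s, ∫⁻ y, φ (y + s) ∂(gammaLaw lam n) ∂(expMeasure lam) =
      ∫⁻ u, φ u ∂(gammaLaw lam (n + 1)) := by
  have hm : ∀ m, Measurable fun u => ENNReal.ofReal (gammaDens lam m u) := fun m =>
    (measurable_gammaDens lam m).ennreal_ofReal
  have hφs : ∀ s, Measurable fun y => φ (y + s) := fun s =>
    hφ.comp (measurable_id.add_const s)
  rcases n with _ | n
  · simp only [gammaLaw_zero]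
    have : ∀ s, ∫⁻ y, φ (y + s) ∂(Measure.dirac (0 : ℝ)) = φ s := by
      intro s
      rw [lintegral_dirac' _ (hφs s)]
      simp
    simp_rw [this]
    rw [zero_add, gammaLaw_one]
  · rw [gammaLaw_succ, gammaLaw_succ, expMeasure_eq,
      lintegral_withDensity_eq_lintegral_mul _ (hm _) hφ,
      lintegral_withDensity_eq_lintegral_mul _ (hm _)]
    swap
    · exact Measurable.lintegral_prod_right' (f := fun p : ℝ × ℝ => φ (p.2 + p.1))
        (hφ.comp (measurable_snd.add measurable_fst))
    have h1 : ∀ s, ((fun u => ENNReal.ofReal (gammaDens lam 0 u)) * fun s =>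
        ∫⁻ y, φ (y + s) ∂(volume.withDensity fun u => ENNReal.ofReal (gammaDens lam n u))) s =
        ∫⁻ u, φ u * (ENNReal.ofReal (gammaDens lam n (u - s)) *
          ENNReal.ofReal (gammaDens lam 0 s)) := by
      intro s
      rw [Pi.mul_apply, lintegral_withDensity_eq_lintegral_mul _ (hm n)
        (hφs s), ← lintegral_const_mul _ ((hm n).mul (hφs s))]
      rw [← lintegral_sub_right_eq_self _ s]
      refine lintegral_congr fun u => ?_
      simp only [Pi.mul_apply, sub_add_cancel]
      ring
    simp_rw [h1]
    rw [lintegral_lintegral_swap]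
    · refine lintegral_congr fun u => ?_
      rw [lintegral_const_mul, lintegral_gammaDens_conv hl, Pi.mul_apply, mul_comm]
      exact ((hm n).comp (measurable_const.sub measurable_id)).mul (hm 0)
    · exact ((hφ.comp measurable_snd).mul (((hm n).comp
        (measurable_snd.sub measurable_fst)).mul ((hm 0).comp measurable_fst))).aemeasurable

/-- The lack of memory of the exponential law. -/
lemma expMeasure_restrict_Ici {g : ℝ} (hg : 0 ≤ g) :
    (expMeasure lam).restrict (Set.Ici g) =
      ENNReal.ofReal (Real.exp (-(lam * g))) • (expMeasure lam).map fun s => g + s := by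
  have hm : Measurable fun u => ENNReal.ofReal (gammaDens lam 0 u) :=
    (measurable_gammaDens lam 0).ennreal_ofReal
  have hmap : Measurable fun s : ℝ => g + s := measurable_const.add measurable_id
  ext B hB
  rw [Measure.restrict_apply hB, Measure.smul_apply, Measure.map_apply hmap hB, expMeasure_eq,
    withDensity_apply _ (hB.inter measurableSet_Ici), withDensity_apply _ (hmap hB), smul_eq_mul,
    ← lintegral_indicator (hB.inter measurableSet_Ici), ← lintegral_indicator (hmap hB),
    ← lintegral_const_mul _ (hm.indicator (hmap hB)), ← lintegral_add_left_eq_self _ g]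
  refine lintegral_congr fun s => ?_
  by_cases hs : 0 ≤ s
  · have hmem : (g + s ∈ B ∩ Set.Ici g) ↔ s ∈ (fun s : ℝ => g + s) ⁻¹' B := by
      simp [hs]
    by_cases h : s ∈ (fun s : ℝ => g + s) ⁻¹' B
    · rw [Set.indicator_of_mem h, Set.indicator_of_mem (hmem.2 h),
        ← ENNReal.ofReal_mul (Real.exp_pos _).le, gammaDens_of_nonneg hs,
        gammaDens_of_nonneg (add_nonneg hg hs)]
      congr 1
      have : Real.exp (-(lam * (g + s))) = Real.exp (-(lam * g)) * Real.exp (-(lam * s)) := by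
        rw [← Real.exp_add]; ring_nf
      rw [this]
      simp only [pow_zero]
      ring
    · rw [Set.indicator_of_notMem h, Set.indicator_of_notMem (fun h' => h (hmem.1 h')), mul_zero]
  · rw [Set.indicator_of_notMem (fun h => hs (by simpa using h.2))]
    simp [gammaDens_of_neg (not_le.1 hs)]

lemma integrable_pow_gammaLaw [hl : Fact (0 < lam)] (n k : ℕ) :
    Integrable (fun y : ℝ => y ^ k) (gammaLaw lam n) := by
  rcases n with _ | m
  · rw [gammaLaw_zero]
    refine ⟨by fun_prop, ?_⟩
    rw [HasFiniteIntegral, lintegral_dirac]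
    exact ENNReal.coe_lt_top
  · have h0 : (0 : ℝ) < lam := hl.out
    rw [gammaLaw_succ, integrable_withDensity_iff_integrable_smul'
      (measurable_gammaDens lam m).ennreal_ofReal (by simp)]
    have h1 : (fun y : ℝ => (ENNReal.ofReal (gammaDens lam m y)).toReal • y ^ k) = fun y =>
        ((m + k).factorial / (m.factorial * lam ^ k)) * gammaDens lam (m + k) y := by
      funext y
      rw [ENNReal.toReal_ofReal (gammaDens_nonneg h0 m y), smul_eq_mul]
      rcases lt_or_ge y 0 with hy | hy
      · simp [gammaDens_of_neg hy]
      · rw [gammaDens_of_nonneg hy, gammaDens_of_nonneg hy]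
        have : ((m + k).factorial : ℝ) ≠ 0 := by positivity
        have : (m.factorial : ℝ) ≠ 0 := by positivity
        field_simp
        ring
    rw [h1]
    exact (integrable_gammaDens h0 _).const_mul _

lemma integrable_add_pow_gammaLaw [Fact (0 < lam)] (n k : ℕ) (c : ℝ) :
    Integrable (fun y : ℝ => (c + y) ^ k) (gammaLaw lam n) := by
  simp_rw [add_pow]
  refine integrable_finsetSum _ fun j _ => ?_
  exact ((integrable_pow_gammaLaw n (k - j)).const_mul _).mul_const _

end GammaLaw

/-! ### Reflection: killed jumps acting on antisymmetric functions -/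

section Reflection

variable {d : ℕ} {lam : ℝ}

/-- The product of Gamma laws with shapes `a i` and common rate `lam`. -/
noncomputable def gammaPi (lam : ℝ) (a : Fin d → ℕ) : Measure (Fin d → ℝ) :=
  Measure.pi fun i => gammaLaw lam (a i)

instance [Fact (0 < lam)] (a : Fin d → ℕ) : IsProbabilityMeasure (gammaPi lam a) := by
  unfold gammaPi; infer_instance

lemma gammaPi_zero [Fact (0 < lam)] : gammaPi lam (fun _ : Fin d => 0) = Measure.dirac 0 := by
  refine (Measure.pi_eq fun s hs => ?_)
  simp only [gammaLaw_zero]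
  rw [Measure.dirac_apply' _ (MeasurableSet.univ_pi hs)]
  simp_rw [fun i => Measure.dirac_apply' (0 : ℝ) (hs i)]
  classical
  by_cases h : (0 : Fin d → ℝ) ∈ Set.univ.pi s
  · rw [Set.indicator_of_mem h]
    rw [Finset.prod_eq_one]
    · rfl
    · intro i _
      rw [Set.indicator_of_mem (by simpa using h i trivial)]; rfl
  · rw [Set.indicator_of_notMem h]
    obtain ⟨i, hi⟩ : ∃ i, (0 : ℝ) ∉ s i := by
      by_contra hcon
      push Not at hcon
      exact h fun i _ => hcon i
    exact (Finset.prod_eq_zero (Finset.mem_univ i) (Set.indicator_of_notMem hi _)).symm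

/-- Adding an independent exponential jump to coordinate `i` raises its shape by one. -/
lemma map_gammaPi_prod_exp [hl : Fact (0 < lam)] (a : Fin d → ℕ) (i : Fin d) :
    ((gammaPi lam a).prod (expMeasure lam)).map (fun p => p.1 + Pi.single i p.2) =
      gammaPi lam (Function.update a i (a i + 1)) := by
  symm
  refine Measure.pi_eq fun s hs => ?_
  rw [Measure.map_apply (measurable_add_single i) (MeasurableSet.univ_pi hs),
    Measure.prod_apply_symm (measurable_add_single i (MeasurableSet.univ_pi hs))]
  have h1 : ∀ t : ℝ, gammaPi lam a ((fun y => (y, t)) ⁻¹'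
      ((fun p : (Fin d → ℝ) × ℝ => p.1 + Pi.single i p.2) ⁻¹' Set.univ.pi s)) =
      (∫⁻ y, (s i).indicator 1 (y + t) ∂(gammaLaw lam (a i))) *
        ∏ j ∈ Finset.univ.erase i, gammaLaw lam (a j) (s j) := by
    intro t
    have h2 : ((fun y => (y, t)) ⁻¹' ((fun p : (Fin d → ℝ) × ℝ => p.1 + Pi.single i p.2) ⁻¹'
        Set.univ.pi s)) = Set.univ.pi (Function.update s i ((fun y => y + t) ⁻¹' s i)) := by
      ext y
      simp only [Set.mem_preimage, Set.mem_univ_pi]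
      refine forall_congr' fun j => ?_
      by_cases hj : j = i
      · subst hj; simp
      · simp [hj]
    rw [h2, gammaPi, Measure.pi_pi, ← Finset.mul_prod_erase _ _ (Finset.mem_univ i)]
    congr 1
    · have hpre : MeasurableSet ((fun y => y + t) ⁻¹' s i) := (measurable_id.add_const t) (hs i)
      rw [Function.update_self, ← lintegral_indicator_one hpre]
      rfl
    · refine Finset.prod_congr rfl fun j hj => ?_
      rw [Function.update_of_ne (Finset.ne_of_mem_erase hj)]
  simp_rw [h1]
  have hmeas : Measurable fun p : ℝ × ℝ => (s i).indicator (1 : ℝ → ℝ≥0∞) (p.2 + p.1) :=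
    (measurable_one.indicator (hs i)).comp (measurable_snd.add measurable_fst)
  rw [lintegral_mul_const _ hmeas.lintegral_prod_right',
    lintegral_gammaLaw_succ hl.out (a i) (measurable_one.indicator (hs i)),
    lintegral_indicator_one (hs i), ← Finset.mul_prod_erase _ _ (Finset.mem_univ i)]
  congr 1
  · rw [Function.update_self]
  · refine Finset.prod_congr rfl fun j hj => ?_
    rw [Function.update_of_ne (Finset.ne_of_mem_erase hj)]

/-- The average of `F (x + η)` over independent Gamma variables `η i` of shapes `a i`. -/
noncomputable def gammaAvg (lam : ℝ) (a : Fin d → ℕ) (F : (Fin d → ℝ) → ℝ) (x : Fin d → ℝ) : ℝ :=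
  ∫ y, F (x + y) ∂(gammaPi lam a)

lemma measurable_comp_add {F : (Fin d → ℝ) → ℝ} (hF : Measurable F) (x : Fin d → ℝ) :
    Measurable fun y => F (x + y) :=
  hF.comp (measurable_const.add measurable_id)

/-- Measurable functions all of whose Gamma averages converge absolutely. -/
structure IsGood (lam : ℝ) (F : (Fin d → ℝ) → ℝ) : Prop where
  measurable : Measurable F
  integrable : ∀ (a : Fin d → ℕ) x, Integrable (fun y => F (x + y)) (gammaPi lam a)

/-- Functions that change sign when two coordinates are exchanged. -/
def IsAntisymm (F : (Fin d → ℝ) → ℝ) : Prop :=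
  ∀ i j, i ≠ j → ∀ x, F (x ∘ Equiv.swap i j) = -F x

lemma IsGood.of_bounded [Fact (0 < lam)] {F : (Fin d → ℝ) → ℝ} (hF : Measurable F) {C : ℝ}
    (hC : ∀ x, |F x| ≤ C) : IsGood lam F :=
  ⟨hF, fun _ x => Integrable.of_bound (C := C)
    (measurable_comp_add hF _).aestronglyMeasurable
    (Filter.Eventually.of_forall fun y => hC (x + y))⟩

lemma measurable_gammaAvg [Fact (0 < lam)] (a : Fin d → ℕ) {F : (Fin d → ℝ) → ℝ}
    (hF : Measurable F) : Measurable (gammaAvg lam a F) := by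
  have h : StronglyMeasurable fun p : (Fin d → ℝ) × (Fin d → ℝ) => F (p.1 + p.2) :=
    (hF.comp (measurable_fst.add measurable_snd)).stronglyMeasurable
  exact h.integral_prod_right'.measurable

lemma gammaAvg_zero [Fact (0 < lam)] {F : (Fin d → ℝ) → ℝ} (hF : Measurable F) :
    gammaAvg lam (fun _ => 0) F = F := by
  funext x
  rw [gammaAvg, gammaPi_zero, integral_dirac' _ _
    (measurable_comp_add hF x).stronglyMeasurable]
  simp

lemma measurePreserving_add_single_gammaPi [Fact (0 < lam)] (a : Fin d → ℕ) (i : Fin d) :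
    MeasurePreserving (fun p : (Fin d → ℝ) × ℝ => p.1 + Pi.single i p.2)
      ((gammaPi lam a).prod (expMeasure lam)) (gammaPi lam (Function.update a i (a i + 1))) :=
  ⟨measurable_add_single i, map_gammaPi_prod_exp a i⟩

section Jump

variable [Fact (0 < lam)] {F : (Fin d → ℝ) → ℝ} (hF : IsGood lam F) (a : Fin d → ℕ) (i : Fin d)
  (x : Fin d → ℝ)
include hF

lemma IsGood.integrable_prod :
    Integrable (fun p : (Fin d → ℝ) × ℝ => F (x + (p.1 + Pi.single i p.2)))
      ((gammaPi lam a).prod (expMeasure lam)) :=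
  (measurePreserving_add_single_gammaPi a i).integrable_comp_of_integrable
    (hF.integrable (Function.update a i (a i + 1)) x)

lemma IsGood.gammaAvg_update :
    gammaAvg lam (Function.update a i (a i + 1)) F x =
      ∫ s, gammaAvg lam a F (x + Pi.single i s) ∂(expMeasure lam) := by
  have h := hF.integrable_prod a i x
  rw [gammaAvg, ← map_gammaPi_prod_exp a i, integral_map (measurable_add_single i).aemeasurable
    (measurable_comp_add hF.measurable x).aestronglyMeasurable,
    integral_prod_symm _ h]
  refine integral_congr_ae (Filter.Eventually.of_forall fun s => ?_)
  refine integral_congr_ae (Filter.Eventually.of_forall fun y => ?_)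
  change F _ = F _
  congr 1
  abel

lemma IsGood.integrable_gammaAvg :
    Integrable (fun s => gammaAvg lam a F (x + Pi.single i s)) (expMeasure lam) := by
  have h := (hF.integrable_prod a i x).integral_prod_right
  refine h.congr (Filter.Eventually.of_forall fun s => ?_)
  refine integral_congr_ae (Filter.Eventually.of_forall fun y => ?_)
  change F _ = F _
  congr 1
  abel

end Jump

lemma measurePreserving_swap_gammaPi [Fact (0 < lam)] (a : Fin d → ℕ) {i j : Fin d}
    (hij : a i = a j) :
    MeasurePreserving (fun y : Fin d → ℝ => y ∘ Equiv.swap i j) (gammaPi lam a)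
      (gammaPi lam a) := by
  have hm : Measurable fun y : Fin d → ℝ => y ∘ Equiv.swap i j :=
    measurable_pi_iff.2 fun k => measurable_pi_apply _
  refine ⟨hm, ?_⟩
  symm
  refine Measure.pi_eq fun s hs => ?_
  rw [Measure.map_apply hm (MeasurableSet.univ_pi hs)]
  have : (fun y : Fin d → ℝ => y ∘ Equiv.swap i j) ⁻¹' Set.univ.pi s =
      Set.univ.pi (s ∘ Equiv.swap i j) := by
    ext y
    simp only [Set.mem_preimage, Set.mem_univ_pi, Function.comp_apply]
    constructor
    · intro h k; simpa using h (Equiv.swap i j k)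
    · intro h k; simpa using h (Equiv.swap i j k)
  rw [this, gammaPi, Measure.pi_pi, ← Equiv.prod_comp (Equiv.swap i j)]
  refine Finset.prod_congr rfl fun k _ => ?_
  simp only [Function.comp_apply, Equiv.swap_apply_self]
  congr 2
  by_cases h1 : k = i
  · subst h1; simp [hij]
  · by_cases h2 : k = j
    · subst h2; simp [hij]
    · rw [Equiv.swap_apply_of_ne_of_ne h1 h2]

lemma IsAntisymm.gammaAvg_comp_swap [Fact (0 < lam)] {F : (Fin d → ℝ) → ℝ} (hF : Measurable F)
    (hanti : IsAntisymm F) (a : Fin d → ℕ) {i j : Fin d} (hne : i ≠ j) (hij : a i = a j)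
    (x : Fin d → ℝ) : gammaAvg lam a F (x ∘ Equiv.swap i j) = -gammaAvg lam a F x := by
  have hp := measurePreserving_swap_gammaPi (lam := lam) a hij
  have h1 : gammaAvg lam a F (x ∘ Equiv.swap i j) =
      ∫ y, F (x ∘ Equiv.swap i j + y ∘ Equiv.swap i j) ∂(gammaPi lam a) := by
    rw [gammaAvg]
    conv_lhs => rw [← hp.map_eq]
    exact integral_map hp.measurable.aemeasurable
      (measurable_comp_add hF _).aestronglyMeasurable
  rw [h1, gammaAvg, ← integral_neg]
  refine integral_congr_ae (Filter.Eventually.of_forall fun y => ?_)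
  exact hanti i j hne (x + y)

/-- The reflection step. If the particle above `i` has one more exponential jump to come than `i`
(or there is no particle above), then killing the jump of `i` does not change the average of an
antisymmetric function: by lack of memory a blocked jump restarts from the position of the blocking
particle, with as many jumps to come for both. -/
lemma integral_indicator_gammaAvg [Fact (0 < lam)] {F : (Fin d → ℝ) → ℝ} (hF : IsGood lam F)
    (hanti : IsAntisymm F) (a : Fin d → ℕ) (i : Fin d)
    (hi : ∀ j : Fin d, (i : ℕ) + 1 = j → a j = a i + 1) {x : Fin d → ℝ} (hx : x ∈ weylChamber d) :
    ∫ s, (weylChamber d).indicator (gammaAvg lam a F) (x + Pi.single i s) ∂(expMeasure lam) =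
      gammaAvg lam (Function.update a i (a i + 1)) F x := by
  rw [hF.gammaAvg_update a i x]
  by_cases hlast : (i : ℕ) + 1 < d
  swap
  · refine integral_congr_ae ?_
    filter_upwards [ae_expMeasure_pos lam] with s hs
    refine Set.indicator_of_mem ?_ _
    intro b c hbc
    have h1 := hx hbc
    have h2 : b ≠ i := by
      rintro rfl
      have := c.2; rw [Fin.lt_def] at hbc; omega
    have h3 : 0 ≤ if c = i then s else 0 := by split_ifs <;> simp [hs.le]
    simp only [Pi.add_apply, Pi.single_apply, h2, if_false]
    linarith
  let j : Fin d := ⟨i + 1, hlast⟩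
  have hij : i < j := by simp [j, Fin.lt_def]
  have haj : a j = a i + 1 := hi j rfl
  set g : ℝ := x j - x i with hg
  have hgpos : 0 < g := sub_pos.2 (hx hij)
  have hmem : ∀ s : ℝ, 0 < s → (x + Pi.single i s ∈ weylChamber d ↔ s < g) := by
    intro s hs
    constructor
    · intro h
      have h1 := h hij
      simp only [Pi.add_apply, Pi.single_apply, hij.ne', if_false, if_true] at h1
      linarith
    · intro h
      refine strictMono_of_lt_succ fun b c hbc => ?_
      have hlt : b < c := by rw [Fin.lt_def]; omega
      have h1 := hx hlt
      simp only [Pi.add_apply, Pi.single_apply]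
      by_cases hb : b = i
      · subst hb
        have hc : c = j := Fin.ext hbc.symm
        subst hc
        rw [if_pos rfl, if_neg hlt.ne']
        linarith
      · rw [if_neg hb]
        have h3 : 0 ≤ if c = i then s else 0 := by split_ifs <;> simp [hs.le]
        linarith
  have hψ := hF.integrable_gammaAvg a i x
  have h1 : ∫ s, (weylChamber d).indicator (gammaAvg lam a F) (x + Pi.single i s)
      ∂(expMeasure lam) = ∫ s in Set.Iio g, gammaAvg lam a F (x + Pi.single i s)
        ∂(expMeasure lam) := by
    rw [← integral_indicator measurableSet_Iio]
    refine integral_congr_ae ?_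
    filter_upwards [ae_expMeasure_pos lam] with s hs
    by_cases h : s < g
    · rw [Set.indicator_of_mem ((hmem s hs).2 h), Set.indicator_of_mem (Set.mem_Iio.2 h)]
    · rw [Set.indicator_of_notMem (fun h' => h ((hmem s hs).1 h')),
        Set.indicator_of_notMem (fun h' => h (Set.mem_Iio.1 h'))]
  -- the blocked part is the average of `F` from a point with two equal coordinates
  have h2 : ∫ s in Set.Ici g, gammaAvg lam a F (x + Pi.single i s) ∂(expMeasure lam) = 0 := by
    have hmap : Measurable fun s : ℝ => g + s := measurable_const.add measurable_id
    have hmeas : Measurable fun s : ℝ => gammaAvg lam a F (x + Pi.single i s) :=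
      (measurable_gammaAvg a hF.measurable).comp
        ((measurable_add_single i).comp ((measurable_const (a := x)).prodMk measurable_id))
    rw [expMeasure_restrict_Ici hgpos.le, integral_smul_measure, integral_map hmap.aemeasurable
      hmeas.aestronglyMeasurable]
    have h3 : ∫ s, gammaAvg lam a F (x + Pi.single i (g + s)) ∂(expMeasure lam) =
        gammaAvg lam (Function.update a i (a i + 1)) F (x + Pi.single i g) := by
      rw [hF.gammaAvg_update a i]
      refine integral_congr_ae (Filter.Eventually.of_forall fun s => ?_)
      simp only [Pi.single_add, add_assoc]
    have h4 := IsAntisymm.gammaAvg_comp_swap (lam := lam) hF.measurable hanti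
      (Function.update a i (a i + 1)) hij.ne (by simp [hij.ne', haj]) (x + Pi.single i g)
    have h5 : (x + Pi.single i g) ∘ Equiv.swap i j = x + Pi.single i g := by
      funext k
      simp only [Function.comp_apply, Pi.add_apply, Pi.single_apply]
      by_cases hk : k = i
      · subst hk; simp [hij.ne', hg]
      · by_cases hk' : k = j
        · subst hk'; simp [hij.ne', hg]
        · rw [Equiv.swap_apply_of_ne_of_ne hk hk']
    rw [h5] at h4
    rw [h3, show gammaAvg lam (Function.update a i (a i + 1)) F (x + Pi.single i g) = 0 by linarith,
      smul_zero]
  rw [h1, ← integral_add_compl (measurableSet_Iio (a := g)) hψ, Set.compl_Iio, h2, add_zero]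

/-- The average over Gamma variables, as a function with values in `[0, ∞]`. -/
noncomputable def avgFun (lam : ℝ) [Fact (0 < lam)] (a : Fin d → ℕ) {F : (Fin d → ℝ) → ℝ}
    (hF : Measurable F) : MFun d :=
  ⟨fun x => ENNReal.ofReal (gammaAvg lam a F x), (measurable_gammaAvg a hF).ennreal_ofReal⟩

/-- On averages of antisymmetric functions with shapes `a`, the word `w` acts in the chamber as
the free jumps that lead to the shapes `b`. -/
def ActsFreely (lam : ℝ) [Fact (0 < lam)] (w : Op d) (a b : Fin d → ℕ) : Prop :=
  ∀ (F : (Fin d → ℝ) → ℝ) (hF : IsGood lam F), IsAntisymm F →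
    (∀ x ∈ weylChamber d, 0 ≤ gammaAvg lam a F x) → ∀ x ∈ weylChamber d,
      0 ≤ gammaAvg lam b F x ∧
      (w (avgFun lam a hF.measurable)).1 x = ENNReal.ofReal (gammaAvg lam b F x)

variable [Fact (0 < lam)]

lemma actsFreely_one (a : Fin d → ℕ) : ActsFreely lam (1 : Op d) a a :=
  fun _ _ _ hpos x hx => ⟨hpos x hx, rfl⟩

lemma ActsFreely.congr {w : Op d} {a b c : Fin d → ℕ} (h : ActsFreely lam w a b)
    (hbc : ∀ i, b i = c i) : ActsFreely lam w a c := by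
  obtain rfl : b = c := funext hbc
  exact h

lemma ActsFreely.mul {w w' : Op d} {a b c : Fin d → ℕ} (hw' : IsSubMarkov w')
    (h : ActsFreely lam w a b) (h' : ActsFreely lam w' b c) : ActsFreely lam (w' * w) a c := by
  intro F hF hanti hpos x hx
  have h1 := h F hF hanti hpos
  have h2 := h' F hF hanti (fun y hy => (h1 y hy).1) x hx
  refine ⟨h2.1, ?_⟩
  rw [← h2.2]
  exact hw'.congr (fun y hy => (h1 y hy).2) hx

lemma actsFreely_jumpOp (a : Fin d → ℕ) (i : Fin d)
    (hi : ∀ j : Fin d, (i : ℕ) + 1 = j → a j = a i + 1) :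
    ActsFreely lam (jumpOp lam i : Op d) a (Function.update a i (a i + 1)) := by
  intro F hF hanti hpos x hx
  have h := integral_indicator_gammaAvg hF hanti a i hi hx
  have hnn : ∀ s : ℝ, 0 ≤ (weylChamber d).indicator (gammaAvg lam a F) (x + Pi.single i s) :=
    fun s => Set.indicator_nonneg hpos _
  have hmeas : Measurable fun s : ℝ =>
      (weylChamber d).indicator (gammaAvg lam a F) (x + Pi.single i s) :=
    ((measurable_gammaAvg a hF.measurable).indicator measurableSet_weylChamber).comp
      ((measurable_add_single i).comp ((measurable_const (a := x)).prodMk measurable_id))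
  refine ⟨h ▸ integral_nonneg hnn, ?_⟩
  have hint : Integrable (fun s : ℝ =>
      (weylChamber d).indicator (gammaAvg lam a F) (x + Pi.single i s)) (expMeasure lam) := by
    refine (hF.integrable_gammaAvg a i x).mono hmeas.aestronglyMeasurable
      (Filter.Eventually.of_forall fun s => ?_)
    exact norm_indicator_le_norm_self _ _
  rw [jumpOp_apply, jumpFun, Set.indicator_of_mem hx, ← h,
    ofReal_integral_eq_lintegral_ofReal hint (Filter.Eventually.of_forall hnn)]
  refine lintegral_congr fun s => ?_
  by_cases hs : x + Pi.single i s ∈ weylChamber d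
  · rw [Set.indicator_of_mem hs, Set.indicator_of_mem hs]; rfl
  · rw [Set.indicator_of_notMem hs, Set.indicator_of_notMem hs, ENNReal.ofReal_zero]

lemma isSubMarkov_jump (i : ℕ) : IsSubMarkov (jumpOp lam i : Op d) :=
  isSubMarkov_jumpOp Fact.out i

lemma actsFreely_ascTop (a : Fin d → ℕ) (l : ℕ) (hl : l ≤ d)
    (ha : ∀ i j : Fin d, d - l ≤ i → d - l ≤ j → a i = a j) :
    ActsFreely lam (ascTop (jumpOp lam) d l : Op d) a
      (fun i => if d - l ≤ i then a i + 1 else a i) := by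
  induction l with
  | zero =>
    have : (fun i : Fin d => if d - 0 ≤ i then a i + 1 else a i) = a := by
      funext i
      rw [if_neg (by have := i.2; omega)]
    rw [this]
    exact actsFreely_one a
  | succ l ih =>
    have h1 := ih (by omega) fun i j hi hj => ha i j (by omega) (by omega)
    let i : Fin d := ⟨d - 1 - l, by omega⟩
    have h2 := actsFreely_jumpOp (lam := lam) (fun i : Fin d => if d - l ≤ i then a i + 1 else a i) i
      (by
        intro j hj
        have hiv : (i : ℕ) = d - 1 - l := rfl
        rw [if_pos (by omega), if_neg (by omega), ha j i (by omega) (by omega)])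
    have h3 := ActsFreely.mul (isSubMarkov_jump _) h1 h2
    refine h3.congr fun j => ?_
    by_cases hj : j = i
    · subst hj
      have hiv : (i : ℕ) = d - 1 - l := rfl
      rw [Function.update_self, if_neg (by omega), if_pos (by omega)]
    · rw [Function.update_of_ne hj]
      have hne : (j : ℕ) ≠ d - 1 - l := fun h => hj (Fin.ext h)
      have : d - (l + 1) ≤ (j : ℕ) ↔ d - l ≤ (j : ℕ) := by omega
      simp only [this]

lemma actsFreely_triTop (a : Fin d → ℕ) (l : ℕ) (hl : l ≤ d)
    (ha : ∀ i j : Fin d, d - l ≤ i → d - l ≤ j → a i = a j) :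
    ActsFreely lam (triTop (jumpOp lam) d l : Op d) a
      (fun i => a i + (i + l + 1 - d)) := by
  induction l generalizing a with
  | zero =>
    have : (fun i : Fin d => a i + (i + 0 + 1 - d)) = a := by
      funext i
      have := i.2
      omega
    rw [this]
    exact actsFreely_one a
  | succ l ih =>
    have h1 := actsFreely_ascTop (lam := lam) a (l + 1) hl ha
    have h2 := ih (fun i => if d - (l + 1) ≤ i then a i + 1 else a i) (by omega)
      (by
        intro i j hi hj
        rw [if_pos (by omega), if_pos (by omega), ha i j (by omega) (by omega)])
    have h3 := ActsFreely.mul (isSubMarkov_triTop (isSubMarkov_jump (lam := lam)) l) h1 h2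
    refine h3.congr fun i => ?_
    split_ifs <;> omega

/-- The triangular prefix turns `F` into its average over `η` with shapes `0, 1, …, d - 1`. -/
lemma actsFreely_triTop_pred (hd : 1 ≤ d) :
    ActsFreely lam (triTop (jumpOp lam) d (d - 1) : Op d) (fun _ => 0) (fun i => (i : ℕ)) := by
  have h := actsFreely_triTop (lam := lam) (fun _ : Fin d => 0) (d - 1) (by omega)
    (fun _ _ _ _ => rfl)
  refine h.congr fun i => ?_
  omega

lemma actsFreely_ascWord_pow (m : ℕ) :
    ActsFreely lam (ascWord (jumpOp lam) d ^ m : Op d) (fun _ => 0) (fun _ => m) := by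
  induction m with
  | zero => exact actsFreely_one _
  | succ m ih =>
    have h := actsFreely_ascTop (lam := lam) (fun _ : Fin d => m) d le_rfl (fun _ _ _ _ => rfl)
    rw [ascTop_self] at h
    have h3 := ActsFreely.mul (isSubMarkov_ascWord (isSubMarkov_jump (lam := lam)) d) ih h
    rw [← pow_succ'] at h3
    refine h3.congr fun i => ?_
    simp

end Reflection

/-! ### Determinantal transition densities -/

section Kernel

variable {d : ℕ} {lam : ℝ}

lemma gammaPi_const_succ (hl : 0 < lam) (m : ℕ) :
    gammaPi lam (fun _ : Fin d => m + 1) =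
      volume.withDensity fun y => ENNReal.ofReal (∏ i, gammaDens lam m (y i)) := by
  have : Fact (0 < lam) := ⟨hl⟩
  refine Measure.pi_eq fun s hs => ?_
  have hint : ∀ i, Integrable (gammaDens lam m) ((volume : Measure ℝ).restrict (s i)) :=
    fun i => (integrable_gammaDens hl m).restrict
  rw [withDensity_apply _ (MeasurableSet.univ_pi hs), volume_pi, Measure.restrict_pi_pi,
    ← ofReal_integral_eq_lintegral_ofReal (Integrable.fintype_prod hint)
      (Filter.Eventually.of_forall fun y => Finset.prod_nonneg fun i _ => gammaDens_nonneg hl m _),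
    integral_fintype_prod_eq_prod, ENNReal.ofReal_prod_of_nonneg
      (fun i _ => integral_nonneg fun u => gammaDens_nonneg hl m u)]
  refine Finset.prod_congr rfl fun i _ => ?_
  rw [gammaLaw_succ, withDensity_apply _ (hs i), ofReal_integral_eq_lintegral_ofReal (hint i)
    (Filter.Eventually.of_forall (gammaDens_nonneg hl m))]

lemma measurable_prod_gammaDens (lam : ℝ) (m : ℕ) :
    Measurable fun y : Fin d → ℝ => ∏ i, gammaDens lam m (y i) :=
  Finset.measurable_prod _ fun i _ => (measurable_gammaDens lam m).comp (measurable_pi_apply i)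

lemma gammaAvg_const_succ (hl : 0 < lam) (m : ℕ) (F : (Fin d → ℝ) → ℝ) (x : Fin d → ℝ) :
    gammaAvg lam (fun _ => m + 1) F x = ∫ z, F z * ∏ i, gammaDens lam m (z i - x i) := by
  rw [gammaAvg, gammaPi_const_succ hl, integral_withDensity_eq_integral_toReal_smul
    (measurable_prod_gammaDens lam m).ennreal_ofReal (by simp)]
  rw [← integral_sub_right_eq_self _ x]
  refine integral_congr_ae (Filter.Eventually.of_forall fun y => ?_)
  simp only [Pi.sub_apply, add_sub_cancel]
  rw [ENNReal.toReal_ofReal (Finset.prod_nonneg fun i _ => gammaDens_nonneg hl m _), smul_eq_mul,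
    mul_comm]

/-- The determinant `det (f (z j - x i))`, with `f` the Gamma density of shape `m + 1`. -/
noncomputable def kernDet (lam : ℝ) (m : ℕ) (x z : Fin d → ℝ) : ℝ :=
  (Matrix.of fun i j => gammaDens lam m (z j - x i)).det

lemma kernDet_eq_sum (m : ℕ) (x z : Fin d → ℝ) :
    kernDet lam m x z = ∑ σ : Equiv.Perm (Fin d),
      (Equiv.Perm.sign σ : ℝ) * ∏ i, gammaDens lam m (z i - x (σ i)) := by
  rw [kernDet, Matrix.det_apply']
  rfl

lemma integrable_prod_gammaDens_sub (hl : 0 < lam) (m : ℕ) (x : Fin d → ℝ) :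
    Integrable fun z : Fin d → ℝ => ∏ i, gammaDens lam m (z i - x i) :=
  Integrable.fintype_prod fun i => (integrable_gammaDens hl m).comp_sub_right (x i)

lemma integrable_kernDet (hl : 0 < lam) (m : ℕ) (x : Fin d → ℝ) :
    Integrable (kernDet lam m x) := by
  have : kernDet lam m x = fun z => ∑ σ : Equiv.Perm (Fin d),
      (Equiv.Perm.sign σ : ℝ) * ∏ i, gammaDens lam m (z i - x (σ i)) :=
    funext fun z => kernDet_eq_sum m x z
  rw [this]
  refine integrable_finsetSum _ fun σ _ => Integrable.const_mul ?_ _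
  exact integrable_prod_gammaDens_sub hl m (x ∘ σ)

lemma measurable_kernDet (m : ℕ) :
    Measurable fun p : (Fin d → ℝ) × (Fin d → ℝ) => kernDet lam m p.1 p.2 := by
  simp_rw [kernDet_eq_sum]
  refine Finset.measurable_sum _ fun σ _ => Measurable.const_mul ?_ _
  refine Finset.measurable_prod _ fun i _ => (measurable_gammaDens lam m).comp ?_
  exact ((measurable_pi_apply i).comp measurable_snd).sub
    ((measurable_pi_apply (σ i)).comp measurable_fst)

lemma continuous_gammaDens {m : ℕ} (hm : 1 ≤ m) : Continuous (gammaDens lam m) := by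
  unfold gammaDens
  refine Continuous.if_le (by fun_prop) continuous_const continuous_const continuous_id ?_
  intro u hu
  rw [← hu, zero_pow (by omega)]
  simp

lemma continuous_kernDet {m : ℕ} (hm : 1 ≤ m) :
    Continuous fun p : (Fin d → ℝ) × (Fin d → ℝ) => kernDet lam m p.1 p.2 := by
  simp_rw [kernDet_eq_sum]
  refine continuous_finsetSum _ fun σ _ => Continuous.const_mul ?_ _
  refine continuous_finsetProd _ fun i _ => (continuous_gammaDens hm).comp ?_
  fun_prop

/-- The signed sum of `G` over all permutations of the coordinates. -/
noncomputable def antisymmetrize (G : (Fin d → ℝ) → ℝ) (z : Fin d → ℝ) : ℝ :=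
  ∑ σ : Equiv.Perm (Fin d), (Equiv.Perm.sign σ : ℝ) * G (z ∘ σ)

lemma isAntisymm_antisymmetrize (G : (Fin d → ℝ) → ℝ) : IsAntisymm (antisymmetrize G) := by
  intro i j hij z
  unfold antisymmetrize
  rw [← Equiv.sum_comp (Equiv.mulLeft (Equiv.swap i j)), ← Finset.sum_neg_distrib]
  refine Finset.sum_congr rfl fun σ _ => ?_
  have h : (z ∘ Equiv.swap i j) ∘ (Equiv.swap i j * σ : Equiv.Perm (Fin d)) = z ∘ σ := by
    funext k
    simp
  simp only [Equiv.coe_mulLeft]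
  rw [h, Equiv.Perm.sign_mul, Equiv.Perm.sign_swap hij]
  simp

lemma antisymmetrize_of_mem {G : (Fin d → ℝ) → ℝ} (hG : ∀ z ∉ weylChamber d, G z = 0)
    {z : Fin d → ℝ} (hz : z ∈ weylChamber d) : antisymmetrize G z = G z := by
  unfold antisymmetrize
  rw [Finset.sum_eq_single 1]
  · simp
  · intro σ _ hσ
    rw [hG _ fun h => hσ ?_, mul_zero]
    -- an increasing bijection of a finite chain is the identity
    have hmono : StrictMono σ := fun a b hab => hz.lt_iff_lt.1 (h hab)
    ext a
    have h1 := congrFun (congrArg (fun f : Fin d ≃o Fin d => (f : Fin d → Fin d))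
      (Subsingleton.elim (StrictMono.orderIsoOfSurjective σ hmono σ.surjective)
        (OrderIso.refl _))) a
    have h2 : σ a = a := h1
    rw [h2]; rfl
  · simp

lemma measurable_comp_perm (σ : Equiv.Perm (Fin d)) :
    Measurable fun z : Fin d → ℝ => z ∘ σ := (measurePreserving_comp_perm σ).measurable

lemma measurable_antisymmetrize {G : (Fin d → ℝ) → ℝ} (hG : Measurable G) :
    Measurable (antisymmetrize G) :=
  Finset.measurable_sum _ fun σ _ => (hG.comp (measurable_comp_perm σ)).const_mul _

lemma gammaAvg_antisymmetrize (hl : 0 < lam) (m : ℕ) {G : (Fin d → ℝ) → ℝ} (hG : Measurable G)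
    {C : ℝ} (hC : ∀ z, |G z| ≤ C) (x : Fin d → ℝ) :
    gammaAvg lam (fun _ => m + 1) (antisymmetrize G) x = ∫ z, G z * kernDet lam m x z := by
  have hint : ∀ (σ : Equiv.Perm (Fin d)), Integrable fun z : Fin d → ℝ =>
      G z * ∏ i, gammaDens lam m (z i - x (σ i)) := fun σ =>
    (integrable_prod_gammaDens_sub hl m (x ∘ σ)).bdd_mul hG.aestronglyMeasurable
      (Filter.Eventually.of_forall hC)
  have hcomp : ∀ (σ : Equiv.Perm (Fin d)) z,
      G z * ∏ i, gammaDens lam m (z i - x (σ i)) =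
        (fun w : Fin d → ℝ => G (w ∘ σ) * ∏ i, gammaDens lam m (w i - x i)) (z ∘ (σ⁻¹ : Equiv.Perm (Fin d))) := by
    intro σ z
    simp only
    congr 1
    · congr 1; funext k; simp
    · rw [← Equiv.prod_comp σ fun k => gammaDens lam m ((z ∘ (σ⁻¹ : Equiv.Perm (Fin d))) k - x k)]
      simp
  have hmp : ∀ (σ : Equiv.Perm (Fin d)) (f : (Fin d → ℝ) → ℝ),
      ∫ z, f (z ∘ (σ⁻¹ : Equiv.Perm (Fin d))) = ∫ z, f z := by
    intro σ f
    have h := measurePreserving_comp_perm (d := d) σ⁻¹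
    have he : MeasurableEmbedding fun z : Fin d → ℝ => z ∘ (σ⁻¹ : Equiv.Perm (Fin d)) :=
      MeasurableEmbedding.of_measurable_inverse h.measurable
        (by
          have : Set.range (fun z : Fin d → ℝ => z ∘ (σ⁻¹ : Equiv.Perm (Fin d))) = Set.univ := by
            refine Set.range_eq_univ.2 fun w => ⟨w ∘ σ, ?_⟩
            funext k; simp
          rw [this]; exact MeasurableSet.univ)
        (measurable_comp_perm σ) (fun z => by funext k; simp)
    exact h.integral_comp he f
  have hint' : ∀ σ : Equiv.Perm (Fin d), Integrable fun w : Fin d → ℝ =>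
      G (w ∘ σ) * ∏ i, gammaDens lam m (w i - x i) := fun σ =>
    (integrable_prod_gammaDens_sub hl m x).bdd_mul
      (hG.comp (measurable_comp_perm σ)).aestronglyMeasurable
      (Filter.Eventually.of_forall fun z => hC _)
  rw [gammaAvg_const_succ hl]
  calc ∫ z, antisymmetrize G z * ∏ i, gammaDens lam m (z i - x i)
      = ∫ z, ∑ σ : Equiv.Perm (Fin d), (Equiv.Perm.sign σ : ℝ) *
          (G (z ∘ σ) * ∏ i, gammaDens lam m (z i - x i)) := by
        refine integral_congr_ae (Filter.Eventually.of_forall fun z => ?_)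
        simp only [antisymmetrize, Finset.sum_mul, mul_assoc]
    _ = ∑ σ : Equiv.Perm (Fin d), (Equiv.Perm.sign σ : ℝ) *
          ∫ z, G (z ∘ σ) * ∏ i, gammaDens lam m (z i - x i) := by
        rw [integral_finsetSum _ fun σ _ => (hint' σ).const_mul _]
        simp_rw [integral_const_mul]
    _ = ∑ σ : Equiv.Perm (Fin d), (Equiv.Perm.sign σ : ℝ) *
          ∫ z, G z * ∏ i, gammaDens lam m (z i - x (σ i)) := by
        refine Finset.sum_congr rfl fun σ _ => ?_
        rw [← hmp σ]
        simp_rw [hcomp]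
    _ = ∫ z, G z * kernDet lam m x z := by
        simp_rw [← integral_const_mul]
        rw [← integral_finsetSum _ fun σ _ => (hint σ).const_mul _]
        refine integral_congr_ae (Filter.Eventually.of_forall fun z => ?_)
        simp only [kernDet_eq_sum, Finset.mul_sum]
        exact Finset.sum_congr rfl fun σ _ => by ring

/-- A continuous inequality that holds almost everywhere in the chamber holds in the chamber. -/
lemma le_of_ae_le_weylChamber {f g : (Fin d → ℝ) → ℝ}
    (h : f ≤ᵐ[volume.restrict (weylChamber d)] g) (hf : ContinuousOn f (weylChamber d))
    (hg : ContinuousOn g (weylChamber d)) {z : Fin d → ℝ} (hz : z ∈ weylChamber d) :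
    f z ≤ g z := by
  have h1 : (fun z => min (f z) (g z)) =ᵐ[volume.restrict (weylChamber d)] f := by
    filter_upwards [h] with z hz
    exact min_eq_left hz
  have h2 := Measure.eqOn_open_of_ae_eq h1 isOpen_weylChamber (hf.inf hg) hf hz
  exact min_eq_left_iff.1 h2

section Positivity

variable [hl : Fact (0 < lam)]

lemma ascWord_pow_succ_bounded (m : ℕ) {G : (Fin d → ℝ) → ℝ} (hG : Measurable G)
    {C : ℝ} (hC : ∀ z, |G z| ≤ C) (hG0 : ∀ z, 0 ≤ G z) (hGW : ∀ z ∉ weylChamber d, G z = 0)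
    {x : Fin d → ℝ} (hx : x ∈ weylChamber d) :
    0 ≤ ∫ z, G z * kernDet lam m x z ∧
      ((ascWord (jumpOp lam) d ^ (m + 1) : Op d)
        ⟨fun z => ENNReal.ofReal (G z), hG.ennreal_ofReal⟩).1 x =
      ENNReal.ofReal (∫ z, G z * kernDet lam m x z) := by
  have hFm := measurable_antisymmetrize hG
  have hF : IsGood lam (antisymmetrize G) := by
    refine IsGood.of_bounded hFm (C := ∑ _σ : Equiv.Perm (Fin d), C) fun z => ?_
    refine (Finset.abs_sum_le_sum_abs _ _).trans (Finset.sum_le_sum fun σ _ => ?_)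
    rw [abs_mul]
    have : |((Equiv.Perm.sign σ : ℤ) : ℝ)| = 1 := by
      rcases Int.units_eq_one_or (Equiv.Perm.sign σ) with h | h <;> simp [h]
    rw [this, one_mul]
    exact hC _
  have h := actsFreely_ascWord_pow (lam := lam) (m + 1) _ hF (isAntisymm_antisymmetrize G)
    (fun y hy => by rw [gammaAvg_zero hFm, antisymmetrize_of_mem hGW hy]; exact hG0 y) x hx
  rw [gammaAvg_antisymmetrize hl.out m hG hC] at h
  refine ⟨h.1, ?_⟩
  rw [← h.2]
  refine ((isSubMarkov_ascWord (isSubMarkov_jump (lam := lam)) d).pow (m + 1)).congr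
    (fun y hy => ?_) hx
  change ENNReal.ofReal _ = ENNReal.ofReal _
  rw [gammaAvg_zero hFm, antisymmetrize_of_mem hGW hy]

/-- The determinants are nonnegative in the chamber, being densities of the killed walk. -/
lemma kernDet_nonneg {m : ℕ} (hm : 1 ≤ m) {x z : Fin d → ℝ} (hx : x ∈ weylChamber d)
    (hz : z ∈ weylChamber d) : 0 ≤ kernDet lam m x z := by
  have h : 0 ≤ᵐ[volume.restrict (weylChamber d)] kernDet lam m x := by
    refine ae_nonneg_of_forall_setIntegral_nonneg (integrable_kernDet hl.out m x).restrict
      fun s hs _ => ?_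
    rw [Measure.restrict_restrict hs, ← integral_indicator (hs.inter measurableSet_weylChamber)]
    have h1 := (ascWord_pow_succ_bounded (lam := lam) (d := d) m
      (G := (s ∩ weylChamber d).indicator 1)
      (measurable_one.indicator (hs.inter measurableSet_weylChamber)) (C := 1)
      (fun z => by
        by_cases h : z ∈ s ∩ weylChamber d
        · simp [Set.indicator_of_mem h]
        · simp [Set.indicator_of_notMem h])
      (fun z => Set.indicator_nonneg (fun _ _ => zero_le_one) _)
      (fun z hz => Set.indicator_of_notMem (fun h => hz h.2) _) hx).1
    refine h1.trans_eq (integral_congr_ae (Filter.Eventually.of_forall fun z => ?_))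
    by_cases h : z ∈ s ∩ weylChamber d
    · simp [Set.indicator_of_mem h]
    · simp [Set.indicator_of_notMem h]
  refine le_of_ae_le_weylChamber h continuousOn_const ?_ hz
  exact ((continuous_kernDet hm).comp (Continuous.prodMk_right x)).continuousOn

/-- The transition density of the interlaced walk at time `m + 1`. -/
lemma ascWord_pow_succ_apply {m : ℕ} (hm : 1 ≤ m) (φ : MFun d) (hφ : ∀ z, φ.1 z ≤ 1)
    {x : Fin d → ℝ} (hx : x ∈ weylChamber d) :
    ((ascWord (jumpOp lam) d ^ (m + 1) : Op d) φ).1 x =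
      ∫⁻ z in weylChamber d, φ.1 z * ENNReal.ofReal (kernDet lam m x z) := by
  have hfin : ∀ z, φ.1 z ≠ ∞ := fun z => ((hφ z).trans_lt ENNReal.one_lt_top).ne
  set G : (Fin d → ℝ) → ℝ := (weylChamber d).indicator fun z => (φ.1 z).toReal with hGdef
  have hG : Measurable G := φ.2.ennreal_toReal.indicator measurableSet_weylChamber
  have hG0 : ∀ z, 0 ≤ G z := fun z => Set.indicator_nonneg (fun _ _ => ENNReal.toReal_nonneg) _
  have hGW : ∀ z ∉ weylChamber d, G z = 0 := fun z hz => Set.indicator_of_notMem hz _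
  have hC : ∀ z, |G z| ≤ 1 := by
    intro z
    rw [abs_of_nonneg (hG0 z)]
    refine Set.indicator_le' (fun z _ => ?_) (fun _ _ => zero_le_one) z
    exact ENNReal.toReal_le_of_le_ofReal zero_le_one (by simpa using hφ z)
  have h := (ascWord_pow_succ_bounded (lam := lam) m hG hC hG0 hGW hx).2
  have h1 : ((ascWord (jumpOp lam) d ^ (m + 1) : Op d) φ).1 x =
      ((ascWord (jumpOp lam) d ^ (m + 1) : Op d)
        ⟨fun z => ENNReal.ofReal (G z), hG.ennreal_ofReal⟩).1 x := by
    refine ((isSubMarkov_ascWord (isSubMarkov_jump (lam := lam)) d).pow (m + 1)).congr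
      (fun y hy => ?_) hx
    change φ.1 y = ENNReal.ofReal (G y)
    rw [hGdef, Set.indicator_of_mem hy, ENNReal.ofReal_toReal (hfin y)]
  rw [h1, h, ofReal_integral_eq_lintegral_ofReal]
  · rw [← lintegral_indicator measurableSet_weylChamber]
    refine lintegral_congr fun z => ?_
    by_cases hz : z ∈ weylChamber d
    · rw [Set.indicator_of_mem hz, ENNReal.ofReal_mul (hG0 z), hGdef, Set.indicator_of_mem hz,
        ENNReal.ofReal_toReal (hfin z)]
    · rw [Set.indicator_of_notMem hz, hGW z hz, zero_mul, ENNReal.ofReal_zero]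
  · exact (integrable_kernDet hl.out m x).bdd_mul hG.aestronglyMeasurable
      (Filter.Eventually.of_forall hC)
  · refine Filter.Eventually.of_forall fun z => ?_
    by_cases hz : z ∈ weylChamber d
    · exact mul_nonneg (hG0 z) (kernDet_nonneg hm hx hz)
    · simp [hGW z hz]

end Positivity

end Kernel

/-! ### The function `h` and the transition densities of the walk killed at `τ` -/

section Harm

variable {d : ℕ} {lam : ℝ}

lemma vandermonde_eq_det (x : Fin d → ℝ) : vandermonde x = (Matrix.vandermonde x).det :=
  (Matrix.det_vandermonde x).symm

lemma isAntisymm_vandermonde : IsAntisymm (vandermonde : (Fin d → ℝ) → ℝ) := by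
  intro i j hij x
  rw [vandermonde_eq_det, vandermonde_eq_det]
  have h := Matrix.det_permute (Equiv.swap i j) (Matrix.vandermonde x)
  rw [Equiv.Perm.sign_swap hij] at h
  have h2 : Matrix.vandermonde (x ∘ Equiv.swap i j) =
      (Matrix.vandermonde x).submatrix (Equiv.swap i j) id := by
    ext a b
    simp [Matrix.vandermonde_apply]
  rw [h2, h]
  simp

lemma isGood_vandermonde [Fact (0 < lam)] : IsGood lam (vandermonde : (Fin d → ℝ) → ℝ) := by
  refine ⟨continuous_vandermonde.measurable, fun a x => ?_⟩
  have h : (fun y => vandermonde (x + y)) = fun y => ∑ σ : Equiv.Perm (Fin d),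
      (Equiv.Perm.sign σ : ℝ) * ∏ k, (x k + y k) ^ ((σ⁻¹ : Equiv.Perm (Fin d)) k : ℕ) := by
    funext y
    rw [vandermonde_eq_det, Matrix.det_apply']
    refine Finset.sum_congr rfl fun σ _ => ?_
    congr 1
    rw [← Equiv.prod_comp σ fun k => (x k + y k) ^ ((σ⁻¹ : Equiv.Perm (Fin d)) k : ℕ)]
    simp [Matrix.vandermonde_apply]
  rw [h]
  refine integrable_finsetSum _ fun σ _ => Integrable.const_mul ?_ _
  exact Integrable.fintype_prod
    (f := fun k t => (x k + t) ^ ((σ⁻¹ : Equiv.Perm (Fin d)) k : ℕ))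
    fun k => integrable_add_pow_gammaLaw _ _ _

lemma vandermonde_refl (z : Fin d → ℝ) : vandermonde (refl z) = vandermonde z := by
  conv_rhs => rw [vandermonde_eq_prod_vandFactor]
  unfold vandermonde
  rw [← Equiv.prod_comp Fin.revPerm]
  refine Finset.prod_congr rfl fun i _ => ?_
  unfold vandFactor
  refine Finset.prod_nbij' Fin.rev Fin.rev ?_ ?_ ?_ ?_ ?_
  · intro j hj
    simpa [Fin.rev_lt_iff] using hj
  · intro j hj
    simpa using hj
  · intro j _; simp
  · intro j _; simp
  · intro j _; simp only [refl, Fin.revPerm_apply, Fin.rev_rev]; ring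

variable [hl : Fact (0 < lam)]

variable {F F' : (Fin d → ℝ) → ℝ} {x : Fin d → ℝ}

lemma triTop_pred_apply (hd : 1 ≤ d) (hF : IsGood lam F) (hanti : IsAntisymm F)
    (hpos : ∀ y ∈ weylChamber d, 0 ≤ F y) (hx : x ∈ weylChamber d) :
    0 ≤ gammaAvg lam (fun i : Fin d => (i : ℕ)) F x ∧
    (triTop (jumpOp lam) d (d - 1) ⟨fun y => ENNReal.ofReal (F y), hF.measurable.ennreal_ofReal⟩ :
      MFun d).1 x = ENNReal.ofReal (gammaAvg lam (fun i : Fin d => (i : ℕ)) F x) := by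
  have h := actsFreely_triTop_pred (lam := lam) hd F hF hanti
    (fun y hy => by rw [gammaAvg_zero hF.measurable]; exact hpos y hy) x hx
  refine ⟨h.1, ?_⟩
  rw [← h.2]
  refine (isSubMarkov_triTop (isSubMarkov_jump (lam := lam)) (d - 1)).congr (fun y _ => ?_) hx
  change ENNReal.ofReal _ = ENNReal.ofReal _
  rw [gammaAvg_zero hF.measurable]

/-- Averages with shapes `0, …, d - 1` of antisymmetric functions are monotone with respect to
inequalities in the chamber only. -/
lemma gammaAvg_mono_of_antisymm (hd : 1 ≤ d) (hF : IsGood lam F) (hanti : IsAntisymm F)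
    (hF' : IsGood lam F') (hanti' : IsAntisymm F') (hpos : ∀ y ∈ weylChamber d, 0 ≤ F y)
    (hle : ∀ y ∈ weylChamber d, F y ≤ F' y) (hx : x ∈ weylChamber d) :
    gammaAvg lam (fun i : Fin d => (i : ℕ)) F x ≤
      gammaAvg lam (fun i : Fin d => (i : ℕ)) F' x := by
  have h := triTop_pred_apply hd hF hanti hpos hx
  have h' := triTop_pred_apply hd hF' hanti' (fun y hy => (hpos y hy).trans (hle y hy)) hx
  rw [← ENNReal.ofReal_le_ofReal_iff h'.1, ← h.2, ← h'.2]
  exact (isSubMarkov_triTop (isSubMarkov_jump (lam := lam)) (d - 1)).mono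
    (fun y hy => ENNReal.ofReal_le_ofReal (hle y hy)) hx

/-- The triangular prefix turns `Δ` into `h`: the law of `η` in the definition of `h` is by
definition the product of Gamma laws of shapes `0, …, d - 1`. -/
lemma triTop_pred_vandermonde (hd : 1 ≤ d) (hx : x ∈ weylChamber d) :
    (triTop (jumpOp lam) d (d - 1) ⟨fun y => ENNReal.ofReal (vandermonde y),
      continuous_vandermonde.measurable.ennreal_ofReal⟩ : MFun d).1 x =
      ENNReal.ofReal (harm lam x) :=
  (triTop_pred_apply hd isGood_vandermonde isAntisymm_vandermonde
    (fun _ hy => (vandermonde_pos hy).le) hx).2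

lemma harm_nonneg (hd : 1 ≤ d) (hx : x ∈ weylChamber d) : 0 ≤ harm lam x :=
  (triTop_pred_apply hd isGood_vandermonde isAntisymm_vandermonde
    (fun _ hy => (vandermonde_pos hy).le) hx).1

end Harm

section TauDensity

variable {d : ℕ} {lam : ℝ}

lemma kernDet_antisymm_left (m : ℕ) (z : Fin d → ℝ) : IsAntisymm fun x => kernDet lam m x z := by
  intro i j hij x
  have h := Matrix.det_permute (Equiv.swap i j)
    (Matrix.of fun i j => gammaDens lam m (z j - x i))
  rw [Equiv.Perm.sign_swap hij] at h
  simp only [kernDet]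
  rw [show (Matrix.of fun a b => gammaDens lam m (z b - (x ∘ Equiv.swap i j) a)) =
    (Matrix.of fun i j => gammaDens lam m (z j - x i)).submatrix (Equiv.swap i j) id from rfl, h]
  simp

lemma kernDet_antisymm_right (m : ℕ) (x : Fin d → ℝ) : IsAntisymm (kernDet lam m x) := by
  intro i j hij z
  have h := Matrix.det_permute' (Equiv.swap i j)
    (Matrix.of fun i j => gammaDens lam m (z j - x i))
  rw [Equiv.Perm.sign_swap hij] at h
  simp only [kernDet]
  rw [show (Matrix.of fun a b => gammaDens lam m ((z ∘ Equiv.swap i j) b - x a)) =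
    (Matrix.of fun i j => gammaDens lam m (z j - x i)).submatrix id (Equiv.swap i j) from rfl, h]
  simp

lemma IsAntisymm.comp_refl {F : (Fin d → ℝ) → ℝ} (hF : IsAntisymm F) :
    IsAntisymm fun v => F (refl v) := by
  intro i j hij v
  have h : refl (v ∘ Equiv.swap i j) = refl v ∘ Equiv.swap i.rev j.rev := by
    funext k
    simp only [refl, Function.comp_apply]
    congr 2
    rcases eq_or_ne k i.rev with rfl | h1
    · simp
    rcases eq_or_ne k j.rev with rfl | h2
    · simp
    rw [Equiv.swap_apply_of_ne_of_ne h1 h2, Equiv.swap_apply_of_ne_of_ne]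
    · rintro h; exact h1 (by rw [← h, Fin.rev_rev])
    · rintro h; exact h2 (by rw [← h, Fin.rev_rev])
  simp only
  rw [h]
  exact hF _ _ (fun h => hij (Fin.rev_injective h)) _

lemma exists_gammaDens_le (hl : 0 < lam) (m : ℕ) : ∃ C : ℝ, 0 < C ∧ ∀ u, gammaDens lam m u ≤ C := by
  refine ⟨lam, hl, fun u => ?_⟩
  rcases lt_or_ge u 0 with hu | hu
  · rw [gammaDens_of_neg hu]; exact hl.le
  · rw [gammaDens_of_nonneg hu]
    have h1 : (lam * u) ^ m / m.factorial ≤ Real.exp (lam * u) :=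
      Real.pow_div_factorial_le_exp (lam * u) (by positivity) m
    calc lam ^ (m + 1) * u ^ m / m.factorial * Real.exp (-(lam * u))
        = lam * ((lam * u) ^ m / m.factorial * Real.exp (-(lam * u))) := by
          rw [mul_pow]; ring
      _ ≤ lam * (Real.exp (lam * u) * Real.exp (-(lam * u))) := by gcongr
      _ = lam := by rw [← Real.exp_add]; simp

lemma exists_abs_kernDet_le (d : ℕ) (hl : 0 < lam) (m : ℕ) :
    ∃ C : ℝ, ∀ x z : Fin d → ℝ, |kernDet lam m x z| ≤ C := by
  obtain ⟨c, hc, hle⟩ := exists_gammaDens_le hl m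
  refine ⟨_, fun x z => Matrix.det_le (abv := AbsoluteValue.abs) (x := c) fun i j => ?_⟩
  simp only [Matrix.of_apply, AbsoluteValue.abs_apply]
  rw [abs_of_nonneg (gammaDens_nonneg hl _ _)]
  exact hle _

variable (lam) in
/-- The function `v ↦ ∫ det f(refl v - (x + η))`: the determinant averaged over Gamma variables at
the starting point, as a function of the reflected end point. -/
noncomputable def halfAvg (m : ℕ) (x v : Fin d → ℝ) : ℝ :=
  gammaAvg lam (fun i : Fin d => (i : ℕ)) (fun y => kernDet lam m y (refl v)) x

variable (lam) in
/-- The transition density of the walk killed at `τ`: the determinant averaged over Gamma variables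
at the starting point and at the end point. -/
noncomputable def tauDens (m : ℕ) (x z : Fin d → ℝ) : ℝ :=
  gammaAvg lam (fun i : Fin d => (i : ℕ)) (halfAvg lam m x) (refl z)

variable [hl : Fact (0 < lam)] {m : ℕ} {x z : Fin d → ℝ}

lemma continuous_refl : Continuous (refl : (Fin d → ℝ) → _) := by
  unfold refl; fun_prop

lemma isGood_kernDet_left (m : ℕ) (z : Fin d → ℝ) : IsGood lam fun x => kernDet lam m x z := by
  obtain ⟨C, hC⟩ := exists_abs_kernDet_le d hl.out m
  exact IsGood.of_bounded ((measurable_kernDet m).comp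
    (measurable_id.prodMk measurable_const)) (C := C) fun x => hC x z

lemma exists_abs_halfAvg_le (m : ℕ) (x : Fin d → ℝ) : ∃ C : ℝ, ∀ v, |halfAvg lam m x v| ≤ C := by
  obtain ⟨C, hC⟩ := exists_abs_kernDet_le d hl.out m
  refine ⟨C, fun v => ?_⟩
  rw [halfAvg, gammaAvg, ← Real.norm_eq_abs]
  refine (norm_integral_le_of_norm_le_const (C := C)
    (Filter.Eventually.of_forall fun y => hC _ _)).trans_eq ?_
  simp

lemma continuous_halfAvg (hm : 1 ≤ m) (x : Fin d → ℝ) : Continuous (halfAvg lam m x) := by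
  obtain ⟨C, hC⟩ := exists_abs_kernDet_le d hl.out m
  unfold halfAvg gammaAvg
  refine continuous_of_dominated (bound := fun _ => C) (fun v => ?_)
    (fun v => Filter.Eventually.of_forall fun y => hC _ _) (integrable_const C)
    (Filter.Eventually.of_forall fun y => ?_)
  · exact (measurable_comp_add (isGood_kernDet_left (lam := lam) m (refl v)).measurable
      x).aestronglyMeasurable
  · exact (continuous_kernDet hm).comp (continuous_const.prodMk continuous_refl)

lemma continuous_tauDens (hm : 1 ≤ m) (x : Fin d → ℝ) : Continuous (tauDens lam m x) := by
  obtain ⟨C, hC⟩ := exists_abs_halfAvg_le (lam := lam) m x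
  have hc := continuous_halfAvg (lam := lam) hm x
  unfold tauDens gammaAvg
  refine continuous_of_dominated (bound := fun _ => C) (fun v => ?_)
    (fun v => Filter.Eventually.of_forall fun y => hC _) (integrable_const C)
    (Filter.Eventually.of_forall fun y => ?_)
  · exact (measurable_comp_add hc.measurable _).aestronglyMeasurable
  · exact hc.comp (continuous_refl.add continuous_const)

lemma isGood_halfAvg (hm : 1 ≤ m) (x : Fin d → ℝ) : IsGood lam (halfAvg lam m x) := by
  obtain ⟨C, hC⟩ := exists_abs_halfAvg_le (lam := lam) m x
  exact IsGood.of_bounded (continuous_halfAvg hm x).measurable hC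

omit hl in
lemma isAntisymm_halfAvg (m : ℕ) (x : Fin d → ℝ) : IsAntisymm (halfAvg lam m x) := by
  intro i j hij v
  simp only [halfAvg, gammaAvg]
  rw [← integral_neg]
  refine integral_congr_ae (Filter.Eventually.of_forall fun y => ?_)
  exact (kernDet_antisymm_right (lam := lam) m (x + y)).comp_refl i j hij v

variable (hd : 1 ≤ d) (hm : 1 ≤ m) (hx : x ∈ weylChamber d)
include hd hm hx

/-- Averaging over the starting point is the action of the triangular prefix. -/
lemma halfAvg_spec {v : Fin d → ℝ} (hv : v ∈ weylChamber d) :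
    0 ≤ halfAvg lam m x v ∧
    (triTop (jumpOp lam) d (d - 1) ⟨fun y => ENNReal.ofReal (kernDet lam m y (refl v)),
      (isGood_kernDet_left (lam := lam) m (refl v)).measurable.ennreal_ofReal⟩ : MFun d).1 x =
      ENNReal.ofReal (halfAvg lam m x v) :=
  triTop_pred_apply hd (isGood_kernDet_left m (refl v)) (kernDet_antisymm_left m _)
    (fun _ hy => kernDet_nonneg hm hy (refl_mem hv)) hx

lemma tauDens_nonneg (hz : z ∈ weylChamber d) : 0 ≤ tauDens lam m x z :=
  (triTop_pred_apply hd (isGood_halfAvg hm x) (isAntisymm_halfAvg m x)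
    (fun _ hv => (halfAvg_spec hd hm hx hv).1) (refl_mem hz)).1

/-- A product bound for the density of the interlaced walk yields one for the walk killed at `τ`. -/
lemma tauDens_le {c : ℝ} (hle : ∀ x ∈ weylChamber d, ∀ z ∈ weylChamber d,
    kernDet lam m x z ≤ c * vandermonde x * vandermonde z) (hz : z ∈ weylChamber d) :
    tauDens lam m x z ≤ c * harm lam x * harmHat lam z := by
  have hgood : ∀ b : ℝ, IsGood lam fun y : Fin d → ℝ => b * vandermonde y := fun b =>
    ⟨continuous_vandermonde.measurable.const_mul b,
      fun a x => (isGood_vandermonde.integrable a x).const_mul b⟩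
  have hanti : ∀ b : ℝ, IsAntisymm fun y : Fin d → ℝ => b * vandermonde y := fun b i j hij y => by
    simp only [isAntisymm_vandermonde i j hij y]; ring
  have havg : ∀ (b : ℝ) y, gammaAvg lam (fun i : Fin d => (i : ℕ))
      (fun y : Fin d → ℝ => b * vandermonde y) y = b * harm lam y := fun b y =>
    integral_const_mul _ _
  have h1 : ∀ v ∈ weylChamber d, halfAvg lam m x v ≤ (c * harm lam x) * vandermonde v := by
    intro v hv
    have h := gammaAvg_mono_of_antisymm hd (isGood_kernDet_left (lam := lam) m (refl v))
      (kernDet_antisymm_left m _) (hgood (c * vandermonde v)) (hanti (c * vandermonde v))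
      (fun _ hy => kernDet_nonneg hm hy (refl_mem hv)) (fun y hy => ?_) hx
    · rw [havg] at h
      exact h.trans_eq (by ring)
    · have := hle y hy (refl v) (refl_mem hv)
      rw [vandermonde_refl] at this
      exact this.trans_eq (by ring)
  have h2 := gammaAvg_mono_of_antisymm hd (isGood_halfAvg (lam := lam) hm x)
    (isAntisymm_halfAvg m x) (hgood (c * harm lam x)) (hanti (c * harm lam x))
    (fun _ hv => (halfAvg_spec hd hm hx hv).1) h1 (refl_mem hz)
  rw [havg] at h2
  exact h2

/-- The transition density at time `d + m`: exchange the descending sweeps for ascending ones, and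
move the triangular suffix to the end point by duality. -/
lemma descTop_pow_apply (φ : MFun d) (hφ : ∀ z, φ.1 z ≤ 1) :
    ((descTop (jumpOp lam) d d ^ (d + m) : Op d) φ).1 x =
      ∫⁻ z in weylChamber d, φ.1 z * ENNReal.ofReal (tauDens lam m x z) := by
  set P : Op d := triTop (jumpOp lam) d (d - 1) with hP
  set B : Op d := triWord (jumpOp lam) (d - 1) with hB
  have hPsub : IsSubMarkov P := isSubMarkov_triTop (isSubMarkov_jump (lam := lam)) (d - 1)
  have hBsub : IsSubMarkov B := isSubMarkov_triWord (isSubMarkov_jump (lam := lam)) (d - 1)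
  have hBφ : ∀ z, (B φ).1 z ≤ 1 := by
    obtain ⟨κ, h1, _, h3⟩ := hBsub
    intro z
    rw [h3]
    calc ∫⁻ y, φ.1 y ∂(κ z) ≤ ∫⁻ _, 1 ∂(κ z) := lintegral_mono fun y => hφ y
      _ ≤ 1 := by simpa using h1 z
  have hword : (descTop (jumpOp lam) d d ^ (d + m) : Op d) =
      P * ascWord (jumpOp lam) d ^ (m + 1) * B := by
    rw [show d + m = d - 1 + (m + 1) by omega]
    exact descTop_pow_eq (commute_jumpOp lam) hd (m + 1)
  have hD : Measurable (Function.uncurry fun y z : Fin d → ℝ =>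
      (B φ).1 z * ENNReal.ofReal (kernDet lam m y z)) :=
    ((B φ).2.comp measurable_snd).mul (measurable_kernDet m).ennreal_ofReal
  have hKz : ∀ z, Measurable fun y : Fin d → ℝ => ENNReal.ofReal (kernDet lam m y z) := fun z =>
    (isGood_kernDet_left (lam := lam) m z).measurable.ennreal_ofReal
  calc ((descTop (jumpOp lam) d d ^ (d + m) : Op d) φ).1 x
      = (P ((ascWord (jumpOp lam) d ^ (m + 1) : Op d) (B φ))).1 x := by rw [hword]; rfl
    _ = (P ⟨fun y => ∫⁻ z in weylChamber d, (B φ).1 z * ENNReal.ofReal (kernDet lam m y z),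
          hD.lintegral_prod_right'⟩).1 x :=
        hPsub.congr (fun y hy => ascWord_pow_succ_apply hm (B φ) hBφ hy) hx
    _ = ∫⁻ z in weylChamber d, (B φ).1 z * (P ⟨fun y => ENNReal.ofReal (kernDet lam m y z),
          hKz z⟩).1 x := by
        rw [hPsub.lintegral_swap _ hD x]
        exact lintegral_congr fun z => hPsub.const_mul _ ⟨_, hKz z⟩ x
    _ = ∫⁻ z in weylChamber d, ENNReal.ofReal (halfAvg lam m x (refl z)) * (B φ).1 z := by
        refine setLIntegral_congr_fun measurableSet_weylChamber fun z hz => ?_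
        have h := (halfAvg_spec (lam := lam) hd hm hx (refl_mem hz)).2
        simp only [refl_refl] at h
        rw [mul_comm]
        exact congrArg (· * (B φ).1 z) h
    _ = ∫⁻ z in weylChamber d, φ.1 z * (P ⟨fun v => ENNReal.ofReal (halfAvg lam m x v),
          (continuous_halfAvg hm x).measurable.ennreal_ofReal⟩).1 (refl z) := by
        have hH : Measurable fun v => ENNReal.ofReal (halfAvg lam m x v) :=
          (continuous_halfAvg hm x).measurable.ennreal_ofReal
        have h := isReflAdjoint_triWord lam (by omega : d - 1 ≤ d) φ (reflFun ⟨_, hH⟩)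
        rw [reflFun_reflFun] at h
        exact h
    _ = ∫⁻ z in weylChamber d, φ.1 z * ENNReal.ofReal (tauDens lam m x z) := by
        refine setLIntegral_congr_fun measurableSet_weylChamber fun z hz => ?_
        exact congrArg (φ.1 z * ·) (triTop_pred_apply (lam := lam) hd (isGood_halfAvg hm x)
          (isAntisymm_halfAvg m x) (fun _ hv => (halfAvg_spec hd hm hx hv).1) (refl_mem hz)).2

end TauDensity

/-! ### Bounds that do not decay in time -/

section Uniform

variable {d : ℕ} {lam : ℝ} [hl : Fact (0 < lam)] {x z : Fin d → ℝ}

lemma IsSubMarkov.apply_oneFun_le {w : Op d} (hw : IsSubMarkov w) (hx : x ∈ weylChamber d) :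
    (w (oneFun d)).1 x ≤ 1 :=
  hw.le_const (fun _ _ => le_rfl) hx

omit hl in
lemma measurable_mul_vandermonde (φ : MFun d) :
    Measurable fun z => φ.1 z * ENNReal.ofReal (vandermonde z) :=
  φ.2.mul continuous_vandermonde.measurable.ennreal_ofReal

/-- The triangular prefix integrates against the Vandermonde product, by duality. -/
lemma setLIntegral_triTop_le (hd : 1 ≤ d) (φ : MFun d) :
    ∫⁻ z in weylChamber d, (triTop (jumpOp lam) d (d - 1) φ : MFun d).1 z ≤
      ENNReal.ofReal lam ^ (∑ i ∈ Finset.range d, i) *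
        ∫⁻ z in weylChamber d, φ.1 z * ENNReal.ofReal (vandermonde z) := by
  have h := (isReflAdjoint_triWord lam (by omega : d - 1 ≤ d)).symm φ (oneFun d)
  have h1 : ∫⁻ z in weylChamber d, (triTop (jumpOp lam) d (d - 1) φ : MFun d).1 z =
      ∫⁻ z in weylChamber d, (oneFun d).1 z * (triTop (jumpOp lam) d (d - 1) φ : MFun d).1 z :=
    lintegral_congr fun z => (one_mul _).symm
  rw [h1, h, ← lintegral_const_mul _ (measurable_mul_vandermonde φ)]
  refine setLIntegral_mono ((measurable_mul_vandermonde φ).const_mul _) fun z hz => ?_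
  calc φ.1 z * (triWord (jumpOp lam) (d - 1) (oneFun d) : MFun d).1 (refl z)
      ≤ φ.1 z * (ENNReal.ofReal lam ^ (∑ i ∈ Finset.range d, i) *
          ENNReal.ofReal (vandermonde (refl z))) := by
        gcongr
        exact triWord_one_le hl.out hd (refl_mem hz)
    _ = _ := by rw [vandermonde_refl]; ring

lemma triWord_le_const (hd : 1 ≤ d) {F : MFun d} {c : ℝ≥0∞} (hF : ∀ y ∈ weylChamber d, F.1 y ≤ c)
    (hx : x ∈ weylChamber d) : (triWord (jumpOp lam) (d - 1) F : MFun d).1 x ≤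
      c * (ENNReal.ofReal lam ^ (∑ i ∈ Finset.range d, i) * ENNReal.ofReal (vandermonde x)) := by
  have hB : IsSubMarkov (triWord (jumpOp lam) (d - 1) : Op d) :=
    isSubMarkov_triWord (isSubMarkov_jump (lam := lam)) (d - 1)
  calc (triWord (jumpOp lam) (d - 1) F : MFun d).1 x
      ≤ (triWord (jumpOp lam) (d - 1) ⟨fun y => c * (oneFun d).1 y,
          (oneFun d).2.const_mul c⟩ : MFun d).1 x :=
        hB.mono (fun y hy => by simpa [oneFun] using hF y hy) hx
    _ = c * (triWord (jumpOp lam) (d - 1) (oneFun d) : MFun d).1 x := hB.const_mul c _ x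
    _ ≤ _ := by gcongr; exact triWord_one_le hl.out hd hx

/-- Rewrite the ascending sweeps as descending sweeps between triangular words: the suffix gives
`Δ(z)`, one descending sweep the factor `lam ^ d`, and the prefix gives `Δ(x)`. -/
lemma ascWord_pow_le (hd : 1 ≤ d) (k : ℕ) (φ : MFun d) (hx : x ∈ weylChamber d) :
    ((ascWord (jumpOp lam) d ^ (d + k) : Op d) φ).1 x ≤
      ∫⁻ z in weylChamber d, φ.1 z *
        ENNReal.ofReal (lam ^ d ^ 2 * vandermonde x * vandermonde z) := by
  set s := ∑ i ∈ Finset.range d, i with hs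
  have hs2 : s + d + s = d ^ 2 := by
    have := Finset.sum_range_id_mul_two d
    rw [← hs] at this
    obtain ⟨e, rfl⟩ : ∃ e, d = e + 1 := ⟨d - 1, by omega⟩
    simp only [Nat.add_sub_cancel] at this
    nlinarith
  have hword : (ascWord (jumpOp lam) d ^ (d + k) : Op d) =
      triWord (jumpOp lam) (d - 1) * descTop (jumpOp lam) d d ^ (k + 1) *
        triTop (jumpOp lam) d (d - 1) := by
    rw [show d + k = d - 1 + (k + 1) by omega]
    exact ascWord_pow_eq (commute_jumpOp lam) hd (k + 1)
  have hQ : IsSubMarkov (descTop (jumpOp lam) d d : Op d) :=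
    isSubMarkov_descTop (isSubMarkov_jump (lam := lam)) d
  set ψ : MFun d := triTop (jumpOp lam) d (d - 1) φ with hψ
  have h1 : ∀ y ∈ weylChamber d, ((descTop (jumpOp lam) d d ^ (k + 1) : Op d) ψ).1 y ≤
      ENNReal.ofReal lam ^ d * ∫⁻ z in weylChamber d, ψ.1 z := by
    intro y hy
    rw [pow_succ]
    exact (hQ.pow k).le_const (fun v hv => descTop_self_le hl.out ψ hv) hy
  rw [hword]
  change (triWord (jumpOp lam) (d - 1) ((descTop (jumpOp lam) d d ^ (k + 1) : Op d) ψ) :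
    MFun d).1 x ≤ _
  refine (triWord_le_const hd h1 hx).trans ?_
  have hvx := (vandermonde_pos hx).le
  have hl0 := hl.out.le
  calc ENNReal.ofReal lam ^ d * (∫⁻ z in weylChamber d, ψ.1 z) *
        (ENNReal.ofReal lam ^ s * ENNReal.ofReal (vandermonde x))
      ≤ ENNReal.ofReal lam ^ d * (ENNReal.ofReal lam ^ s *
          ∫⁻ z in weylChamber d, φ.1 z * ENNReal.ofReal (vandermonde z)) *
        (ENNReal.ofReal lam ^ s * ENNReal.ofReal (vandermonde x)) := by
        gcongr
        exact setLIntegral_triTop_le hd φ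
    _ = ENNReal.ofReal (lam ^ d ^ 2 * vandermonde x) *
          ∫⁻ z in weylChamber d, φ.1 z * ENNReal.ofReal (vandermonde z) := by
        rw [ENNReal.ofReal_mul (by positivity), ENNReal.ofReal_pow hl0, ← hs2]
        ring
    _ = _ := by
        rw [← lintegral_const_mul _ (measurable_mul_vandermonde φ)]
        refine lintegral_congr fun z => ?_
        rw [ENNReal.ofReal_mul (by positivity : 0 ≤ lam ^ d ^ 2 * vandermonde x)]
        ring

lemma kernDet_le_uniform (hd : 1 ≤ d) {m : ℕ} (hm : 1 ≤ m) (hdm : d ≤ m + 1)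
    (hx : x ∈ weylChamber d) (hz : z ∈ weylChamber d) :
    kernDet lam m x z ≤ lam ^ d ^ 2 * vandermonde x * vandermonde z := by
  have hcont : Continuous fun z : Fin d → ℝ => lam ^ d ^ 2 * vandermonde x * vandermonde z :=
    continuous_const.mul continuous_vandermonde
  have hDc : Continuous (kernDet lam m x) := (continuous_kernDet hm).comp (Continuous.prodMk_right x)
  have h : (fun z => ENNReal.ofReal (kernDet lam m x z))
      ≤ᵐ[volume.restrict (weylChamber d)]
      fun z => ENNReal.ofReal (lam ^ d ^ 2 * vandermonde x * vandermonde z) := by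
    refine ae_le_of_forall_setLIntegral_le_of_sigmaFinite hDc.measurable.ennreal_ofReal
      fun s hs _ => ?_
    have hind : ∀ f : (Fin d → ℝ) → ℝ≥0∞, ∫⁻ z in s, f z ∂(volume.restrict (weylChamber d)) =
        ∫⁻ z in weylChamber d, (indFun hs).1 z * f z := by
      intro f
      rw [← lintegral_indicator hs]
      refine lintegral_congr fun z => ?_
      by_cases h : z ∈ s <;> simp [indFun, h]
    rw [hind, hind, ← ascWord_pow_succ_apply hm (indFun hs) (fun z => ?_) hx]
    · obtain ⟨k, hk⟩ := Nat.exists_eq_add_of_le hdm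
      rw [hk]
      exact ascWord_pow_le hd k _ hx
    · exact Set.indicator_le_self' (fun _ _ => bot_le) z
  refine le_of_ae_le_weylChamber (f := kernDet lam m x) ?_ hDc.continuousOn hcont.continuousOn hz
  filter_upwards [h, ae_restrict_mem measurableSet_weylChamber] with z hz hzW
  have := (vandermonde_pos hzW).le
  have := (vandermonde_pos hx).le
  have := hl.out.le
  exact (ENNReal.ofReal_le_ofReal_iff (by positivity)).1 hz

lemma ascWord_pow_one_le_uniform (hd : 1 ≤ d) (k : ℕ) (hx : x ∈ weylChamber d) :
    ((ascWord (jumpOp lam) d ^ (d - 1 + k) : Op d) (oneFun d)).1 x ≤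
      ENNReal.ofReal lam ^ (∑ i ∈ Finset.range d, i) * ENNReal.ofReal (vandermonde x) := by
  have hQ : IsSubMarkov (descTop (jumpOp lam) d d : Op d) :=
    isSubMarkov_descTop (isSubMarkov_jump (lam := lam)) d
  have hP : IsSubMarkov (triTop (jumpOp lam) d (d - 1) : Op d) :=
    isSubMarkov_triTop (isSubMarkov_jump (lam := lam)) (d - 1)
  rw [ascWord_pow_eq (commute_jumpOp lam) hd k, mul_assoc]
  refine (triWord_le_const hd (c := 1) (F := (descTop (jumpOp lam) d d ^ k *
    triTop (jumpOp lam) d (d - 1) : Op d) (oneFun d)) (fun y hy => ?_) hx).trans_eq (one_mul _)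
  exact ((hQ.pow k).mul hP).apply_oneFun_le hy

/-- Tail bounds for the interlaced walk in terms of `Δ` yield tail bounds for the walk killed at `τ`
in terms of `h`, by the exchange of sweeps. -/
lemma descTop_pow_one_le (hd : 1 ≤ d) (k : ℕ) {c : ℝ≥0∞} (hc : ∀ y ∈ weylChamber d,
    ((ascWord (jumpOp lam) d ^ k : Op d) (triWord (jumpOp lam) (d - 1) (oneFun d))).1 y ≤
      c * ENNReal.ofReal (vandermonde y)) (hx : x ∈ weylChamber d) :
    ((descTop (jumpOp lam) d d ^ (d - 1 + k) : Op d) (oneFun d)).1 x ≤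
      c * ENNReal.ofReal (harm lam x) := by
  have hP : IsSubMarkov (triTop (jumpOp lam) d (d - 1) : Op d) :=
    isSubMarkov_triTop (isSubMarkov_jump (lam := lam)) (d - 1)
  rw [descTop_pow_eq (commute_jumpOp lam) hd k, mul_assoc]
  change (triTop (jumpOp lam) d (d - 1) ((ascWord (jumpOp lam) d ^ k : Op d)
    (triWord (jumpOp lam) (d - 1) (oneFun d))) : MFun d).1 x ≤ _
  rw [← triTop_pred_vandermonde hd hx, ← hP.const_mul]
  exact hP.mono (fun y hy => hc y hy) hx

lemma ascWord_pow_triWord_one_le (k : ℕ) (hx : x ∈ weylChamber d) :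
    ((ascWord (jumpOp lam) d ^ k : Op d) (triWord (jumpOp lam) (d - 1) (oneFun d))).1 x ≤
      ((ascWord (jumpOp lam) d ^ k : Op d) (oneFun d)).1 x := by
  have hB : IsSubMarkov (triWord (jumpOp lam) (d - 1) : Op d) :=
    isSubMarkov_triWord (isSubMarkov_jump (lam := lam)) (d - 1)
  exact ((isSubMarkov_ascWord (isSubMarkov_jump (lam := lam)) d).pow k).mono
    (fun y hy => hB.apply_oneFun_le hy) hx

lemma descTop_pow_one_le_uniform (hd : 1 ≤ d) (k : ℕ) (hx : x ∈ weylChamber d) :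
    ((descTop (jumpOp lam) d d ^ (d - 1 + k) : Op d) (oneFun d)).1 x ≤
      ENNReal.ofReal lam ^ (∑ i ∈ Finset.range d, i) * ENNReal.ofReal (harm lam x) := by
  refine descTop_pow_one_le hd k (fun y hy => ?_) hx
  have hQ : IsSubMarkov (descTop (jumpOp lam) d d : Op d) :=
    isSubMarkov_descTop (isSubMarkov_jump (lam := lam)) d
  have h := triWord_le_const (lam := lam) hd (c := 1)
    (F := (descTop (jumpOp lam) d d ^ k : Op d) (oneFun d))
    (fun v hv => (hQ.pow k).apply_oneFun_le hv) hy
  have hword := triWord_mul_descTop_pow (commute_jumpOp (d := d) lam) hd k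
  have h2 : (triWord (jumpOp lam) (d - 1) ((descTop (jumpOp lam) d d ^ k : Op d) (oneFun d)) :
      MFun d) = (ascWord (jumpOp lam) d ^ k : Op d) (triWord (jumpOp lam) (d - 1) (oneFun d)) :=
    congrFun hword (oneFun d)
  rw [h2, one_mul] at h
  exact h

end Uniform

/-! ### Derivatives of Gamma densities -/

section GammaDeriv

variable {lam : ℝ}

/-- The `k`-th derivative of the Gamma density of shape `m + 1`, for `m > k`: an iterated
difference in the shape parameter. -/
noncomputable def gammaDeriv (lam : ℝ) : ℕ → ℕ → ℝ → ℝ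
  | 0, m => gammaDens lam m
  | k + 1, m => fun u => lam * (gammaDeriv lam k (m - 1) u - gammaDeriv lam k m u)

lemma gammaDeriv_zero (m : ℕ) : gammaDeriv lam 0 m = gammaDens lam m := rfl

lemma gammaDeriv_succ (k m : ℕ) (u : ℝ) : gammaDeriv lam (k + 1) m u =
    lam * (gammaDeriv lam k (m - 1) u - gammaDeriv lam k m u) := rfl

lemma gammaDeriv_of_neg (k m : ℕ) {u : ℝ} (hu : u < 0) : gammaDeriv lam k m u = 0 := by
  induction k generalizing m with
  | zero => exact gammaDens_of_neg hu
  | succ k ih => rw [gammaDeriv_succ, ih, ih]; simp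

lemma measurable_gammaDeriv (k m : ℕ) : Measurable (gammaDeriv lam k m) := by
  induction k generalizing m with
  | zero => exact measurable_gammaDens lam m
  | succ k ih => exact ((ih _).sub (ih _)).const_mul lam

lemma integrable_gammaDeriv (hl : 0 < lam) (k m : ℕ) : Integrable (gammaDeriv lam k m) := by
  induction k generalizing m with
  | zero => exact integrable_gammaDens hl m
  | succ k ih => exact ((ih _).sub (ih _)).const_mul lam

lemma continuous_gammaDeriv {k m : ℕ} (hkm : k < m) : Continuous (gammaDeriv lam k m) := by
  induction k generalizing m with
  | zero => exact continuous_gammaDens hkm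
  | succ k ih => exact continuous_const.mul ((ih (by omega)).sub (ih (by omega)))

lemma exists_abs_gammaDeriv_le (hl : 0 < lam) (k m : ℕ) : ∃ C, ∀ u, |gammaDeriv lam k m u| ≤ C := by
  induction k generalizing m with
  | zero =>
    obtain ⟨C, _, hC⟩ := exists_gammaDens_le hl m
    exact ⟨C, fun u => by rw [gammaDeriv_zero, abs_of_nonneg (gammaDens_nonneg hl m u)]; exact hC u⟩
  | succ k ih =>
    obtain ⟨C, hC⟩ := ih (m - 1)
    obtain ⟨C', hC'⟩ := ih m
    refine ⟨lam * (C + C'), fun u => ?_⟩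
    rw [gammaDeriv_succ, abs_mul, abs_of_pos hl]
    gcongr
    exact (abs_sub _ _).trans (add_le_add (hC u) (hC' u))

lemma hasDerivAt_gammaDens {m : ℕ} (hm : 2 ≤ m) (u : ℝ) :
    HasDerivAt (gammaDens lam m) (gammaDeriv lam 1 m u) u := by
  obtain ⟨e, rfl⟩ : ∃ e, m = e + 2 := ⟨m - 2, by omega⟩
  set p : ℝ → ℝ := fun u =>
    lam ^ (e + 2 + 1) * u ^ (e + 2) / (e + 2).factorial * Real.exp (-(lam * u)) with hp
  set q : ℝ → ℝ := fun u => lam * (lam ^ (e + 2) * u ^ (e + 1) / (e + 1).factorial *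
    Real.exp (-(lam * u)) - p u) with hq
  have hpq : ∀ u, HasDerivAt p (q u) u := by
    intro u
    have h1 : HasDerivAt (fun u : ℝ => -(lam * u)) (-(lam * 1)) u :=
      ((hasDerivAt_id u).const_mul lam).neg
    have h2 := (((hasDerivAt_pow (e + 2) u).const_mul (lam ^ (e + 2 + 1))).div_const
      ((e + 2).factorial : ℝ)).mul h1.exp
    refine h2.congr_deriv ?_
    simp only [hq, hp, Nat.factorial_succ (e + 1)]
    push_cast
    have : ((e + 1).factorial : ℝ) ≠ 0 := by positivity
    have : ((e : ℝ) + 1 + 1) ≠ 0 := by positivity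
    field_simp
    ring
  have hp0 : p 0 = 0 := by simp [hp]
  have hq0 : q 0 = 0 := by simp [hq, hp]
  rcases lt_trichotomy u 0 with hu | rfl | hu
  · rw [gammaDeriv_of_neg _ _ hu]
    refine (hasDerivAt_const u (0 : ℝ)).congr_of_eventuallyEq ?_
    filter_upwards [gt_mem_nhds hu] with v hv
    exact gammaDens_of_neg hv
  · have hd : gammaDeriv lam 1 (e + 2) 0 = 0 := by
      simp [gammaDeriv_succ, gammaDeriv_zero, gammaDens]
    rw [hd, ← hasDerivWithinAt_univ, ← Set.Iic_union_Ici (a := (0 : ℝ))]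
    refine HasDerivWithinAt.union ?_ ?_
    · refine (hasDerivWithinAt_const (0 : ℝ) _ (0 : ℝ)).congr (fun v hv => ?_) ?_
      · rcases (Set.mem_Iic.1 hv).lt_or_eq with h | rfl
        · exact gammaDens_of_neg h
        · simp [gammaDens]
      · simp [gammaDens]
    · have h := (hpq 0).hasDerivWithinAt (s := Set.Ici 0)
      rw [hq0] at h
      exact h.congr (fun v hv => gammaDens_of_nonneg hv) (gammaDens_of_nonneg le_rfl)
  · have hval : gammaDeriv lam 1 (e + 2) u = q u := by
      rw [gammaDeriv_succ, gammaDeriv_zero, gammaDeriv_zero, gammaDens_of_nonneg hu.le,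
        gammaDens_of_nonneg hu.le]
      rfl
    rw [hval]
    refine (hpq u).congr_of_eventuallyEq ?_
    filter_upwards [lt_mem_nhds hu] with v hv
    exact gammaDens_of_nonneg hv.le

lemma hasDerivAt_gammaDeriv {k m : ℕ} (hkm : k + 2 ≤ m) (u : ℝ) :
    HasDerivAt (gammaDeriv lam k m) (gammaDeriv lam (k + 1) m u) u := by
  induction k generalizing m with
  | zero => exact hasDerivAt_gammaDens hkm u
  | succ k ih =>
    exact ((ih (m := m - 1) (by omega)).sub (ih (m := m) (by omega))).const_mul lam

/-- The total variation distance of Gamma laws with consecutive shapes: a second moment bound. -/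
lemma integral_abs_gammaDeriv_one_le (hl : 0 < lam) {b : ℕ} (hb : 1 ≤ b) :
    ∫ u, |gammaDeriv lam 1 b u| ≤ lam / Real.sqrt b := by
  obtain ⟨e, rfl⟩ : ∃ e, b = e + 1 := ⟨b - 1, by omega⟩
  set β : ℝ := ((e + 1 : ℕ) : ℝ) with hβ
  have hβ0 : 0 < β := by positivity
  set r := Real.sqrt β with hr
  have hr0 : 0 < r := Real.sqrt_pos.2 hβ0
  have hr2 : r * r = β := Real.mul_self_sqrt hβ0.le
  -- `|y| ≤ (√b y² + 1 / √b) / 2` with `y = 1 - lam u / b`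
  have hpt : ∀ u, |gammaDeriv lam 1 (e + 1) u| ≤
      lam / 2 * (r * (gammaDens lam e u - 2 * gammaDens lam (e + 1) u +
        (β + 1) / β * gammaDens lam (e + 2) u) + 1 / r * gammaDens lam e u) := by
    intro u
    rcases lt_or_ge u 0 with hu | hu
    · simp [gammaDeriv_of_neg _ _ hu, gammaDens_of_neg hu]
    set y : ℝ := 1 - lam * u / β with hy
    have hf := gammaDens_nonneg hl e u
    have h1 : gammaDens lam (e + 1) u = gammaDens lam e u * (lam * u / β) := by
      rw [gammaDens_of_nonneg hu, gammaDens_of_nonneg hu, Nat.factorial_succ, hβ]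
      push_cast
      have : (e.factorial : ℝ) ≠ 0 := by positivity
      have : (e : ℝ) + 1 ≠ 0 := by positivity
      field_simp
      ring
    have h2 : (β + 1) / β * gammaDens lam (e + 2) u = gammaDens lam e u * (lam * u / β) ^ 2 := by
      rw [gammaDens_of_nonneg hu, gammaDens_of_nonneg hu, Nat.factorial_succ (e + 1),
        Nat.factorial_succ e, hβ]
      push_cast
      have : (e.factorial : ℝ) ≠ 0 := by positivity
      have : (e : ℝ) + 1 ≠ 0 := by positivity
      have : (e : ℝ) + 1 + 1 ≠ 0 := by positivity
      field_simp
      ring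
    have h3 : gammaDeriv lam 1 (e + 1) u = lam * (gammaDens lam e u * y) := by
      rw [gammaDeriv_succ, gammaDeriv_zero, gammaDeriv_zero, Nat.add_sub_cancel, h1, hy]
      ring
    have h4 : |y| ≤ (r * y ^ 2 + 1 / r) / 2 := by
      have h5 : 0 ≤ (r * |y| - 1) ^ 2 / r := by positivity
      have h6 : (r * |y| - 1) ^ 2 / r = r * y ^ 2 - 2 * |y| + 1 / r := by
        rw [← sq_abs y]; field_simp; ring
      linarith
    rw [h3, abs_mul, abs_mul, abs_of_pos hl, abs_of_nonneg hf, h2, h1]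
    calc lam * (gammaDens lam e u * |y|)
        ≤ lam * (gammaDens lam e u * ((r * y ^ 2 + 1 / r) / 2)) := by gcongr
      _ = _ := by rw [hy]; ring
  have hi : ∀ m, Integrable (gammaDens lam m) := integrable_gammaDens hl
  calc ∫ u, |gammaDeriv lam 1 (e + 1) u|
      ≤ ∫ u, lam / 2 * (r * (gammaDens lam e u - 2 * gammaDens lam (e + 1) u +
        (β + 1) / β * gammaDens lam (e + 2) u) + 1 / r * gammaDens lam e u) := by
        refine integral_mono (integrable_gammaDeriv hl _ _).abs ?_ hpt
        exact ((((((hi _).sub ((hi _).const_mul _)).add ((hi _).const_mul _)).const_mul _).add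
          ((hi _).const_mul _))).const_mul _
    _ = lam / 2 * (r * (1 - 2 + (β + 1) / β) + 1 / r) := by
        rw [integral_const_mul, integral_add, integral_const_mul, integral_add, integral_sub,
          integral_const_mul, integral_const_mul, integral_const_mul, integral_gammaDens hl,
          integral_gammaDens hl, integral_gammaDens hl]
        · ring
        · exact hi _
        · exact (hi _).const_mul _
        · exact (hi _).sub ((hi _).const_mul _)
        · exact (hi _).const_mul _
        · exact (((hi _).sub ((hi _).const_mul _)).add ((hi _).const_mul _)).const_mul _
        · exact (hi _).const_mul _
    _ = lam / r := by
        rw [← hr2]; field_simp; ring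

lemma lintegral_gammaDens_conv_gammaDens (hl : 0 < lam) (a b : ℕ) (u : ℝ) :
    ∫⁻ s, ENNReal.ofReal (gammaDens lam a (u - s)) * ENNReal.ofReal (gammaDens lam b s) =
      ENNReal.ofReal (gammaDens lam (a + b + 1) u) := by
  have hm : ∀ m, Measurable fun u => ENNReal.ofReal (gammaDens lam m u) := fun m =>
    (measurable_gammaDens lam m).ennreal_ofReal
  induction b generalizing u with
  | zero => exact lintegral_gammaDens_conv hl a u
  | succ b ih =>
    calc ∫⁻ s, ENNReal.ofReal (gammaDens lam a (u - s)) * ENNReal.ofReal (gammaDens lam (b + 1) s)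
        = ∫⁻ s, ∫⁻ r, ENNReal.ofReal (gammaDens lam a (u - s)) *
            (ENNReal.ofReal (gammaDens lam b (s - r)) * ENNReal.ofReal (gammaDens lam 0 r)) := by
          refine lintegral_congr fun s => ?_
          rw [← lintegral_gammaDens_conv hl b s, lintegral_const_mul]
          exact ((hm b).comp (measurable_const.sub measurable_id)).mul (hm 0)
      _ = ∫⁻ r, ∫⁻ s, ENNReal.ofReal (gammaDens lam a (u - s)) *
            (ENNReal.ofReal (gammaDens lam b (s - r)) * ENNReal.ofReal (gammaDens lam 0 r)) := by
          refine lintegral_lintegral_swap (Measurable.aemeasurable ?_)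
          exact ((hm a).comp (measurable_const.sub measurable_fst)).mul
            (((hm b).comp (measurable_fst.sub measurable_snd)).mul ((hm 0).comp measurable_snd))
      _ = ∫⁻ r, ENNReal.ofReal (gammaDens lam (a + b + 1) (u - r)) *
            ENNReal.ofReal (gammaDens lam 0 r) := by
          refine lintegral_congr fun r => ?_
          rw [← ih (u - r), ← lintegral_mul_const]
          · rw [← lintegral_add_right_eq_self _ r]
            refine lintegral_congr fun s => ?_
            rw [add_sub_cancel_right, sub_add_eq_sub_sub_swap, mul_assoc]
          · exact ((hm a).comp (measurable_const.sub measurable_id)).mul (hm b)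
      _ = ENNReal.ofReal (gammaDens lam (a + (b + 1) + 1) u) :=
          lintegral_gammaDens_conv hl (a + b + 1) u

lemma integrable_gammaDeriv_mul (hl : 0 < lam) (k a l b : ℕ) (u : ℝ) :
    Integrable fun s => gammaDeriv lam k a (u - s) * gammaDeriv lam l b s := by
  obtain ⟨C, hC⟩ := exists_abs_gammaDeriv_le hl k a
  exact (integrable_gammaDeriv hl l b).bdd_mul
    ((measurable_gammaDeriv k a).comp (measurable_const.sub measurable_id)).aestronglyMeasurable
    (Filter.Eventually.of_forall fun s => hC (u - s))

lemma integral_gammaDens_conv_gammaDens (hl : 0 < lam) (a b : ℕ) (u : ℝ) :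
    ∫ s, gammaDens lam a (u - s) * gammaDens lam b s = gammaDens lam (a + b + 1) u := by
  have h := lintegral_gammaDens_conv_gammaDens hl a b u
  rw [integral_eq_lintegral_of_nonneg_ae]
  · simp_rw [ENNReal.ofReal_mul (gammaDens_nonneg hl a _)]
    rw [h, ENNReal.toReal_ofReal (gammaDens_nonneg hl _ _)]
  · exact Filter.Eventually.of_forall fun s =>
      mul_nonneg (gammaDens_nonneg hl _ _) (gammaDens_nonneg hl _ _)
  · exact (integrable_gammaDeriv_mul hl 0 a 0 b u).aestronglyMeasurable

lemma integral_gammaDeriv_conv_gammaDens (hl : 0 < lam) {k a : ℕ} (hka : k ≤ a) (b : ℕ) (u : ℝ) :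
    ∫ s, gammaDeriv lam k a (u - s) * gammaDens lam b s = gammaDeriv lam k (a + b + 1) u := by
  induction k generalizing a with
  | zero => exact integral_gammaDens_conv_gammaDens hl a b u
  | succ k ih =>
    have h1 := integrable_gammaDeriv_mul hl k (a - 1) 0 b u
    have h2 := integrable_gammaDeriv_mul hl k a 0 b u
    rw [gammaDeriv_zero] at h1 h2
    rw [gammaDeriv_succ, show a + b + 1 - 1 = a - 1 + b + 1 by omega, ← ih (by omega),
      ← ih (by omega), ← integral_sub h1 h2, ← integral_const_mul]
    refine integral_congr_ae (Filter.Eventually.of_forall fun s => ?_)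
    simp only [gammaDeriv_succ]
    ring

lemma integral_gammaDeriv_conv_gammaDeriv_one (hl : 0 < lam) {k a b : ℕ} (hka : k ≤ a)
    (hb : 1 ≤ b) (u : ℝ) :
    ∫ s, gammaDeriv lam k a (u - s) * gammaDeriv lam 1 b s =
      gammaDeriv lam (k + 1) (a + b + 1) u := by
  have h1 := integrable_gammaDeriv_mul hl k a 0 (b - 1) u
  have h2 := integrable_gammaDeriv_mul hl k a 0 b u
  rw [gammaDeriv_zero] at h1 h2
  rw [gammaDeriv_succ, show a + b + 1 - 1 = a + (b - 1) + 1 by omega,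
    ← integral_gammaDeriv_conv_gammaDens hl hka, ← integral_gammaDeriv_conv_gammaDens hl hka,
    ← integral_sub h1 h2, ← integral_const_mul]
  refine integral_congr_ae (Filter.Eventually.of_forall fun s => ?_)
  simp only [gammaDeriv_succ, gammaDeriv_zero]
  ring

/-- Young's inequality for the convolution of two Gamma densities, with one derivative given to the
second one. -/
lemma integral_abs_gammaDeriv_succ_le (hl : 0 < lam) {k a b : ℕ} (hka : k ≤ a) (hb : 1 ≤ b) :
    ∫ u, |gammaDeriv lam (k + 1) (a + b + 1) u| ≤
      (∫ u, |gammaDeriv lam k a u|) * ∫ u, |gammaDeriv lam 1 b u| := by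
  have hf := integrable_gammaDeriv hl k a
  have hg := integrable_gammaDeriv hl 1 b
  have hconv : Integrable fun p : ℝ × ℝ => |gammaDeriv lam k a (p.1 - p.2)| *
      |gammaDeriv lam 1 b p.2| := by
    have h := hg.abs.convolution_integrand (ContinuousLinearMap.mul ℝ ℝ) hf.abs
    refine h.congr (Filter.Eventually.of_forall fun p => ?_)
    simp [mul_comm]
  calc ∫ u, |gammaDeriv lam (k + 1) (a + b + 1) u|
      ≤ ∫ u, ∫ s, |gammaDeriv lam k a (u - s)| * |gammaDeriv lam 1 b s| := by
        refine integral_mono (integrable_gammaDeriv hl _ _).abs hconv.integral_prod_left fun u => ?_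
        simp only
        rw [← integral_gammaDeriv_conv_gammaDeriv_one hl hka hb]
        refine (abs_integral_le_integral_abs).trans_eq ?_
        simp only [abs_mul]
    _ = ∫ s, ∫ u, |gammaDeriv lam k a (u - s)| * |gammaDeriv lam 1 b s| :=
        integral_integral_swap hconv
    _ = (∫ u, |gammaDeriv lam k a u|) * ∫ u, |gammaDeriv lam 1 b u| := by
        rw [← integral_const_mul]
        refine integral_congr_ae (Filter.Eventually.of_forall fun s => ?_)
        simp only
        rw [integral_mul_const, integral_sub_right_eq_self (fun u => |gammaDeriv lam k a u|) s]

/-- Splitting the Gamma variable into `k` independent parts of shape of order `m` and giving one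
derivative to each. -/
lemma integral_abs_gammaDeriv_le (hl : 0 < lam) {b : ℕ} (hb : 1 ≤ b) (k r : ℕ) :
    ∫ u, |gammaDeriv lam k (k * (b + 1) + r) u| ≤ (lam / Real.sqrt b) ^ k := by
  induction k with
  | zero =>
    simp only [gammaDeriv_zero, abs_of_nonneg (gammaDens_nonneg hl _ _), integral_gammaDens hl]
    simp
  | succ k ih =>
    rw [show (k + 1) * (b + 1) + r = k * (b + 1) + r + b + 1 by ring, pow_succ]
    have hk : k ≤ k * (b + 1) + r := by nlinarith
    refine (integral_abs_gammaDeriv_succ_le hl hk hb).trans ?_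
    have h2 : 0 ≤ ∫ u, |gammaDeriv lam 1 b u| := integral_nonneg fun u => abs_nonneg _
    exact mul_le_mul ih (integral_abs_gammaDeriv_one_le hl hb) h2 (by positivity)

/-- Derivatives of Gamma densities in `L¹`: each one gains a factor of order `lam / √m`. -/
lemma integral_abs_gammaDeriv_le_sqrt (hl : 0 < lam) {K k m : ℕ} (hkK : k ≤ K) (hK : 1 ≤ K)
    (hm : 2 * K ≤ m) :
    ∫ u, |gammaDeriv lam k m u| ≤ (Real.sqrt (4 * K) * (lam / Real.sqrt m)) ^ k := by
  set b := m / (2 * K) with hb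
  have hb1 : 1 ≤ b := (Nat.one_le_div_iff (by omega)).2 hm
  have h1 : 2 * K * b ≤ m := Nat.mul_div_le m (2 * K)
  have h2 : m < 2 * K * (b + 1) := Nat.lt_mul_div_succ m (by omega)
  have h3 : k * (b + 1) ≤ m := by
    calc k * (b + 1) ≤ K * (2 * b) := Nat.mul_le_mul hkK (by omega)
      _ = 2 * K * b := by ring
      _ ≤ m := h1
  obtain ⟨r, hr⟩ := Nat.exists_eq_add_of_le h3
  have h4 : m ≤ 4 * K * b := by nlinarith
  have hb0 : (0 : ℝ) < b := by exact_mod_cast hb1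
  have hm0 : (0 : ℝ) < m := by exact_mod_cast (by omega : 0 < m)
  have h5 : lam / Real.sqrt b ≤ Real.sqrt (4 * K) * (lam / Real.sqrt m) := by
    have h6 : Real.sqrt m ≤ Real.sqrt (4 * K) * Real.sqrt b := by
      rw [← Real.sqrt_mul (by positivity)]
      exact Real.sqrt_le_sqrt (by exact_mod_cast h4)
    have hsb := Real.sqrt_pos.2 hb0
    have hsm := Real.sqrt_pos.2 hm0
    rw [← mul_div_assoc, div_le_div_iff₀ hsb hsm]
    nlinarith
  calc ∫ u, |gammaDeriv lam k m u| = ∫ u, |gammaDeriv lam k (k * (b + 1) + r) u| := by rw [← hr]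
    _ ≤ (lam / Real.sqrt b) ^ k := integral_abs_gammaDeriv_le hl hb1 k r
    _ ≤ _ := by gcongr

/-- The supremum of a function vanishing on the negative axis is bounded by the `L¹` norm of its
derivative. -/
lemma abs_gammaDeriv_le_integral (hl : 0 < lam) {k m : ℕ} (hkm : k + 2 ≤ m) (u : ℝ) :
    |gammaDeriv lam k m u| ≤ ∫ s, |gammaDeriv lam (k + 1) m s| := by
  have hint := integrable_gammaDeriv (lam := lam) hl (k + 1) m
  set v := min u (-1) with hv
  have hvu : v ≤ u := min_le_left _ _
  have hv0 : v < 0 := (min_le_right _ _).trans_lt (by norm_num)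
  have h := intervalIntegral.integral_eq_sub_of_hasDerivAt
    (fun x (_ : x ∈ Set.uIcc v u) => hasDerivAt_gammaDeriv (lam := lam) hkm x)
    hint.intervalIntegrable
  rw [gammaDeriv_of_neg _ _ hv0, sub_zero] at h
  rw [← h, intervalIntegral.integral_of_le hvu]
  calc |∫ x in Set.Ioc v u, gammaDeriv lam (k + 1) m x|
      ≤ ∫ x in Set.Ioc v u, |gammaDeriv lam (k + 1) m x| := abs_integral_le_integral_abs
    _ ≤ ∫ x, |gammaDeriv lam (k + 1) m x| :=
        setIntegral_le_integral hint.abs (Filter.Eventually.of_forall fun x => abs_nonneg _)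

end GammaDeriv

/-! ### Newton's divided differences -/

section Newton

/-- A function `F 0` with its derivatives `F 1, …, F K`, which are bounded by `B 0, …, B K`. -/
structure IsChain (K : ℕ) (B : ℕ → ℝ) (F : ℕ → ℝ → ℝ) : Prop where
  cont : ∀ j ≤ K, Continuous (F j)
  deriv : ∀ j < K, ∀ x, HasDerivAt (F j) (F (j + 1) x) x
  bound : ∀ j ≤ K, ∀ x, |F j x| ≤ B j

/-- The difference quotient `(F 0 x - F 0 c) / (x - c)`, written as a mean of the derivative,
together with its derivatives. -/
noncomputable def diffQuot (c : ℝ) (F : ℕ → ℝ → ℝ) : ℕ → ℝ → ℝ :=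
  fun j x => ∫ t in (0 : ℝ)..1, t ^ j * F (j + 1) (c + t * (x - c))

/-- Iterated difference quotients at the nodes `x 0, …, x (k - 1)`. -/
noncomputable def iterQuot (x : ℕ → ℝ) (F : ℕ → ℝ → ℝ) : ℕ → ℕ → ℝ → ℝ
  | 0 => F
  | k + 1 => diffQuot (x k) (iterQuot x F k)

lemma IsChain.diffQuot {K : ℕ} {B : ℕ → ℝ} {F : ℕ → ℝ → ℝ} (hF : IsChain (K + 1) B F) (c : ℝ) :
    IsChain K (fun j => B (j + 1)) (diffQuot c F) := by
  have hB : ∀ j ≤ K, ∀ t ∈ Set.uIoc (0 : ℝ) 1, ∀ x,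
      ‖t ^ j * F (j + 1) (c + t * (x - c))‖ ≤ B (j + 1) := by
    intro j hj t ht x
    rw [Set.uIoc_of_le zero_le_one] at ht
    rw [norm_mul, Real.norm_eq_abs, abs_of_nonneg (pow_nonneg ht.1.le j)]
    calc t ^ j * ‖F (j + 1) (c + t * (x - c))‖ ≤ 1 * ‖F (j + 1) (c + t * (x - c))‖ := by
          gcongr
          exact pow_le_one₀ ht.1.le ht.2
      _ ≤ B (j + 1) := by rw [one_mul]; exact hF.bound (j + 1) (by omega) _
  have hcont : ∀ j ≤ K, Continuous fun p : ℝ × ℝ =>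
      p.2 ^ j * F (j + 1) (c + p.2 * (p.1 - c)) := fun j hj =>
    (continuous_snd.pow j).mul ((hF.cont (j + 1) (by omega)).comp
      (continuous_const.add (continuous_snd.mul (continuous_fst.sub continuous_const))))
  have hcont' : ∀ j ≤ K, ∀ x, Continuous fun t : ℝ => t ^ j * F (j + 1) (c + t * (x - c)) :=
    fun j hj x => (hcont j hj).comp (Continuous.prodMk_right x)
  refine ⟨fun j hj => ?_, fun j hj x => ?_, fun j hj x => ?_⟩
  · exact intervalIntegral.continuous_parametric_intervalIntegral_of_continuous' (hcont j hj) 0 1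
  · refine (intervalIntegral.hasDerivAt_integral_of_dominated_loc_of_deriv_le
      (μ := volume) (a := 0) (b := 1) (s := Set.univ) (x₀ := x)
      (F := fun x t => t ^ j * F (j + 1) (c + t * (x - c)))
      (F' := fun x t => t ^ (j + 1) * F (j + 1 + 1) (c + t * (x - c)))
      (bound := fun _ => B (j + 1 + 1)) Filter.univ_mem ?_ ?_ ?_ ?_ ?_ ?_).2
    · exact Filter.Eventually.of_forall fun y => (hcont' j hj.le y).aestronglyMeasurable
    · exact (hcont' j hj.le x).intervalIntegrable 0 1
    · exact (hcont' (j + 1) hj x).aestronglyMeasurable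
    · exact Filter.Eventually.of_forall fun t ht y _ => hB (j + 1) hj t ht y
    · exact intervalIntegrable_const
    · refine Filter.Eventually.of_forall fun t _ y _ => ?_
      have h1 : HasDerivAt (fun y : ℝ => c + t * (y - c)) (t * 1) y :=
        (((hasDerivAt_id y).sub_const c).const_mul t).const_add c
      have h2 := ((hF.deriv (j + 1) (by omega) (c + t * (y - c))).comp y h1).const_mul (t ^ j)
      refine h2.congr_deriv ?_
      ring
  · refine (intervalIntegral.norm_integral_le_of_norm_le_const fun t ht => hB j hj t ht x).trans_eq ?_
    simp

lemma IsChain.iterQuot {K : ℕ} {B : ℕ → ℝ} {F : ℕ → ℝ → ℝ} (x : ℕ → ℝ) (k : ℕ)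
    (hF : IsChain (K + k) B F) : IsChain K (fun j => B (j + k)) (iterQuot x F k) := by
  induction k generalizing K with
  | zero => exact hF
  | succ k ih =>
    have h := (ih (K := K + 1) (by rwa [add_assoc, add_comm 1])).diffQuot (x k)
    have hB : (fun j => B (j + (k + 1))) = fun j => B (j + 1 + k) := by
      funext j; congr 1; ring
    rw [hB]
    exact h

lemma IsChain.sub_eq_mul_diffQuot {K : ℕ} {B : ℕ → ℝ} {F : ℕ → ℝ → ℝ} (hF : IsChain (K + 1) B F)
    (c x : ℝ) : F 0 x - F 0 c = (x - c) * OrderedWalk.diffQuot c F 0 x := by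
  have h1 : ∀ t ∈ Set.uIcc (0 : ℝ) 1, HasDerivAt (fun t : ℝ => F 0 (c + t * (x - c)))
      (F 1 (c + t * (x - c)) * (x - c)) t := by
    intro t _
    have h2 : HasDerivAt (fun t : ℝ => c + t * (x - c)) (1 * (x - c)) t :=
      ((hasDerivAt_id t).mul_const (x - c)).const_add c
    rw [one_mul] at h2
    exact (hF.deriv 0 (by omega) _).comp t h2
  have hc : Continuous fun t : ℝ => F 1 (c + t * (x - c)) :=
    (hF.cont 1 (by omega)).comp (by fun_prop)
  have h := intervalIntegral.integral_eq_sub_of_hasDerivAt h1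
    ((hc.mul continuous_const).intervalIntegrable 0 1)
  simp only [zero_mul, add_zero, one_mul, add_sub_cancel] at h
  rw [← h, intervalIntegral.integral_mul_const, mul_comm]
  simp [OrderedWalk.diffQuot]

/-- Newton's interpolation formula with remainder. -/
lemma IsChain.newton {K : ℕ} {B : ℕ → ℝ} {F : ℕ → ℝ → ℝ} (hF : IsChain K B F) (x : ℕ → ℝ) {n : ℕ}
    (hn : n ≤ K) (y : ℝ) :
    F 0 y = ∑ k ∈ Finset.range n, (∏ p ∈ Finset.range k, (y - x p)) *
        OrderedWalk.iterQuot x F k 0 (x k) +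
      (∏ p ∈ Finset.range n, (y - x p)) * OrderedWalk.iterQuot x F n 0 y := by
  induction n with
  | zero => simp [OrderedWalk.iterQuot]
  | succ n ih =>
    have h := IsChain.sub_eq_mul_diffQuot (K := K - n - 1) (IsChain.iterQuot (K := K - n - 1 + 1) x n
      (by rwa [show K - n - 1 + 1 + n = K by omega])) (x n) y
    rw [ih (by omega), Finset.sum_range_succ, Finset.prod_range_succ]
    have h2 : OrderedWalk.iterQuot x F (n + 1) 0 y =
      OrderedWalk.diffQuot (x n) (OrderedWalk.iterQuot x F n) 0 y := rfl
    rw [h2, mul_assoc, ← h]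
    ring

/-- The triangular matrix `∏_{p < k} (x i - x p)` that expresses values at the nodes through divided
differences. -/
def newtonMatrix {d : ℕ} (x : Fin d → ℝ) : Matrix (Fin d) (Fin d) ℝ :=
  Matrix.of fun i k => ∏ p ∈ Finset.Iio k, (x i - x p)

lemma det_newtonMatrix {d : ℕ} (x : Fin d → ℝ) : (newtonMatrix x).det = vandermonde x := by
  rw [Matrix.det_of_isLowerTriangular, vandermonde_eq_prod_vandFactor]
  · rfl
  · intro i k hik
    have hik' : i < k := hik
    exact Finset.prod_eq_zero (Finset.mem_Iio.2 hik') (sub_self _)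

section Bounds

variable {d : ℕ} {x : Fin d → ℝ}

/-- The nodes, extended by zero to all natural indices. -/
noncomputable def nodeSeq (x : Fin d → ℝ) (k : ℕ) : ℝ := if h : k < d then x ⟨k, h⟩ else 0

lemma nodeSeq_val (x : Fin d → ℝ) (i : Fin d) : nodeSeq x i = x i := by
  simp [nodeSeq]

lemma prod_range_nodeSeq (x : Fin d → ℝ) (y : ℝ) (k : Fin d) :
    ∏ p ∈ Finset.range (k : ℕ), (y - nodeSeq x p) = ∏ p ∈ Finset.Iio k, (y - x p) := by
  refine (Finset.prod_bij (fun (p : Fin d) _ => (p : ℕ)) ?_ ?_ ?_ ?_).symm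
  · intro p hp; simpa using hp
  · intro p _ q _ h; exact Fin.ext h
  · intro q hq
    have hq' := Finset.mem_range.1 hq
    exact ⟨⟨q, hq'.trans k.2⟩, by simpa [Fin.lt_def] using hq', rfl⟩
  · intro p _; rw [nodeSeq_val]

lemma newtonMatrix_mulVec_iterQuot {B : ℕ → ℝ} {F : ℕ → ℝ → ℝ} (hF : IsChain (d - 1) B F)
    (x : Fin d → ℝ) :
    (newtonMatrix x).mulVec (fun k : Fin d => iterQuot (nodeSeq x) F k 0 (x k)) =
      fun i => F 0 (x i) := by
  funext i
  have h := hF.newton (nodeSeq x) (n := (i : ℕ)) (by omega) (x i)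
  have h0 : ∀ k : Fin d, i < k → newtonMatrix x i k = 0 := fun k hik =>
    Finset.prod_eq_zero (Finset.mem_Iio.2 hik) (sub_self _)
  have h1 : (newtonMatrix x).mulVec (fun k : Fin d => iterQuot (nodeSeq x) F k 0 (x k)) i =
      ∑ k ∈ Finset.Iic i, newtonMatrix x i k * iterQuot (nodeSeq x) F k 0 (x k) := by
    symm
    refine Finset.sum_subset (Finset.subset_univ (Finset.Iic i)) fun k _ hk => ?_
    rw [h0 k (by simpa using hk), zero_mul]
  have h2 : ∑ k ∈ Finset.Iic i, newtonMatrix x i k * iterQuot (nodeSeq x) F k 0 (x k) =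
      ∑ k ∈ Finset.range ((i : ℕ) + 1), (∏ p ∈ Finset.range k, (x i - nodeSeq x p)) *
        iterQuot (nodeSeq x) F k 0 (nodeSeq x k) := by
    refine Finset.sum_bij (fun (k : Fin d) _ => (k : ℕ)) ?_ ?_ ?_ ?_
    · intro k hk
      have := Finset.mem_Iic.1 hk
      rw [Fin.le_def] at this
      exact Finset.mem_range.2 (by omega)
    · intro p _ q _ h; exact Fin.ext h
    · intro q hq
      have hq' := Finset.mem_range.1 hq
      have hi := i.2
      refine ⟨⟨q, by omega⟩, ?_, rfl⟩
      rw [Finset.mem_Iic, Fin.le_def]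
      change q ≤ (i : ℕ)
      omega
    · intro k _
      rw [prod_range_nodeSeq, nodeSeq_val]
      rfl
  rw [h1, h2, Finset.sum_range_succ, h, nodeSeq_val]

lemma isUnit_det_newtonMatrix (hx : x ∈ weylChamber d) : IsUnit (newtonMatrix x).det := by
  rw [det_newtonMatrix]
  exact (vandermonde_pos hx).ne'.isUnit

/-- The divided differences are fixed linear combinations of the values at the nodes, with
coefficients that depend on the nodes only. -/
lemma inv_newtonMatrix_mulVec {B : ℕ → ℝ} {F : ℕ → ℝ → ℝ} (hF : IsChain (d - 1) B F)
    (hx : x ∈ weylChamber d) :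
    (newtonMatrix x)⁻¹.mulVec (fun i => F 0 (x i)) =
      fun k : Fin d => iterQuot (nodeSeq x) F k 0 (x k) := by
  rw [← newtonMatrix_mulVec_iterQuot hF x, Matrix.mulVec_mulVec,
    Matrix.nonsing_inv_mul _ (isUnit_det_newtonMatrix hx), Matrix.one_mulVec]

/-- The `i`-th divided difference is bounded by the `i`-th derivative. -/
lemma abs_inv_newtonMatrix_mulVec_le {B : ℕ → ℝ} {F : ℕ → ℝ → ℝ} (hF : IsChain (d - 1) B F)
    (hx : x ∈ weylChamber d) (i : Fin d) :
    |(newtonMatrix x)⁻¹.mulVec (fun p => F 0 (x p)) i| ≤ B i := by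
  rw [inv_newtonMatrix_mulVec hF hx]
  have h := (IsChain.iterQuot (K := d - 1 - i) (nodeSeq x) i
    (by rwa [show d - 1 - (i : ℕ) + i = d - 1 by omega])).bound 0 (by omega) (x i)
  simpa using h

/-- A family of functions `F z 0` with derivatives `F z 1, …, F z K`, measurable in the parameter
`z` and integrable with respect to it, with bounds `B 0, …, B K`. -/
structure IsMeasChain (K : ℕ) (B : ℕ → ℝ≥0∞) (F : ℝ → ℕ → ℝ → ℝ) : Prop where
  meas : ∀ j ≤ K, Measurable fun p : ℝ × ℝ => F p.1 j p.2
  bound : ∀ j ≤ K, ∀ y, ∫⁻ z, ‖F z j y‖ₑ ≤ B j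

lemma IsMeasChain.diffQuot {K : ℕ} {B : ℕ → ℝ≥0∞} {F : ℝ → ℕ → ℝ → ℝ}
    (hF : IsMeasChain (K + 1) B F) (c : ℝ) :
    IsMeasChain K (fun j => B (j + 1)) fun z => OrderedWalk.diffQuot c (F z) := by
  have hm : ∀ j ≤ K, Measurable fun p : (ℝ × ℝ) × ℝ =>
      p.2 ^ j * F p.1.1 (j + 1) (c + p.2 * (p.1.2 - c)) := fun j hj =>
    (measurable_snd.pow_const j).mul ((hF.meas (j + 1) (by omega)).comp
      ((measurable_fst.comp measurable_fst).prodMk (measurable_const.add (measurable_snd.mul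
        ((measurable_snd.comp measurable_fst).sub measurable_const)))))
  have hq : ∀ z j y, OrderedWalk.diffQuot c (F z) j y =
      ∫ t in Set.Ioc (0 : ℝ) 1, t ^ j * F z (j + 1) (c + t * (y - c)) := fun z j y =>
    intervalIntegral.integral_of_le zero_le_one
  refine ⟨fun j hj => ?_, fun j hj y => ?_⟩
  · simp_rw [hq]
    exact ((hm j hj).stronglyMeasurable.integral_prod_right').measurable
  · have hm' : Measurable fun p : ℝ × ℝ => ‖F p.1 (j + 1) (c + p.2 * (y - c))‖ₑ :=
      ((hF.meas (j + 1) (by omega)).comp (measurable_fst.prodMk (measurable_const.add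
        (measurable_snd.mul measurable_const)))).enorm
    calc ∫⁻ z, ‖OrderedWalk.diffQuot c (F z) j y‖ₑ
        ≤ ∫⁻ z, ∫⁻ t in Set.Ioc (0 : ℝ) 1, ‖F z (j + 1) (c + t * (y - c))‖ₑ := by
          refine lintegral_mono fun z => ?_
          simp only
          rw [hq]
          refine (enorm_integral_le_lintegral_enorm _).trans ?_
          refine setLIntegral_mono (hm'.comp measurable_prodMk_left) fun t ht => ?_
          rw [enorm_mul]
          refine mul_le_of_le_one_left' ?_
          rw [Real.enorm_of_nonneg (pow_nonneg ht.1.le j)]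
          exact ENNReal.ofReal_le_one.2 (pow_le_one₀ ht.1.le ht.2)
      _ = ∫⁻ t in Set.Ioc (0 : ℝ) 1, ∫⁻ z, ‖F z (j + 1) (c + t * (y - c))‖ₑ :=
          lintegral_lintegral_swap hm'.aemeasurable
      _ ≤ ∫⁻ _ in Set.Ioc (0 : ℝ) 1, B (j + 1) :=
          lintegral_mono fun t => hF.bound (j + 1) (by omega) _
      _ = B (j + 1) := by simp

lemma IsMeasChain.iterQuot {K : ℕ} {B : ℕ → ℝ≥0∞} {F : ℝ → ℕ → ℝ → ℝ} (x : ℕ → ℝ) (k : ℕ)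
    (hF : IsMeasChain (K + k) B F) :
    IsMeasChain K (fun j => B (j + k)) fun z => OrderedWalk.iterQuot x (F z) k := by
  induction k generalizing K with
  | zero => exact hF
  | succ k ih =>
    have h := (ih (K := K + 1) (by rwa [add_assoc, add_comm 1])).diffQuot (x k)
    have hB : (fun j => B (j + (k + 1))) = fun j => B (j + 1 + k) := by
      funext j; congr 1; ring
    rw [hB]
    exact h

/-- The `i`-th divided difference is bounded in `L¹` by the `i`-th derivative. -/
lemma lintegral_inv_newtonMatrix_mulVec_le {B : ℕ → ℝ≥0∞} {B' : ℕ → ℝ} {F : ℝ → ℕ → ℝ → ℝ}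
    (hF : ∀ z, IsChain (d - 1) B' (F z)) (hF' : IsMeasChain (d - 1) B F)
    (hx : x ∈ weylChamber d) (i : Fin d) :
    ∫⁻ z, ‖(newtonMatrix x)⁻¹.mulVec (fun p => F z 0 (x p)) i‖ₑ ≤ B i := by
  simp_rw [fun z => inv_newtonMatrix_mulVec (hF z) hx]
  have h := (IsMeasChain.iterQuot (K := d - 1 - i) (nodeSeq x) i
    (by rwa [show d - 1 - (i : ℕ) + i = d - 1 by omega])).bound 0 (by omega) (x i)
  simpa using h

end Bounds

end Newton

/-! ### Decay of the determinants in time -/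

section Decay

variable {d : ℕ} {lam : ℝ} {m : ℕ} {x z : Fin d → ℝ}

/-- The scale of one derivative of the Gamma density of shape `m + 1`. The factor `√(8 d)` allows
for derivatives up to order `2 d`: the divided differences use those up to order `2 d - 2`, and a
supremum bound uses one more. -/
noncomputable def scale (d : ℕ) (lam : ℝ) (m : ℕ) : ℝ :=
  Real.sqrt (4 * (2 * d : ℕ)) * (lam / Real.sqrt m)

lemma scale_nonneg (hl : 0 < lam) : 0 ≤ scale d lam m := by
  unfold scale; positivity

lemma integral_abs_gammaDeriv_le_scale (hl : 0 < lam) (hd : 1 ≤ d) (hm : 4 * d ≤ m) {k : ℕ}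
    (hk : k ≤ 2 * d) : ∫ u, |gammaDeriv lam k m u| ≤ scale d lam m ^ k :=
  integral_abs_gammaDeriv_le_sqrt hl hk (by omega) (by omega)

lemma abs_gammaDeriv_le_scale (hl : 0 < lam) (hd : 1 ≤ d) (hm : 4 * d ≤ m) {k : ℕ}
    (hk : k + 1 ≤ 2 * d) (u : ℝ) : |gammaDeriv lam k m u| ≤ scale d lam m ^ (k + 1) :=
  (abs_gammaDeriv_le_integral hl (by omega) u).trans (integral_abs_gammaDeriv_le_scale hl hd hm hk)

/-- The `l`-th derivative of the Gamma density, as a function of the starting point. -/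
noncomputable def startChain (lam : ℝ) (m l : ℕ) (z : ℝ) (j : ℕ) (y : ℝ) : ℝ :=
  (-1) ^ j * gammaDeriv lam (j + l) m (z - y)

lemma isChain_startChain (hl : 0 < lam) (hd : 1 ≤ d) (hm : 4 * d ≤ m) {l : ℕ} (hld : l ≤ d - 1)
    (z : ℝ) :
    IsChain (d - 1) (fun j => scale d lam m ^ (j + l + 1)) (startChain lam m l z) := by
  refine ⟨fun j hj => ?_, fun j hj y => ?_, fun j hj y => ?_⟩
  · exact continuous_const.mul ((continuous_gammaDeriv (by omega)).comp
      (continuous_const.sub continuous_id))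
  · have h1 : HasDerivAt (fun y : ℝ => z - y) (-1) y := by
      simpa using (hasDerivAt_id y).const_sub z
    have h2 := ((hasDerivAt_gammaDeriv (lam := lam) (k := j + l) (m := m) (by omega)
      (z - y)).comp y h1).const_mul ((-1) ^ j)
    refine h2.congr_deriv ?_
    rw [startChain, show j + 1 + l = j + l + 1 by ring]
    ring
  · rw [startChain, abs_mul, abs_pow, abs_neg, abs_one, one_pow, one_mul]
    exact abs_gammaDeriv_le_scale hl hd hm (by omega) _

/-- The `i`-th divided difference, at the nodes `x`, of `y ↦ f (z - y)` and of its derivatives. -/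
noncomputable def startDiff (lam : ℝ) (m : ℕ) (x : Fin d → ℝ) (i : Fin d) (l : ℕ) (z : ℝ) : ℝ :=
  (newtonMatrix x)⁻¹.mulVec (fun p => gammaDeriv lam l m (z - x p)) i

lemma startDiff_eq_sum (i : Fin d) (l : ℕ) (z : ℝ) : startDiff lam m x i l z =
    ∑ p, (newtonMatrix x)⁻¹ i p * gammaDeriv lam l m (z - x p) := rfl

lemma startDiff_eq (i : Fin d) (l : ℕ) (z : ℝ) : startDiff lam m x i l z =
    (newtonMatrix x)⁻¹.mulVec (fun p => startChain lam m l z 0 (x p)) i := by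
  simp [startDiff, startChain]

lemma isChain_startDiff (hl : 0 < lam) (hd : 1 ≤ d) (hm : 4 * d ≤ m) (hx : x ∈ weylChamber d)
    (i : Fin d) :
    IsChain (d - 1) (fun l => scale d lam m ^ ((i : ℕ) + l + 1)) (startDiff lam m x i) := by
  refine ⟨fun l hld => ?_, fun l hld z => ?_, fun l hld z => ?_⟩
  · simp_rw [funext (startDiff_eq_sum (lam := lam) (m := m) (x := x) i l)]
    exact continuous_finsetSum _ fun p _ => continuous_const.mul
      ((continuous_gammaDeriv (by omega)).comp (continuous_id.sub continuous_const))
  · rw [funext (startDiff_eq_sum (lam := lam) (m := m) (x := x) i l), startDiff_eq_sum]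
    refine HasDerivAt.fun_sum fun p _ => HasDerivAt.const_mul _ ?_
    exact (hasDerivAt_gammaDeriv (by omega) (z - x p)).comp_sub_const z (x p)
  · rw [startDiff_eq]
    exact abs_inv_newtonMatrix_mulVec_le (isChain_startChain hl hd hm hld z) hx i

lemma integrable_startDiff (hl : 0 < lam) (i : Fin d) :
    Integrable (startDiff lam m x i 0) := by
  rw [funext (startDiff_eq_sum (lam := lam) (m := m) (x := x) i 0)]
  exact integrable_finsetSum _ fun p _ =>
    ((integrable_gammaDeriv hl 0 m).comp_sub_right (x p)).const_mul _

lemma integral_abs_startDiff_le (hl : 0 < lam) (hd : 1 ≤ d) (hm : 4 * d ≤ m)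
    (hx : x ∈ weylChamber d) (i : Fin d) :
    ∫ z, |startDiff lam m x i 0 z| ≤ scale d lam m ^ (i : ℕ) := by
  have hs := scale_nonneg (d := d) (m := m) hl
  have hF' : IsMeasChain (d - 1) (fun j => ENNReal.ofReal (scale d lam m ^ j))
      (startChain lam m 0) := by
    refine ⟨fun j hj => ?_, fun j hj y => ?_⟩
    · exact ((measurable_gammaDeriv (j + 0) m).comp
        (measurable_fst.sub measurable_snd)).const_mul _
    · have h1 : ∀ z, ‖startChain lam m 0 z j y‖ₑ = ‖gammaDeriv lam j m (z - y)‖ₑ := fun z => by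
        simp [startChain, enorm_mul, enorm_pow]
      simp_rw [h1]
      rw [lintegral_sub_right_eq_self (fun u => ‖gammaDeriv lam j m u‖ₑ) y,
        ← ofReal_integral_norm_eq_lintegral_enorm (integrable_gammaDeriv hl j m)]
      exact ENNReal.ofReal_le_ofReal (integral_abs_gammaDeriv_le_scale hl hd hm (by omega))
  have h := lintegral_inv_newtonMatrix_mulVec_le
    (fun z => isChain_startChain hl hd hm (Nat.zero_le _) z) hF' hx i
  simp_rw [← startDiff_eq] at h
  rw [← ofReal_integral_norm_eq_lintegral_enorm (integrable_startDiff hl i)] at h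
  exact (ENNReal.ofReal_le_ofReal_iff (by positivity)).1 h

lemma kernDet_eq_mul_det_startDiff (hx : x ∈ weylChamber d) (z : Fin d → ℝ) :
    kernDet lam m x z =
      vandermonde x * (Matrix.of fun i j => startDiff lam m x i 0 (z j)).det := by
  have h : (Matrix.of fun i j => gammaDens lam m (z j - x i)) =
      newtonMatrix x * Matrix.of fun i j => startDiff lam m x i 0 (z j) := by
    have h1 : (Matrix.of fun i j => startDiff lam m x i 0 (z j)) =
        (newtonMatrix x)⁻¹ * Matrix.of fun i j => gammaDens lam m (z j - x i) := rfl
    rw [h1, Matrix.mul_nonsing_inv_cancel_left _ _ (isUnit_det_newtonMatrix hx)]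
  rw [kernDet, h, Matrix.det_mul, det_newtonMatrix]

lemma det_eq_mul_det_inv_newtonMatrix (hz : z ∈ weylChamber d) (f : Fin d → ℝ → ℝ) :
    (Matrix.of fun i j => f i (z j)).det = vandermonde z *
      (Matrix.of fun j i => (newtonMatrix z)⁻¹.mulVec (fun p => f i (z p)) j).det := by
  have h : (Matrix.of fun i j => f i (z j)).transpose =
      newtonMatrix z * Matrix.of fun j i => (newtonMatrix z)⁻¹.mulVec (fun p => f i (z p)) j := by
    have h1 : (Matrix.of fun j i => (newtonMatrix z)⁻¹.mulVec (fun p => f i (z p)) j) =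
        (newtonMatrix z)⁻¹ * (Matrix.of fun i j => f i (z j)).transpose := rfl
    rw [h1, Matrix.mul_nonsing_inv_cancel_left _ _ (isUnit_det_newtonMatrix hz)]
  rw [← Matrix.det_transpose, h, Matrix.det_mul, det_newtonMatrix]

lemma abs_det_le_sum (A : Matrix (Fin d) (Fin d) ℝ) :
    |A.det| ≤ ∑ σ : Equiv.Perm (Fin d), ∏ i, |A (σ i) i| := by
  rw [Matrix.det_apply']
  refine (Finset.abs_sum_le_sum_abs _ _).trans (Finset.sum_le_sum fun σ _ => ?_)
  rw [abs_mul, Finset.abs_prod]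
  have : |((Equiv.Perm.sign σ : ℤ) : ℝ)| = 1 := by
    rcases Int.units_eq_one_or (Equiv.Perm.sign σ) with h | h <;> simp [h]
  rw [this, one_mul]

lemma sum_perm_val (σ : Equiv.Perm (Fin d)) :
    ∑ i : Fin d, (σ i : ℕ) = ∑ i ∈ Finset.range d, i := by
  rw [Equiv.sum_comp σ fun i : Fin d => (i : ℕ), Finset.sum_range]

lemma sum_perm_val_add (σ : Equiv.Perm (Fin d)) :
    ∑ i : Fin d, ((i : ℕ) + (σ i : ℕ) + 1) = d ^ 2 := by
  rw [Finset.sum_add_distrib, Finset.sum_add_distrib, sum_perm_val σ,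
    show ∑ i : Fin d, (i : ℕ) = ∑ i ∈ Finset.range d, i from
      (Finset.sum_range fun i => i).symm]
  have h := Finset.sum_range_id_mul_two d
  rcases d with _ | e
  · simp
  · simp only [Nat.add_sub_cancel] at h
    simp only [Finset.sum_const, Finset.card_univ, Fintype.card_fin, smul_eq_mul, mul_one]
    nlinarith

/-- Taking divided differences in the starting points and in the end points, the determinant is
`Δ(x) Δ(z)` times a determinant of divided differences, each bounded by a derivative of the
density. -/
lemma kernDet_le_scale (hl : 0 < lam) (hd : 1 ≤ d) (hm : 4 * d ≤ m) (hx : x ∈ weylChamber d)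
    (hz : z ∈ weylChamber d) :
    kernDet lam m x z ≤ d.factorial * scale d lam m ^ d ^ 2 * vandermonde x * vandermonde z := by
  have hvx := (vandermonde_pos hx).le
  have hvz := (vandermonde_pos hz).le
  rw [kernDet_eq_mul_det_startDiff hx, det_eq_mul_det_inv_newtonMatrix hz]
  set A : Matrix (Fin d) (Fin d) ℝ := Matrix.of fun j i =>
    (newtonMatrix z)⁻¹.mulVec (fun p => startDiff lam m x i 0 (z p)) j with hA
  have hAb : ∀ j i, |A j i| ≤ scale d lam m ^ ((i : ℕ) + j + 1) := fun j i =>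
    abs_inv_newtonMatrix_mulVec_le (isChain_startDiff hl hd hm hx i) hz j
  have hdet : |A.det| ≤ d.factorial * scale d lam m ^ d ^ 2 := by
    refine (abs_det_le_sum A).trans ?_
    calc ∑ σ : Equiv.Perm (Fin d), ∏ i, |A (σ i) i|
        ≤ ∑ σ : Equiv.Perm (Fin d), ∏ i : Fin d, scale d lam m ^ ((i : ℕ) + (σ i : ℕ) + 1) :=
          Finset.sum_le_sum fun σ _ => Finset.prod_le_prod (fun i _ => abs_nonneg _)
            fun i _ => hAb _ _
      _ = ∑ _σ : Equiv.Perm (Fin d), scale d lam m ^ d ^ 2 := by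
          refine Finset.sum_congr rfl fun σ _ => ?_
          rw [Finset.prod_pow_eq_pow_sum, sum_perm_val_add]
      _ = _ := by
          rw [Finset.sum_const, Finset.card_univ, Fintype.card_perm, Fintype.card_fin,
            nsmul_eq_mul]
  calc vandermonde x * (vandermonde z * A.det)
      ≤ vandermonde x * (vandermonde z * (d.factorial * scale d lam m ^ d ^ 2)) := by
        gcongr
        exact (le_abs_self _).trans hdet
    _ = _ := by ring

/-- Divided differences in the starting points only bound the total mass of the density. -/
lemma setLIntegral_kernDet_le (hl : 0 < lam) (hd : 1 ≤ d) (hm : 4 * d ≤ m)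
    (hx : x ∈ weylChamber d) :
    ∫⁻ z in weylChamber d, ENNReal.ofReal (kernDet lam m x z) ≤
      ENNReal.ofReal (d.factorial * scale d lam m ^ (∑ i ∈ Finset.range d, i) *
        vandermonde x) := by
  have hvx := (vandermonde_pos hx).le
  have hs := scale_nonneg (d := d) (m := m) hl
  have hint : ∀ σ : Equiv.Perm (Fin d), Integrable fun z : Fin d → ℝ =>
      ∏ i, |startDiff lam m x (σ i) 0 (z i)| := fun σ =>
    Integrable.fintype_prod (f := fun i t => |startDiff lam m x (σ i) 0 t|)
      fun i => (integrable_startDiff hl (σ i)).abs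
  have hsum : Integrable fun z : Fin d → ℝ => vandermonde x *
      ∑ σ : Equiv.Perm (Fin d), ∏ i, |startDiff lam m x (σ i) 0 (z i)| :=
    (integrable_finsetSum _ fun σ _ => hint σ).const_mul _
  calc ∫⁻ z in weylChamber d, ENNReal.ofReal (kernDet lam m x z)
      ≤ ∫⁻ z : Fin d → ℝ, ENNReal.ofReal (vandermonde x *
          ∑ σ : Equiv.Perm (Fin d), ∏ i, |startDiff lam m x (σ i) 0 (z i)|) := by
        refine (setLIntegral_le_lintegral _ _).trans (lintegral_mono fun z => ?_)
        refine ENNReal.ofReal_le_ofReal ?_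
        rw [kernDet_eq_mul_det_startDiff hx]
        gcongr
        exact (le_abs_self _).trans (abs_det_le_sum _)
    _ = ENNReal.ofReal (vandermonde x *
          ∑ σ : Equiv.Perm (Fin d), ∏ i, ∫ t, |startDiff lam m x (σ i) 0 t|) := by
        rw [← ofReal_integral_eq_lintegral_ofReal hsum (Filter.Eventually.of_forall fun z =>
          mul_nonneg hvx (Finset.sum_nonneg fun σ _ => Finset.prod_nonneg fun i _ =>
            abs_nonneg _)), integral_const_mul, integral_finsetSum _ fun σ _ => hint σ]
        congr 2
        refine Finset.sum_congr rfl fun σ _ => ?_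
        exact integral_fintype_prod_volume_eq_prod fun i t => |startDiff lam m x (σ i) 0 t|
    _ ≤ _ := by
        refine ENNReal.ofReal_le_ofReal ?_
        rw [mul_comm]
        gcongr
        calc ∑ σ : Equiv.Perm (Fin d), ∏ i, ∫ t, |startDiff lam m x (σ i) 0 t|
            ≤ ∑ σ : Equiv.Perm (Fin d), ∏ i : Fin d, scale d lam m ^ (σ i : ℕ) :=
              Finset.sum_le_sum fun σ _ => Finset.prod_le_prod
                (fun i _ => integral_nonneg fun t => abs_nonneg _)
                fun i _ => integral_abs_startDiff_le hl hd hm hx _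
          _ = ∑ _σ : Equiv.Perm (Fin d), scale d lam m ^ (∑ i ∈ Finset.range d, i) := by
              refine Finset.sum_congr rfl fun σ _ => ?_
              rw [Finset.prod_pow_eq_pow_sum, sum_perm_val]
          _ = _ := by
              rw [Finset.sum_const, Finset.card_univ, Fintype.card_perm, Fintype.card_fin,
                nsmul_eq_mul]

lemma ascWord_pow_one_le_scale [hl : Fact (0 < lam)] (hd : 1 ≤ d) (hm : 4 * d ≤ m)
    (hx : x ∈ weylChamber d) :
    ((ascWord (jumpOp lam) d ^ (m + 1) : Op d) (oneFun d)).1 x ≤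
      ENNReal.ofReal (d.factorial * scale d lam m ^ (∑ i ∈ Finset.range d, i) *
        vandermonde x) := by
  rw [ascWord_pow_succ_apply (by omega) (oneFun d) (fun _ => le_rfl) hx]
  refine le_trans (le_of_eq ?_) (setLIntegral_kernDet_le hl.out hd hm hx)
  exact lintegral_congr fun z => one_mul _

end Decay

/-! ### Bounds for all times -/

section AllTimes

variable {d : ℕ} {lam : ℝ}

/-- The constant in front of `(lam / √n) ^ s`. The first summand serves times `m + 1` with
`m ≥ 4 d`, where `scale d lam m ≤ √(16 d) lam / √(m + 1)`; the second one serves times up to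
`4 d`, where `1 ≤ √(4 d) / √n`. -/
noncomputable def decayConst (d s : ℕ) : ℝ :=
  d.factorial * Real.sqrt (16 * d) ^ s + Real.sqrt (4 * d) ^ s

lemma decayConst_nonneg (d s : ℕ) : 0 ≤ decayConst d s := by
  unfold decayConst; positivity

lemma scale_pow_le_decayConst (hl : 0 < lam) (s : ℕ) {m : ℕ} (hm : 1 ≤ m) :
    d.factorial * scale d lam m ^ s ≤ decayConst d s * (lam / Real.sqrt (m + 1 : ℕ)) ^ s := by
  have hm0 : (0 : ℝ) < m := by exact_mod_cast hm
  have hsm := Real.sqrt_pos.2 hm0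
  have hsm1 : 0 < Real.sqrt (m + 1 : ℕ) := Real.sqrt_pos.2 (by positivity)
  have h1 : scale d lam m ≤ Real.sqrt (16 * d) * (lam / Real.sqrt (m + 1 : ℕ)) := by
    have h2 : Real.sqrt (m + 1 : ℕ) ≤ Real.sqrt 2 * Real.sqrt m := by
      rw [← Real.sqrt_mul (by norm_num)]
      refine Real.sqrt_le_sqrt ?_
      have : (1 : ℝ) ≤ m := by exact_mod_cast hm
      push_cast; linarith
    have h3 : lam / Real.sqrt m ≤ Real.sqrt 2 * (lam / Real.sqrt (m + 1 : ℕ)) := by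
      rw [← mul_div_assoc, div_le_div_iff₀ hsm hsm1]
      nlinarith
    have h4 : Real.sqrt (16 * d) = Real.sqrt (4 * (2 * d : ℕ)) * Real.sqrt 2 := by
      rw [← Real.sqrt_mul (by positivity)]
      congr 1; push_cast; ring
    rw [scale, h4, mul_assoc]
    gcongr
  have h0 := scale_nonneg (d := d) (m := m) hl
  calc d.factorial * scale d lam m ^ s
      ≤ d.factorial * (Real.sqrt (16 * d) * (lam / Real.sqrt (m + 1 : ℕ))) ^ s := by gcongr
    _ = d.factorial * Real.sqrt (16 * d) ^ s * (lam / Real.sqrt (m + 1 : ℕ)) ^ s := by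
        rw [mul_pow]; ring
    _ ≤ _ := by
        unfold decayConst
        gcongr
        exact le_add_of_nonneg_right (by positivity)

lemma pow_le_decayConst (hl : 0 < lam) (s : ℕ) {n : ℕ} (hn : 1 ≤ n) (hnd : n ≤ 4 * d) :
    lam ^ s ≤ decayConst d s * (lam / Real.sqrt n) ^ s := by
  have hn0 : (0 : ℝ) < n := by exact_mod_cast hn
  have hsn := Real.sqrt_pos.2 hn0
  have h1 : lam ≤ Real.sqrt (4 * d) * (lam / Real.sqrt n) := by
    have h2 : Real.sqrt n ≤ Real.sqrt (4 * d) := Real.sqrt_le_sqrt (by exact_mod_cast hnd)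
    rw [← mul_div_assoc, le_div_iff₀ hsn]
    nlinarith
  calc lam ^ s ≤ (Real.sqrt (4 * d) * (lam / Real.sqrt n)) ^ s := by gcongr
    _ = Real.sqrt (4 * d) ^ s * (lam / Real.sqrt n) ^ s := mul_pow _ _ _
    _ ≤ _ := by
        unfold decayConst
        gcongr
        exact le_add_of_nonneg_left (by positivity)

variable [hl : Fact (0 < lam)] {x z : Fin d → ℝ}

lemma kernDet_le_decay (hd : 1 ≤ d) {m : ℕ} (hm : 1 ≤ m) (hdm : d ≤ m + 1)
    (hx : x ∈ weylChamber d) (hz : z ∈ weylChamber d) :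
    kernDet lam m x z ≤ decayConst d (d ^ 2) * (lam / Real.sqrt (m + 1 : ℕ)) ^ d ^ 2 *
      vandermonde x * vandermonde z := by
  have hvx := (vandermonde_pos hx).le
  have hvz := (vandermonde_pos hz).le
  rcases le_or_gt (4 * d) m with h | h
  · refine (kernDet_le_scale hl.out hd h hx hz).trans ?_
    gcongr ?_ * _ * _
    exact scale_pow_le_decayConst hl.out _ hm
  · refine (kernDet_le_uniform hd hm hdm hx hz).trans ?_
    gcongr
    exact pow_le_decayConst hl.out _ (by omega) (by omega)

lemma ascWord_pow_one_le_decay (hd : 1 ≤ d) {n : ℕ} (hn : 1 ≤ n) (hdn : d - 1 ≤ n)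
    (hx : x ∈ weylChamber d) :
    ((ascWord (jumpOp lam) d ^ n : Op d) (oneFun d)).1 x ≤
      ENNReal.ofReal (decayConst d (∑ i ∈ Finset.range d, i) *
        (lam / Real.sqrt n) ^ (∑ i ∈ Finset.range d, i) * vandermonde x) := by
  have hvx := (vandermonde_pos hx).le
  obtain ⟨m, rfl⟩ : ∃ m, n = m + 1 := ⟨n - 1, by omega⟩
  rcases le_or_gt (4 * d) m with h | h
  · refine (ascWord_pow_one_le_scale hd h hx).trans (ENNReal.ofReal_le_ofReal ?_)
    gcongr ?_ * _
    exact scale_pow_le_decayConst hl.out _ (by omega)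
  · obtain ⟨k, hk⟩ := Nat.exists_eq_add_of_le hdn
    rw [hk]
    refine (ascWord_pow_one_le_uniform hd k hx).trans ?_
    rw [← ENNReal.ofReal_pow hl.out.le, ← ENNReal.ofReal_mul (pow_nonneg hl.out.le _), ← hk]
    refine ENNReal.ofReal_le_ofReal ?_
    gcongr
    exact pow_le_decayConst hl.out _ (by omega) (by omega)

lemma descTop_pow_one_le_decay (hd : 1 ≤ d) {k : ℕ} (hk : 1 ≤ k) (hx : x ∈ weylChamber d) :
    ((descTop (jumpOp lam) d d ^ (d - 1 + k) : Op d) (oneFun d)).1 x ≤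
      ENNReal.ofReal (decayConst d (∑ i ∈ Finset.range d, i) *
        (lam / Real.sqrt k) ^ (∑ i ∈ Finset.range d, i) * harm lam x) := by
  have hh := harm_nonneg (lam := lam) hd hx
  have hl0 := hl.out.le
  have hc := decayConst_nonneg d (∑ i ∈ Finset.range d, i)
  rcases le_or_gt k (4 * d) with h | h
  · refine (descTop_pow_one_le_uniform hd k hx).trans ?_
    rw [← ENNReal.ofReal_pow hl0, ← ENNReal.ofReal_mul (pow_nonneg hl0 _)]
    refine ENNReal.ofReal_le_ofReal ?_
    gcongr
    exact pow_le_decayConst hl.out _ hk h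
  · rw [ENNReal.ofReal_mul (by positivity)]
    refine descTop_pow_one_le hd k (fun y hy => ?_) hx
    rw [← ENNReal.ofReal_mul (by positivity)]
    exact (ascWord_pow_triWord_one_le k hy).trans
      (ascWord_pow_one_le_decay hd hk (by omega) hy)

end AllTimes

section Law

variable {d : ℕ} {lam : ℝ} {Ω : Type*} [MeasurableSpace Ω] {μ : Measure Ω}
  [IsProbabilityMeasure μ] {X : ℕ → Fin d → Ω → ℝ} {x : Fin d → ℝ}

omit [IsProbabilityMeasure μ] in
lemma real_le_of_killedLaw_le (hX : ∀ i j, Measurable (X i j)) (x : Fin d → ℝ) {n : ℕ} {A : Set Ω}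
    {w : Op d} (h : ∀ {B : Set (Fin d → ℝ)} (hB : MeasurableSet B),
      killedLaw μ X x n A B = (w (indFun hB)).1 x) {r : ℝ} (hr : 0 ≤ r)
    (hle : (w (oneFun d)).1 x ≤ ENNReal.ofReal r) : μ.real A ≤ r := by
  have h1 : indFun (MeasurableSet.univ : MeasurableSet (Set.univ : Set (Fin d → ℝ))) =
      oneFun d := by
    apply Subtype.ext
    exact Set.indicator_univ _
  refine ENNReal.toReal_le_of_le_ofReal hr ?_
  rw [measure_eq_killedLaw_univ hX x n A, h MeasurableSet.univ, h1]
  exact hle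

omit [MeasurableSpace Ω] [IsProbabilityMeasure μ] in
lemma isContinuousDensity_of_indFun {ν : Measure (Fin d → ℝ)} {w : Op d}
    (h : ∀ {B : Set (Fin d → ℝ)} (hB : MeasurableSet B), ν B = (w (indFun hB)).1 x)
    {g : (Fin d → ℝ) → ℝ} (hg : Continuous g) (hpos : ∀ z ∈ weylChamber d, 0 ≤ g z)
    (hw : ∀ φ : MFun d, (∀ z, φ.1 z ≤ 1) →
      (w φ).1 x = ∫⁻ z in weylChamber d, φ.1 z * ENNReal.ofReal (g z)) :
    IsContinuousDensity ν g := by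
  refine ⟨hg.continuousOn, hpos, Measure.ext fun B hB => ?_⟩
  rw [h hB, hw _ (fun z => Set.indicator_le_self' (fun _ _ => bot_le) z),
    withDensity_apply _ hB, ← lintegral_indicator hB]
  refine lintegral_congr fun z => ?_
  by_cases hz : z ∈ B <;> simp [indFun, hz]

end Law

lemma rpow_half_eq_sqrt_pow (n s : ℕ) (t : ℝ) (ht : t = s / 2) :
    (n : ℝ) ^ t = Real.sqrt n ^ s := by
  rw [ht, Real.sqrt_eq_rpow, ← Real.rpow_natCast, ← Real.rpow_mul (Nat.cast_nonneg n)]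
  congr 1; ring

end OrderedWalk

open OrderedWalk

theorem mainTheorem6 (d : ℕ) (hd : 1 ≤ d) :
    ∃ C : ℝ, 0 < C ∧
      ∀ (lam : ℝ), 0 < lam →
      ∀ (Ω : Type*) [MeasurableSpace Ω] (μ : Measure Ω) [IsProbabilityMeasure μ]
        (X : ℕ → Fin d → Ω → ℝ),
        (∀ i j, Measurable (X i j)) →
        (∀ i j, μ.map (X i j) = expMeasure lam) →
        iIndepFun (fun p : ℕ × Fin d => X p.1 p.2) μ →
      ∀ x ∈ OrderedWalk.weylChamber d, ∀ n : ℕ, d + 1 ≤ n →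
        -- tail bounds
        μ.real (OrderedWalk.tauGt X x n) ≤
          C * lam ^ ((d : ℝ) * ((d : ℝ) - 1) / 2) * OrderedWalk.harm lam x
            / (n : ℝ) ^ ((d : ℝ) * ((d : ℝ) - 1) / 4) ∧
        μ.real (OrderedWalk.rhoGt X x n) ≤
          C * lam ^ ((d : ℝ) * ((d : ℝ) - 1) / 2) * OrderedWalk.vandermonde x
            / (n : ℝ) ^ ((d : ℝ) * ((d : ℝ) - 1) / 4) ∧
        -- the killed density `G_{n+d}(x, ·)`
        (∃ G : (Fin d → ℝ) → ℝ,
          OrderedWalk.IsContinuousDensity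
            (OrderedWalk.killedLaw μ X x (n + d) (OrderedWalk.tauGt X x (n + d))) G ∧
          ∀ z ∈ OrderedWalk.weylChamber d,
            G z ≤ C * lam ^ (d ^ 2) * OrderedWalk.harm lam x * OrderedWalk.harmHat lam z
              / (n : ℝ) ^ ((d : ℝ) ^ 2 / 2)) ∧
        -- the killed density of the interlaced walk at time `n`
        (∃ G' : (Fin d → ℝ) → ℝ,
          OrderedWalk.IsContinuousDensity
            (OrderedWalk.killedLaw μ X x n (OrderedWalk.rhoGt X x n)) G' ∧
          ∀ z ∈ OrderedWalk.weylChamber d,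
            G' z ≤ C * lam ^ (d ^ 2) * OrderedWalk.vandermonde x * OrderedWalk.vandermonde z
              / (n : ℝ) ^ ((d : ℝ) ^ 2 / 2)) := by
  set s := ∑ i ∈ Finset.range d, i with hs
  have hs2 : (s : ℝ) * 2 = d * ((d : ℝ) - 1) := by
    have h := Finset.sum_range_id_mul_two d
    rw [← hs] at h
    have h' : ((s * 2 : ℕ) : ℝ) = ((d * (d - 1) : ℕ) : ℝ) := by rw [h]
    push_cast [Nat.cast_sub hd] at h'
    exact h'
  have hc1 := decayConst_nonneg d s
  have hc2 := decayConst_nonneg d (d ^ 2)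
  have hsd : 1 ≤ Real.sqrt d ^ s := one_le_pow₀ (Real.one_le_sqrt.2 (by exact_mod_cast hd))
  set C := 1 + decayConst d s * Real.sqrt d ^ s + decayConst d (d ^ 2) with hC
  have hC1 : decayConst d s * Real.sqrt d ^ s ≤ C := by rw [hC]; linarith
  have hC2 : decayConst d s ≤ C := (le_mul_of_one_le_right hc1 hsd).trans hC1
  have hC3 : decayConst d (d ^ 2) ≤ C := by
    have : 0 ≤ decayConst d s * Real.sqrt d ^ s := by positivity
    rw [hC]; linarith
  refine ⟨C, by positivity, ?_⟩
  intro lam hlam Ω _ μ _ X hX hlaw hind x hx n hn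
  have : Fact (0 < lam) := ⟨hlam⟩
  have hd0 : 0 < d := hd
  have hn0 : (0 : ℝ) < n := by exact_mod_cast (by omega : 0 < n)
  have hsn := Real.sqrt_pos.2 hn0
  have hvx := (vandermonde_pos hx).le
  have hhx := harm_nonneg (lam := lam) hd hx
  rw [show (d : ℝ) * ((d : ℝ) - 1) / 2 = (s : ℝ) by linarith, Real.rpow_natCast,
    rpow_half_eq_sqrt_pow n s _ (by linarith), rpow_half_eq_sqrt_pow n (d ^ 2) _ (by push_cast; rfl)]
  refine ⟨?_, ?_, ⟨tauDens lam n x, ?_, fun z hz => ?_⟩, ⟨kernDet lam (n - 1) x, ?_, fun z hz => ?_⟩⟩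
  · obtain ⟨k, rfl⟩ : ∃ k, n = d - 1 + k := ⟨n - (d - 1), by omega⟩
    have hk : 1 ≤ k := by omega
    refine real_le_of_killedLaw_le hX x (killedLaw_tauGt_apply hd0 hX hlaw hind hx _)
      (by positivity) ((descTop_pow_one_le_decay hd hk hx).trans (ENNReal.ofReal_le_ofReal ?_))
    have hk0 : (0 : ℝ) < k := by exact_mod_cast hk
    have hsk := Real.sqrt_pos.2 hk0
    -- the time lost in the exchange of sweeps costs a constant factor
    have h1 : lam / Real.sqrt k ≤ Real.sqrt d * (lam / Real.sqrt (d - 1 + k : ℕ)) := by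
      have h2 : Real.sqrt (d - 1 + k : ℕ) ≤ Real.sqrt d * Real.sqrt k := by
        rw [← Real.sqrt_mul (by positivity)]
        refine Real.sqrt_le_sqrt ?_
        have : d - 1 + k ≤ d * k := by
          obtain ⟨e, rfl⟩ : ∃ e, d = e + 1 := ⟨d - 1, by omega⟩
          simp only [Nat.add_sub_cancel]
          nlinarith
        exact_mod_cast this
      rw [← mul_div_assoc, div_le_div_iff₀ hsk hsn]
      nlinarith
    calc decayConst d s * (lam / Real.sqrt k) ^ s * harm lam x
        ≤ decayConst d s * (Real.sqrt d * (lam / Real.sqrt (d - 1 + k : ℕ))) ^ s * harm lam x := by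
          gcongr
      _ = decayConst d s * Real.sqrt d ^ s * lam ^ s * harm lam x /
            Real.sqrt (d - 1 + k : ℕ) ^ s := by
          rw [mul_pow, div_pow]; ring
      _ ≤ _ := by gcongr
  · refine real_le_of_killedLaw_le hX x (killedLaw_rhoGt_apply hd0 hX hlaw hind hx _)
      (by positivity) ((ascWord_pow_one_le_decay hd (by omega) (by omega) hx).trans
        (ENNReal.ofReal_le_ofReal ?_))
    calc decayConst d s * (lam / Real.sqrt n) ^ s * vandermonde x
        = decayConst d s * lam ^ s * vandermonde x / Real.sqrt n ^ s := by rw [div_pow]; ring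
      _ ≤ _ := by gcongr
  · refine isContinuousDensity_of_indFun (killedLaw_tauGt_apply hd0 hX hlaw hind hx _)
      (continuous_tauDens (by omega) x) (fun z hz => tauDens_nonneg hd (by omega) hx hz)
      fun φ hφ => ?_
    rw [add_comm n d]
    exact descTop_pow_apply hd (by omega) hx φ hφ
  · have hhz : 0 ≤ harmHat lam z := harm_nonneg (lam := lam) hd (refl_mem hz)
    refine (tauDens_le hd (by omega) hx
      (fun y hy v hv => kernDet_le_decay hd (by omega) (by omega) hy hv) hz).trans ?_
    have h1 : lam / Real.sqrt (n + 1 : ℕ) ≤ lam / Real.sqrt n := by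
      gcongr
      exact_mod_cast Nat.le_succ n
    calc decayConst d (d ^ 2) * (lam / Real.sqrt (n + 1 : ℕ)) ^ d ^ 2 * harm lam x * harmHat lam z
        ≤ decayConst d (d ^ 2) * (lam / Real.sqrt n) ^ d ^ 2 * harm lam x * harmHat lam z := by
          gcongr
      _ = decayConst d (d ^ 2) * lam ^ d ^ 2 * harm lam x * harmHat lam z /
            Real.sqrt n ^ d ^ 2 := by rw [div_pow]; ring
      _ ≤ _ := by gcongr
  · refine isContinuousDensity_of_indFun (killedLaw_rhoGt_apply hd0 hX hlaw hind hx _)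
      ((continuous_kernDet (by omega)).comp (Continuous.prodMk_right x))
      (fun z hz => kernDet_nonneg (by omega) hx hz) fun φ hφ => ?_
    have h := ascWord_pow_succ_apply (lam := lam) (m := n - 1) (by omega) φ hφ hx
    rwa [show n - 1 + 1 = n by omega] at h
  · have hvz := (vandermonde_pos hz).le
    have h := kernDet_le_decay (lam := lam) hd (m := n - 1) (by omega) (by omega) hx hz
    rw [show n - 1 + 1 = n by omega] at h
    refine h.trans ?_
    calc decayConst d (d ^ 2) * (lam / Real.sqrt n) ^ d ^ 2 * vandermonde x * vandermonde z
        = decayConst d (d ^ 2) * lam ^ d ^ 2 * vandermonde x * vandermonde z /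
            Real.sqrt n ^ d ^ 2 := by rw [div_pow]; ring
      _ ≤ _ := by gcongr
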